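/- Let $T>0$, $M\ge 0$ and let $K\subset\mathbb R^d$ be compact. Let $X_{M,K}$ be the set of $b\in W^{2,\infty}(\mathbb R^d)$ with $\operatorname{supp} b\subseteq K$ and $\|b\|_\infty+\|\nabla b\|_\infty+\|\nabla^2 b\|_\infty\le M$ (each $b$ is identified with its $C^1$ representative). Let $\mathcal P^2(\mathbb R^d)$ be the probability measures with finite second moment, with the $2$-Wasserstein distance $d_2$. For a potential $b$, the $N$-particle system driven by $b$ is $$\dot{x}_i(t)=-\frac1N\sum_{j\ne i}\nabla b\big(x_i(t)-x_j(t)\big),\qquad i=1,\dots,N,\quad t\in[0,T],$$ and the aggregation equation driven by $b$ is $\partial_t\mu=\nabla\cdot(\mu\,(\nabla b*\mu))$, whose solutions are weak solutions $\mu\in C([0,T],\mathcal P^2(\mathbb R^d))$. Let $W\in X_{M,K}$ (the true potential). For a curve of measures $\mu=(\mu_t)_{t\in[0,T]}$ put $$\tilde{\mathcal E}_\mu(\Psi)=\frac1T\int_0^T\int_{\mathbb R^d}\big|(\nabla\Psi*\mu_t)(x)-(\nabla W*\mu_t)(x)\big|^2\,d\mu_t(x)\,dt .$$ Let $A^N\subseteq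 X_{M,K}$, $N\in\mathbb N$, have the uniform approximating property: for every $b\in X_{M,K}$ there are $b^N\in A^N$ with $b^N\to b$ uniformly on $K$. Let $\mu^N_t=\frac1N\sum_{i=1}^N\delta_{y^N_i(t)}$, where $y^N$ solves the $N$-particle system driven by $U^N$, and either $U^N=W$ for all $N$ (the observed trajectories are those of the true system) or $U^N=\widehat W^N$ for all $N$ (they are those of the estimated system). Let $\widehat W^N\in A^N$ minimize $\tilde{\mathcal E}_N:=\tilde{\mathcal E}_{\mu^N}$ over $A^N$, and suppose that $\widehat W^N\to\overline W\in X_{M,K}$ uniformly on $K$. Let $\widehat\mu(0)\in\mathcal P^2(\mathbb R^d)$ have compact support, let the empirical measures $\widehat\mu^N(0)=\frac1N\sum_{i=1}^N\delta_{x^N_{0,i}}$ satisfy $d_2(\widehat\mu^N(0),\widehat\mu(0))\to0$, let $x^N$ be the solution of the $N$-particle system driven by $\widehat W^N$ with $x^N_i(0)=x^N_{0,i}$, and let $\widehat\mu^N_t=\frac1N\sum_{i=1}^N\delta_{x^N_i(t)}$. Then: 1. (Mean-field limit.) The equation $\partial_t\widehat\mu=\nabla\cdot(\widehat\mu\,(\nabla\overline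 W*\widehat\mu))$ has a unique weak solution $\widehat\mu\in C([0,T],\mathcal P^2(\mathbb R^d))$ with initial datum $\widehat\mu(0)$, and $\sup_{t\in[0,T]}d_2(\widehat\mu^N_t,\widehat\mu_t)\to0$ as $N\to\infty$. 2. (Identification.) Let $\mu\in C([0,T],\mathcal P^2(\mathbb R^d))$ be a weak solution of the aggregation equation driven by the true potential $W$ with $\mu(0)=\widehat\mu(0)$, and suppose that $d_2(\mu^N_0,\mu(0))\to0$. (a) If the coercivity condition $c_T\,\frac1T\int_0^T\|(\nabla\overline W-\nabla W)*\mu_t\|^2_{L^2(\mu_t)}\,dt\le\tilde{\mathcal E}_\mu(\overline W)$ holds for some $c_T>0$, then $W=\overline W$ in $L^2(\mu)$, in the sense of the norm in that condition: $\nabla\overline W*\mu_t=\nabla W*\mu_t$ $\mu_t$-a.e. for every $t\in[0,T]$; moreover $\widehat\mu_t=\mu_t$ for every $t\in[0,T]$. (b) If the coercivity condition holds at the level of the interaction kernels, that is, $c_T\,\frac1T\int_0^T\iint|\nabla\overline W(x-y)-\nabla W(x-y)|^2\,d\mu_t(y)\,d\mu_t(x)\,dt\le\tilde{\mathcal E}_\mu(\overline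 W)$ for some $c_T>0$, then $\nabla\overline W(x-y)=\nabla W(x-y)$ for $\mu_t\otimes\mu_t$-a.e. $(x,y)$, for every $t\in[0,T]$. -/

import Mathlib

open Set Filter Topology MeasureTheory
open scoped NNReal ENNReal ContDiff Gradient

noncomputable section

/-- The Euclidean space `ℝ^d`. -/
abbrev RSpace (d : ℕ) : Type := EuclideanSpace ℝ (Fin d)

/-! ### The class of admissible potentials -/

/-- `g` is the weak (distributional) partial derivative of `f` in the direction of the `i`-th
coordinate: `∫ f ∂ᵢφ = - ∫ g φ` for all test functions `φ`. -/
def HasWeakPartialDeriv {d : ℕ} (i : Fin d) (f g : RSpace d → ℝ) : Prop :=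
  LocallyIntegrable f ∧ LocallyIntegrable g ∧
    ∀ φ : RSpace d → ℝ, ContDiff ℝ ∞ φ → HasCompactSupport φ →
      ∫ x, f x * fderiv ℝ φ x (EuclideanSpace.single i 1) = - ∫ x, g x * φ x

/-- `H` is the weak Hessian of `b`. The Euclidean norm of `H x` is the Frobenius norm of the
Hessian matrix with entries `H x (i, j)`. -/
def HasWeakHessian {d : ℕ} (b : RSpace d → ℝ)
    (H : RSpace d → EuclideanSpace ℝ (Fin d × Fin d)) : Prop :=
  ∀ i j : Fin d, HasWeakPartialDeriv j (fun x => (∇ b x) i) (fun x => H x (i, j))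

/-- The class `X_{M,K}`: potentials `b ∈ W^{2,∞}(ℝ^d)` with support in `K` and
`‖b‖_∞ + ‖∇b‖_∞ + ‖∇²b‖_∞ ≤ M`. An element of `W^{2,∞}` is represented by its (unique)
continuously differentiable representative. -/
def XClass {d : ℕ} (M : ℝ≥0) (K : Set (RSpace d)) : Set (RSpace d → ℝ) :=
  {b | ContDiff ℝ 1 b ∧ tsupport b ⊆ K ∧
    ∃ H : RSpace d → EuclideanSpace ℝ (Fin d × Fin d), HasWeakHessian b H ∧
      eLpNorm b ⊤ volume + eLpNorm (∇ b) ⊤ volume + eLpNorm H ⊤ volume ≤ M}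

/-- The uniform approximating property of a family `A^N` in the class `X`: every `b ∈ X` is the
uniform limit on `K` of some sequence `b^N ∈ A^N`. -/
def UniformlyApproximating {d : ℕ} (K : Set (RSpace d)) (X : Set (RSpace d → ℝ))
    (A : ℕ → Set (RSpace d → ℝ)) : Prop :=
  ∀ b ∈ X, ∃ β : ℕ → RSpace d → ℝ, (∀ N, β N ∈ A N) ∧ TendstoUniformlyOn β b atTop K

/-! ### The Wasserstein distance -/

/-- The set of transport plans between `μ` and `ν`. -/
def Couplings {d : ℕ} (μ ν : Measure (RSpace d)) : Set (Measure (RSpace d × RSpace d)) :=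
  {γ | γ.map Prod.fst = μ ∧ γ.map Prod.snd = ν}

/-- The `2`-Wasserstein distance `d_2`, with values in `[0,∞]`; it is finite between probability
measures with finite second moments. -/
def d2 {d : ℕ} (μ ν : Measure (RSpace d)) : ℝ≥0∞ :=
  (⨅ γ ∈ Couplings μ ν, ∫⁻ p, ‖p.1 - p.2‖ₑ ^ 2 ∂γ) ^ (1 / 2 : ℝ)

/-- `μ` is a probability measure with finite second moment. -/
def MemP2 {d : ℕ} (μ : Measure (RSpace d)) : Prop :=
  IsProbabilityMeasure μ ∧ ∫⁻ x, ‖x‖ₑ ^ 2 ∂μ < ⊤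

/-- `μ ∈ C([0,T], P²(ℝ^d))`, where `P²(ℝ^d)` carries the distance `d_2`. -/
def IsP2Curve {d : ℕ} (T : ℝ) (μ : ℝ → Measure (RSpace d)) : Prop :=
  ∀ t ∈ Icc 0 T, MemP2 (μ t) ∧ Tendsto (fun s => d2 (μ s) (μ t)) (𝓝[Icc 0 T] t) (𝓝 0)

/-! ### Dynamics -/

/-- The convolution `∇Ψ * μ`. -/
def gradConv {d : ℕ} (Ψ : RSpace d → ℝ) (μ : Measure (RSpace d)) (x : RSpace d) : RSpace d :=
  ∫ y, ∇ Ψ (x - y) ∂μ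

/-- `μ ∈ C([0,T], P²(ℝ^d))` is a weak solution of the aggregation equation
`∂ₜ μ = ∇ · (μ (∇W * μ))` on `[0,T]`. -/
def IsAggregationSolution {d : ℕ} (T : ℝ) (W : RSpace d → ℝ)
    (μ : ℝ → Measure (RSpace d)) : Prop :=
  IsP2Curve T μ ∧
    ∀ φ : RSpace d → ℝ, ContDiff ℝ ∞ φ → HasCompactSupport φ → ∀ t ∈ Icc 0 T,
      ∫ x, φ x ∂(μ t) - ∫ x, φ x ∂(μ 0) =
        - ∫ s in (0 : ℝ)..t, ∫ x, inner ℝ (∇ φ x) (gradConv W (μ s) x) ∂(μ s)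

/-- `x` solves on `[0,T]` the system of `N` particles driven by the potential `W`, without
confinement: `ẋᵢ = - (1/N) ∑_{j ≠ i} ∇W(xᵢ - xⱼ)`. -/
def IsParticleSolution {d N : ℕ} (T : ℝ) (W : RSpace d → ℝ)
    (x : ℝ → Fin N → RSpace d) : Prop :=
  ∀ t ∈ Icc 0 T, ∀ i : Fin N,
    HasDerivWithinAt (fun s => x s i)
      (-((1 / N : ℝ) • ∑ j ∈ Finset.univ.erase i, ∇ W (x t i - x t j))) (Icc 0 T) t

/-- The empirical measure `(1/N) ∑ᵢ δ_{xᵢ}`. -/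
def empiricalMeasure {d N : ℕ} (x : Fin N → RSpace d) : Measure (RSpace d) :=
  (N : ℝ≥0∞)⁻¹ • ∑ i, Measure.dirac (x i)

/-- The error functional
`Ẽ(Ψ) = (1/T) ∫_0^T ∫ |∇Ψ * μₜ - ∇W * μₜ|² dμₜ dt` along a curve of measures `μ`. It is the
particle error functional when `μ` is the curve of empirical measures, and the limiting
functional when `μ` solves the aggregation equation. -/
def errorFunctional {d : ℕ} (T : ℝ) (W : RSpace d → ℝ) (μ : ℝ → Measure (RSpace d))
    (Ψ : RSpace d → ℝ) : ℝ :=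
  (1 / T) * ∫ t in (0 : ℝ)..T, ∫ x, ‖gradConv Ψ (μ t) x - gradConv W (μ t) x‖ ^ 2 ∂(μ t)

/-- The coercivity condition: for some `c > 0`,
`c (1/T) ∫_0^T ‖(∇Ψ - ∇W) * μₜ‖²_{L²(μₜ)} dt ≤ Ẽ(Ψ)`. -/
def Coercive {d : ℕ} (T : ℝ) (W : RSpace d → ℝ) (μ : ℝ → Measure (RSpace d))
    (Ψ : RSpace d → ℝ) : Prop :=
  ∃ c : ℝ, 0 < c ∧
    c * ((1 / T) * ∫ t in (0 : ℝ)..T,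
      ∫ x, ‖∫ y, (∇ Ψ (x - y) - ∇ W (x - y)) ∂(μ t)‖ ^ 2 ∂(μ t)) ≤ errorFunctional T W μ Ψ

/-- The coercivity condition on the interaction kernels themselves: for some `c > 0`,
`c (1/T) ∫_0^T ∬ |∇Ψ(x-y) - ∇W(x-y)|² dμₜ(y) dμₜ(x) dt ≤ Ẽ(Ψ)`. -/
def KernelCoercive {d : ℕ} (T : ℝ) (W : RSpace d → ℝ) (μ : ℝ → Measure (RSpace d))
    (Ψ : RSpace d → ℝ) : Prop :=
  ∃ c : ℝ, 0 < c ∧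
    c * ((1 / T) * ∫ t in (0 : ℝ)..T,
      ∫ x, ∫ y, ‖∇ Ψ (x - y) - ∇ W (x - y)‖ ^ 2 ∂(μ t) ∂(μ t)) ≤ errorFunctional T W μ Ψ

end

/-! ### Regularity of the admissible potentials -/

/-! Potentials in `XClass M K` have gradients bounded by `M` and Lipschitz with a constant depending
only on `d` and `M`. A uniformly small function with Lipschitz gradient has a small gradient, so
uniform convergence of potentials is uniform convergence of forces
(`XClass.tendstoUniformly_gradient`).

Mean-field limit: for a bounded Lipschitz force the aggregation equation is solved by pushing the
initial measure along its characteristic flow (`exists_characteristic_flow`,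
`isAggregationSolution_of_flow`). Particles obey the same law up to a self-interaction of order
`1/N`. Any plan between the initial data can be carried along both dynamics, and a Grönwall estimate
then bounds `d2` at later times by the initial distance, the distance of the forces and the
self-interaction (`d2_empiricalMeasure_flow_le`).

Uniqueness must hold among all weak solutions, not only those known to be transported by a flow.
`IsAggregationSolution.unique` argues by duality. A test function is pulled back along Euler steps
of a mollified velocity of one solution, and both solutions are paired with it. The difference of
the pairings at time `t` is controlled by the time integral of such differences at earlier times;
with an exponential weight this is a contraction by `1/2`.

Identification: the true potential is a limit of competitors and has zero error, so the minimal
particle errors tend to zero. The energy is stable under `d2` and under uniform convergence of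
forces, hence `Wbar` has zero error along the limit of the observed measures, at every time by
continuity (`convEnergy_eq_zero_of_isMinOn`). If the particles follow `W`, this limit is `μ` by
uniqueness. If they follow `What N`, it is the solution driven by `Wbar`; zero error says that both
forces agree on it, so it also solves the equation of `W`, and uniqueness again makes it `μ`. Kernel
coercivity turns zero error into equality of the kernels. -/

theorem EuclideanSpace.norm_le_sum_abs {d : ℕ} (v : RSpace d) : ‖v‖ ≤ ∑ i, |v i| := by
  conv_lhs => rw [← (EuclideanSpace.basisFun (Fin d) ℝ).sum_repr v]
  refine (norm_sum_le _ _).trans (Finset.sum_le_sum fun i _ => ?_)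
  simp [norm_smul]

theorem ContinuousLinearMap.opNorm_le_of_basis {d : ℕ} (A : RSpace d →L[ℝ] ℝ) {C : ℝ}
    (hC : 0 ≤ C) (hA : ∀ j, |A (EuclideanSpace.single j 1)| ≤ C) : ‖A‖ ≤ d * C := by
  refine A.opNorm_le_bound (by positivity) fun v => ?_
  conv_lhs => rw [← (EuclideanSpace.basisFun (Fin d) ℝ).sum_repr v]
  rw [map_sum]
  refine (norm_sum_le _ _).trans ?_
  have : ∀ i ∈ Finset.univ, ‖A ((EuclideanSpace.basisFun (Fin d) ℝ).repr v i •
      (EuclideanSpace.basisFun (Fin d) ℝ) i)‖ ≤ C * ‖v‖ := by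
    intro i _
    simp only [EuclideanSpace.basisFun_repr, EuclideanSpace.basisFun_apply, map_smul, norm_smul,
      Real.norm_eq_abs]
    rw [mul_comm]
    exact mul_le_mul (hA i) (by simpa using PiLp.norm_apply_le v i) (abs_nonneg _) hC
  refine (Finset.sum_le_sum this).trans ?_
  simp [mul_assoc]

/-- A continuous function with essentially bounded weak partial derivatives is Lipschitz. -/
theorem lipschitz_of_hasWeakPartialDeriv {d : ℕ} {f : RSpace d → ℝ} (hf : Continuous f)
    {h : Fin d → RSpace d → ℝ} {C : ℝ} (hC : 0 ≤ C)
    (hw : ∀ j, HasWeakPartialDeriv j f (h j)) (hb : ∀ j, ∀ᵐ x, |h j x| ≤ C) (x y : RSpace d) :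
    |f x - f y| ≤ d * C * ‖x - y‖ := by
  -- The mollifications `F n` converge pointwise to `f`, so a Lipschitz bound uniform in `n`
  -- survives in the limit.
  let φ : ℕ → ContDiffBump (0 : RSpace d) := fun n =>
    { rIn := 1 / (n + 2), rOut := 1 / (n + 1), rIn_pos := by positivity,
      rIn_lt_rOut := by gcongr; norm_num }
  have hφ : Tendsto (fun n => (φ n).rOut) atTop (𝓝 0) := tendsto_one_div_add_atTop_nhds_zero_nat
  let F : ℕ → RSpace d → ℝ := fun n =>
    MeasureTheory.convolution f ((φ n).normed volume) (ContinuousLinearMap.lsmul ℝ ℝ) volume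
  have hF : ∀ z, Tendsto (fun n => F n z) atTop (𝓝 (f z)) := by
    intro z
    have := ContDiffBump.convolution_tendsto_right_of_continuous (μ := volume) hφ hf z
    refine this.congr fun n => ?_
    have hfl : (ContinuousLinearMap.lsmul ℝ ℝ : ℝ →L[ℝ] ℝ →L[ℝ] ℝ).flip =
        ContinuousLinearMap.lsmul ℝ ℝ := by
      ext; simp
    change _ = MeasureTheory.convolution _ _ _ _ _
    rw [← convolution_flip, hfl]
  have hlip : ∀ n, |F n x - F n y| ≤ d * C * ‖x - y‖ := by
    intro n
    have hρ : ContDiff ℝ ∞ ((φ n).normed volume) := (φ n).contDiff_normed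
    have hder := fun z => ((φ n).hasCompactSupport_normed (μ := volume)).hasFDerivAt_convolution_right
      (ContinuousLinearMap.lsmul ℝ ℝ) (μ := volume) hf.locallyIntegrable
      (hρ.of_le (by exact_mod_cast le_top)) z
    refine Convex.norm_image_sub_le_of_norm_hasFDerivWithin_le (𝕜 := ℝ) (f := F n) (s := univ)
      (fun z _ => (hder z).hasFDerivWithinAt) (fun z _ => ?_) convex_univ (mem_univ y) (mem_univ x)
    refine ContinuousLinearMap.opNorm_le_of_basis _ hC fun j => ?_
    rw [convolution_precompR_apply (ContinuousLinearMap.lsmul ℝ ℝ) hf.locallyIntegrable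
      ((φ n).hasCompactSupport_normed.fderiv ℝ) (hρ.continuous_fderiv (by simp))]
    -- The reflected and translated mollifier serves as test function: it moves the derivative from
    -- the mollifier onto `f`, and the average of `h j` against a probability density is at most
    -- `C`.
    have key := (hw j).2.2 (fun t => (φ n).normed volume (z - t))
      (hρ.comp (contDiff_const.sub contDiff_id))
      ((φ n).hasCompactSupport_normed.comp_homeomorph (Homeomorph.subLeft z))
    have hd : ∀ t, fderiv ℝ (fun t => (φ n).normed volume (z - t)) t (EuclideanSpace.single j 1)
        = - fderiv ℝ ((φ n).normed volume) (z - t) (EuclideanSpace.single j 1) := by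
      intro t
      have h1 : HasFDerivAt (fun t => (φ n).normed volume (z - t))
          ((fderiv ℝ ((φ n).normed volume) (z - t)).comp
            (-(ContinuousLinearMap.id ℝ (RSpace d)))) t :=
        ((hρ.differentiable (by simp) (z - t)).hasFDerivAt).comp t
          ((hasFDerivAt_id t).const_sub z)
      rw [h1.fderiv]; simp
    simp only [hd, mul_neg, integral_neg, neg_inj] at key
    simp only [MeasureTheory.convolution, ContinuousLinearMap.lsmul_apply, smul_eq_mul]
    rw [key, ← Real.norm_eq_abs]
    have hi : Integrable (fun t => C * (φ n).normed volume (z - t)) :=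
      ((φ n).integrable_normed.comp_sub_left z).const_mul C
    refine le_trans (norm_integral_le_of_norm_le hi ?_) (le_of_eq ?_)
    · filter_upwards [hb j] with t ht
      rw [norm_mul, Real.norm_eq_abs, Real.norm_eq_abs, abs_of_nonneg ((φ n).nonneg_normed _)]
      exact mul_le_mul_of_nonneg_right ht ((φ n).nonneg_normed _)
    · rw [integral_const_mul, integral_sub_left_eq_self (fun t => (φ n).normed volume t),
        (φ n).integral_normed, mul_one]
  exact le_of_tendsto ((hF x).sub (hF y)).abs (Eventually.of_forall hlip)

/-- A bound for the Lipschitz constant of the gradients of the potentials in `XClass M K`. -/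
def gradLip (d : ℕ) (M : ℝ≥0) : ℝ≥0 := d * (d * M)

namespace XClass

variable {d : ℕ} {M : ℝ≥0} {K : Set (RSpace d)} {b : RSpace d → ℝ}

theorem continuous_gradient (hb : b ∈ XClass M K) : Continuous (∇ b) :=
  (InnerProductSpace.toDual ℝ (RSpace d)).symm.continuous.comp
    (hb.1.continuous_fderiv (by simp))

theorem norm_gradient_le (hb : b ∈ XClass M K) (x : RSpace d) : ‖∇ b x‖ ≤ M := by
  obtain ⟨-, -, H, -, hM⟩ := id hb
  have h1 : eLpNormEssSup (∇ b) volume ≤ M := by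
    rw [← eLpNorm_exponent_top]
    exact (le_add_self.trans le_self_add).trans hM
  have h2 : ∀ᵐ x, ‖∇ b x‖ ≤ M := by
    filter_upwards [ae_le_eLpNormEssSup (f := ∇ b) (μ := volume)] with x hx
    exact_mod_cast (hx.trans h1)
  have hcl : IsClosed {x | ‖∇ b x‖ ≤ M} :=
    isClosed_le (continuous_gradient hb).norm continuous_const
  -- A set of full measure is dense, and the bound is a closed condition because the gradient is
  -- continuous.
  have := (Measure.dense_of_ae h2).closure_eq
  rw [hcl.closure_eq] at this
  exact this.ge (mem_univ x)

theorem lipschitz_gradient (hb : b ∈ XClass M K) : LipschitzWith (gradLip d M) (∇ b) := by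
  obtain ⟨-, -, H, hH, hM⟩ := id hb
  have h1 : eLpNormEssSup H volume ≤ M := by
    rw [← eLpNorm_exponent_top]
    exact le_add_self.trans hM
  have h2 : ∀ᵐ x, ‖H x‖ ≤ M := by
    filter_upwards [ae_le_eLpNormEssSup (f := H) (μ := volume)] with x hx
    exact_mod_cast (hx.trans h1)
  refine LipschitzWith.of_dist_le_mul fun x y => ?_
  rw [dist_eq_norm, dist_eq_norm]
  -- One factor `d` of `gradLip` comes from summing the components here, the other from bounding an
  -- operator norm by its values on the basis.
  refine (EuclideanSpace.norm_le_sum_abs _).trans ?_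
  have : ∀ i ∈ Finset.univ, |(∇ b x - ∇ b y) i| ≤ d * M * ‖x - y‖ := fun i _ => by
    refine lipschitz_of_hasWeakPartialDeriv (f := fun x => (∇ b x) i) ?_ M.2 (fun j => hH i j)
      (fun j => ?_) x y
    · exact (EuclideanSpace.proj i : RSpace d →L[ℝ] ℝ).continuous.comp (continuous_gradient hb)
    · filter_upwards [h2] with x hx
      exact (PiLp.norm_apply_le (H x) (i, j)).trans hx
  refine (Finset.sum_le_sum this).trans_eq ?_
  simp [gradLip, mul_assoc]

theorem eq_zero_of_notMem (hb : b ∈ XClass M K) {x : RSpace d} (hx : x ∉ K) : b x = 0 :=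
  image_eq_zero_of_notMem_tsupport fun h => hx (hb.2.1 h)

theorem hasCompactSupport_gradient (hK : IsCompact K) (hb : b ∈ XClass M K) :
    HasCompactSupport (∇ b) := by
  have h : HasCompactSupport b := hK.of_isClosed_subset (isClosed_tsupport _) hb.2.1
  exact (h.fderiv ℝ).comp_left (g := (InnerProductSpace.toDual ℝ (RSpace d)).symm) (map_zero _)

end XClass

/-- Interpolation: a small function with Lipschitz gradient has a small gradient. -/
theorem norm_gradient_le_of_abs_le {d : ℕ} {f : RSpace d → ℝ} (hf : Differentiable ℝ f)
    {B η τ : ℝ} (hL : ∀ x y, ‖∇ f x - ∇ f y‖ ≤ B * ‖x - y‖) (hη : ∀ x, |f x| ≤ η)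
    (hB : 0 ≤ B) (hτ : 0 < τ) (x : RSpace d) : ‖∇ f x‖ ≤ 2 * η / τ + B * τ := by
  have hη0 : 0 ≤ η := (abs_nonneg _).trans (hη x)
  rcases eq_or_ne (∇ f x) 0 with h0 | h0
  · rw [h0, norm_zero]; positivity
  have hn : 0 < ‖∇ f x‖ := norm_pos_iff.2 h0
  -- A step of length `τ` along the gradient: the first-order term is `τ * ‖∇ f x‖`, the increment
  -- of `f` is at most `2 * η`, and the Taylor remainder at most `B * τ ^ 2`.
  set v : RSpace d := (τ / ‖∇ f x‖) • ∇ f x with hv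
  have hvn : ‖v‖ = τ := by rw [hv, norm_smul, norm_div, norm_norm, Real.norm_of_nonneg hτ.le]; field_simp
  have h1 : ‖f (x + v) - f x - fderiv ℝ f x (x + v - x)‖ ≤ B * τ * ‖x + v - x‖ := by
    refine Convex.norm_image_sub_le_of_norm_fderiv_le' (𝕜 := ℝ) (s := Metric.closedBall x τ)
      (fun z _ => hf z) (fun z hz => ?_) (convex_closedBall x τ) (Metric.mem_closedBall_self hτ.le)
      (by simp [hvn])
    have : ‖fderiv ℝ f z - fderiv ℝ f x‖ = ‖∇ f z - ∇ f x‖ := by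
      rw [gradient, gradient, ← map_sub, LinearIsometryEquiv.norm_map]
    rw [this]
    refine (hL z x).trans (mul_le_mul_of_nonneg_left ?_ hB)
    simpa [dist_eq_norm] using hz
  have h2 : fderiv ℝ f x v = τ * ‖∇ f x‖ := by
    have : fderiv ℝ f x v = inner ℝ (∇ f x) v := by
      rw [gradient, InnerProductSpace.toDual_symm_apply]
    rw [this, hv, inner_smul_right, real_inner_self_eq_norm_sq]
    field_simp
  rw [add_sub_cancel_left, h2, hvn, Real.norm_eq_abs] at h1
  have h3 := (abs_le.1 h1).1
  have h4 := (abs_le.1 (hη (x + v))).2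
  have h5 := (abs_le.1 (hη x)).1
  have h6 : τ * ‖∇ f x‖ ≤ 2 * η + B * τ * τ := by linarith
  rw [div_add' _ _ _ hτ.ne', le_div_iff₀ hτ]
  linarith

/-- Uniform convergence of potentials in `XClass M K` implies that of the gradients. -/
theorem XClass.tendstoUniformly_gradient {d : ℕ} {M : ℝ≥0} {K : Set (RSpace d)}
    {β : ℕ → RSpace d → ℝ} {b : RSpace d → ℝ} (hβ : ∀ N, β N ∈ XClass M K) (hb : b ∈ XClass M K)
    (h : TendstoUniformlyOn β b atTop K) :
    TendstoUniformly (fun N => ∇ (β N)) (∇ b) atTop := by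
  rw [Metric.tendstoUniformly_iff]
  rw [Metric.tendstoUniformlyOn_iff] at h
  intro ε hε
  -- `B` bounds the Lipschitz constant of the difference of two gradients; the `+ 1` keeps it
  -- positive. With `τ` as below and `η = ε * τ / 8`, both terms of the interpolation bound equal `ε
  -- / 4`.
  set B : ℝ := 2 * gradLip d M + 1 with hB
  have hB0 : 0 < B := by positivity
  set τ : ℝ := ε / (4 * B) with hτ
  have hτ0 : 0 < τ := by positivity
  filter_upwards [h (ε * τ / 8) (by positivity)] with N hN x
  have hd1 : Differentiable ℝ b := hb.1.differentiable (by simp)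
  have hd2 : Differentiable ℝ (β N) := (hβ N).1.differentiable (by simp)
  have hg : ∀ x, ∇ (fun x => b x - β N x) x = ∇ b x - ∇ (β N) x := fun x => by
    rw [gradient, fderiv_fun_sub (hd1 x) (hd2 x), map_sub]; rfl
  have := norm_gradient_le_of_abs_le (f := fun x => b x - β N x) (B := B) (η := ε * τ / 8)
    (hd1.sub hd2) (fun x y => ?_) (fun x => ?_) hB0.le hτ0 x
  · rw [dist_eq_norm, ← hg]
    refine this.trans_lt ?_
    have : 2 * (ε * τ / 8) / τ + B * τ = ε / 2 := by rw [hτ]; field_simp; ring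
    rw [this]; linarith
  · rw [hg, hg]
    have h1 := (XClass.lipschitz_gradient hb).dist_le_mul x y
    have h2 := (XClass.lipschitz_gradient (hβ N)).dist_le_mul x y
    rw [dist_eq_norm, dist_eq_norm] at h1 h2
    have : ∇ b x - ∇ (β N) x - (∇ b y - ∇ (β N) y) =
      (∇ b x - ∇ b y) - (∇ (β N) x - ∇ (β N) y) := by abel
    rw [this]
    refine (norm_sub_le _ _).trans ?_
    rw [hB]
    nlinarith [norm_nonneg (x - y)]
  -- Off `K` both potentials vanish, so closeness on `K` is closeness everywhere.
  · by_cases hx : x ∈ K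
    · have := hN x hx
      rw [Real.dist_eq] at this
      exact this.le
    · rw [XClass.eq_zero_of_notMem hb hx, XClass.eq_zero_of_notMem (hβ N) hx]
      simp; positivity

/-- Mollification of a compactly supported Lipschitz vector field. -/
theorem LipschitzWith.exists_contDiff_approx {d : ℕ} {G : RSpace d → RSpace d} {Λ : ℝ≥0}
    (hG : LipschitzWith Λ G) (hc : HasCompactSupport G) {ε : ℝ} (hε : 0 < ε) :
    ∃ g : RSpace d → RSpace d, ContDiff ℝ ∞ g ∧ HasCompactSupport g ∧ LipschitzWith Λ g ∧
      ∀ x, ‖g x - G x‖ ≤ ε := by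
  set r : ℝ := ε / (Λ + 1) with hr
  have hr0 : 0 < r := by positivity
  let φ : ContDiffBump (0 : RSpace d) :=
    { rIn := r / 2, rOut := r, rIn_pos := by positivity, rIn_lt_rOut := by linarith }
  refine ⟨MeasureTheory.convolution (φ.normed volume) G (ContinuousLinearMap.lsmul ℝ ℝ) volume,
    ?_, ?_, ?_, ?_⟩
  · exact φ.hasCompactSupport_normed.contDiff_convolution_left _ φ.contDiff_normed
      hG.continuous.locallyIntegrable
  · exact φ.hasCompactSupport_normed.convolution _ hc
  -- Averaging translates of `G` against a probability density does not increase the Lipschitz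
  -- constant.
  · refine LipschitzWith.of_dist_le_mul fun x y => ?_
    have hi : ∀ z, Integrable (fun t => φ.normed volume t • G (z - t)) := fun z =>
      (φ.continuous_normed.smul (hG.continuous.comp (continuous_const.sub continuous_id)))
        |>.integrable_of_hasCompactSupport φ.hasCompactSupport_normed.smul_right
    simp only [MeasureTheory.convolution, ContinuousLinearMap.lsmul_apply]
    rw [dist_eq_norm, dist_eq_norm, ← integral_sub (hi x) (hi y)]
    refine le_trans (norm_integral_le_of_norm_le
      (φ.integrable_normed.mul_const (Λ * ‖x - y‖)) (Eventually.of_forall fun t => ?_))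
      (le_of_eq ?_)
    · rw [← smul_sub, norm_smul, Real.norm_of_nonneg (φ.nonneg_normed _)]
      refine mul_le_mul_of_nonneg_left ?_ (φ.nonneg_normed _)
      have := hG.dist_le_mul (x - t) (y - t)
      rwa [dist_eq_norm, dist_eq_norm, sub_sub_sub_cancel_right] at this
    · rw [integral_mul_const, φ.integral_normed, one_mul]
  · intro x
    rw [← dist_eq_norm]
    refine ContDiffBump.dist_normed_convolution_le hG.continuous.aestronglyMeasurable fun y hy => ?_
    refine (hG.dist_le_mul y x).trans ?_
    have h1 : dist y x ≤ r := (Metric.mem_ball.1 hy).le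
    calc (Λ : ℝ) * dist y x ≤ (Λ + 1) * r := by gcongr; linarith
      _ = ε := by rw [hr]; field_simp

/-! ### Estimates for the Wasserstein distance -/

/-- The quadratic transport cost of a plan. -/
noncomputable def transportCost {d : ℕ} (γ : Measure (RSpace d × RSpace d)) : ℝ≥0∞ :=
  ∫⁻ p, ‖p.1 - p.2‖ₑ ^ 2 ∂γ

section d2

variable {d : ℕ} {μ ν : Measure (RSpace d)}

theorem Couplings.isProbabilityMeasure [IsProbabilityMeasure μ]
    {γ : Measure (RSpace d × RSpace d)} (hγ : γ ∈ Couplings μ ν) : IsProbabilityMeasure γ := by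
  constructor
  have := congrArg (fun m => m univ) hγ.1
  simpa [Measure.map_apply measurable_fst MeasurableSet.univ] using this

/-- Lower bounds are proved plan by plan, so the existence of an optimal plan is never needed. -/
theorem le_d2 {c : ℝ≥0∞} (h : ∀ γ ∈ Couplings μ ν, c ^ 2 ≤ transportCost γ) : c ≤ d2 μ ν := by
  have h1 : c ^ 2 ≤ ⨅ γ ∈ Couplings μ ν, ∫⁻ p, ‖p.1 - p.2‖ₑ ^ 2 ∂γ := le_iInf₂ h
  have h2 := ENNReal.rpow_le_rpow h1 (z := 1 / 2) (by norm_num)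
  rwa [← ENNReal.rpow_natCast, ← ENNReal.rpow_mul, Nat.cast_ofNat, mul_one_div_cancel (by norm_num),
    ENNReal.rpow_one] at h2

theorem d2_sq : d2 μ ν ^ 2 = ⨅ γ ∈ Couplings μ ν, transportCost γ := by
  rw [d2, ← ENNReal.rpow_natCast, ← ENNReal.rpow_mul, Nat.cast_ofNat,
    one_div_mul_cancel (by norm_num), ENNReal.rpow_one]
  rfl

theorem d2_sq_le {γ : Measure (RSpace d × RSpace d)} (hγ : γ ∈ Couplings μ ν) :
    d2 μ ν ^ 2 ≤ transportCost γ := by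
  rw [d2_sq]; exact iInf₂_le _ hγ

/-- Two random variables on a common space furnish a plan between their laws. This is the source of
the upper bounds on `d2` along the dynamics. -/
theorem d2_map_sq_le {Ω : Type*} [MeasurableSpace Ω] (P : Measure Ω) {X Y : Ω → RSpace d}
    (hX : Measurable X) (hY : Measurable Y) :
    d2 (P.map X) (P.map Y) ^ 2 ≤ ∫⁻ w, ‖X w - Y w‖ₑ ^ 2 ∂P := by
  have hγ : P.map (fun w => (X w, Y w)) ∈ Couplings (P.map X) (P.map Y) := by
    constructor
    · rw [Measure.map_map measurable_fst (hX.prodMk hY)]; rfl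
    · rw [Measure.map_map measurable_snd (hX.prodMk hY)]; rfl
  refine (d2_sq_le hγ).trans_eq ?_
  rw [transportCost, lintegral_map _ (hX.prodMk hY)]
  exact ((measurable_fst.sub measurable_snd).enorm.pow_const 2)

theorem d2_map_le {Ω : Type*} [MeasurableSpace Ω] (P : Measure Ω) [IsProbabilityMeasure P]
    {X Y : Ω → RSpace d} (hX : Measurable X) (hY : Measurable Y) {c : ℝ}
    (h : ∀ w, ‖X w - Y w‖ ≤ c) : d2 (P.map X) (P.map Y) ≤ ENNReal.ofReal c := by
  rw [← ENNReal.pow_le_pow_left_iff two_ne_zero]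
  refine (d2_map_sq_le P hX hY).trans ?_
  have : ∀ w, ‖X w - Y w‖ₑ ^ 2 ≤ ENNReal.ofReal c ^ 2 := fun w => by
    gcongr
    rw [← ofReal_norm]
    exact ENNReal.ofReal_le_ofReal (h w)
  exact (lintegral_mono this).trans (by simp)

theorem sq_lintegral_enorm_sub_le (γ : Measure (RSpace d × RSpace d)) [IsProbabilityMeasure γ] :
    (∫⁻ p, ‖p.1 - p.2‖ₑ ∂γ) ^ 2 ≤ transportCost γ := by
  have hD : Measurable fun p : RSpace d × RSpace d => ‖p.1 - p.2‖ₑ :=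
    (measurable_fst.sub measurable_snd).enorm
  have := ENNReal.lintegral_mul_le_Lp_mul_Lq γ (Real.HolderConjugate.two_two)
    hD.aemeasurable (aemeasurable_const (b := (1 : ℝ≥0∞)))
  simp only [Pi.mul_apply, mul_one, ENNReal.one_rpow, lintegral_const, measure_univ] at this
  calc _ ≤ ((∫⁻ p, ‖p.1 - p.2‖ₑ ^ (2 : ℝ) ∂γ) ^ (1 / 2 : ℝ)) ^ 2 := by gcongr
    _ = _ := by
      rw [← ENNReal.rpow_natCast, ← ENNReal.rpow_mul]
      simp [transportCost]

/-- Integrals of bounded Lipschitz functions are Lipschitz in the Wasserstein distance. -/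
theorem enorm_integral_sub_le_d2 {F : Type*} [NormedAddCommGroup F] [NormedSpace ℝ F]
    [IsProbabilityMeasure μ] [IsProbabilityMeasure ν] {f : RSpace d → F} {L : ℝ≥0}
    (hf : LipschitzWith L f) (hμ : Integrable f μ) (hν : Integrable f ν) :
    ‖∫ x, f x ∂μ - ∫ x, f x ∂ν‖ₑ ≤ L * d2 μ ν := by
  -- The bound is divided by `L` to fit `le_d2`, so constant functions are treated apart.
  rcases eq_or_ne L 0 with rfl | hL
  · have : ∀ x, f x = f 0 := fun x => by
      have := hf.dist_le_mul x 0
      simpa using this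
    simp_rw [this]
    by_cases hF : CompleteSpace F
    · simp
    · simp [integral, hF]
  have hL' : (L : ℝ≥0∞) ≠ 0 := by exact_mod_cast hL
  rw [mul_comm]
  refine (ENNReal.div_le_iff hL' ENNReal.coe_ne_top).1 (le_d2 fun γ hγ => ?_)
  have := Couplings.isProbabilityMeasure hγ
  obtain ⟨h1, h2⟩ := hγ
  rw [← h1] at hμ
  rw [← h2] at hν
  have i1 : Integrable (fun p => f p.1) γ := hμ.comp_measurable measurable_fst
  have i2 : Integrable (fun p => f p.2) γ := hν.comp_measurable measurable_snd
  have e1 : ∫ x, f x ∂μ = ∫ p, f p.1 ∂γ := by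
    rw [← h1, integral_map measurable_fst.aemeasurable hμ.1]
  have e2 : ∫ x, f x ∂ν = ∫ p, f p.2 ∂γ := by
    rw [← h2, integral_map measurable_snd.aemeasurable hν.1]
  rw [e1, e2, ← integral_sub i1 i2]
  have hD : Measurable fun p : RSpace d × RSpace d => ‖p.1 - p.2‖ₑ :=
    (measurable_fst.sub measurable_snd).enorm
  have b1 : ‖∫ p, (f p.1 - f p.2) ∂γ‖ₑ ≤ L * ∫⁻ p, ‖p.1 - p.2‖ₑ ∂γ := by
    refine (enorm_integral_le_lintegral_enorm _).trans ?_
    rw [← lintegral_const_mul _ hD]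
    refine lintegral_mono fun p => ?_
    have := hf p.1 p.2
    rwa [edist_eq_enorm_sub, edist_eq_enorm_sub] at this
  have b2 : ‖∫ p, (f p.1 - f p.2) ∂γ‖ₑ / L ≤ ∫⁻ p, ‖p.1 - p.2‖ₑ ∂γ := by
    rw [ENNReal.div_le_iff hL' ENNReal.coe_ne_top, mul_comm]; exact b1
  have b3 := sq_lintegral_enorm_sub_le γ
  exact (pow_le_pow_left' b2 2).trans b3

end d2

/-! ### Convolution of a field with a measure -/

/-- The convolution `G * μ` of a field with a measure. -/
noncomputable def fieldConv {d : ℕ} {F : Type*} [NormedAddCommGroup F] [NormedSpace ℝ F]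
    (G : RSpace d → F) (μ : Measure (RSpace d)) (x : RSpace d) : F :=
  ∫ y, G (x - y) ∂μ

theorem LipschitzWith.const_sub_left {d : ℕ} {F : Type*} [PseudoMetricSpace F] {G : RSpace d → F}
    {Λ : ℝ≥0} (hG : LipschitzWith Λ G) (x : RSpace d) : LipschitzWith Λ (fun y => G (x - y)) := by
  refine LipschitzWith.of_dist_le_mul fun y z => ?_
  refine (hG.dist_le_mul _ _).trans_eq ?_
  rw [dist_sub_left]

section fieldConv

variable {d : ℕ} {F : Type*} [NormedAddCommGroup F] [NormedSpace ℝ F] {G G' : RSpace d → F}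
  {μ ν : Measure (RSpace d)} [IsProbabilityMeasure μ] [IsProbabilityMeasure ν] {Λ : ℝ≥0} {M : ℝ}

theorem LipschitzWith.integrable_of_bounded [FiniteDimensional ℝ F] (hG : LipschitzWith Λ G)
    (hM : ∀ x, ‖G x‖ ≤ M) : Integrable G μ := by
  have : ProperSpace F := FiniteDimensional.proper_real F
  exact Integrable.of_bound hG.continuous.aestronglyMeasurable M (Eventually.of_forall hM)

theorem integrable_fieldConv [FiniteDimensional ℝ F] (hG : LipschitzWith Λ G)
    (hM : ∀ x, ‖G x‖ ≤ M) (x : RSpace d) : Integrable (fun y => G (x - y)) μ :=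
  (hG.const_sub_left x).integrable_of_bounded fun _ => hM _

theorem norm_fieldConv_le (hM : ∀ x, ‖G x‖ ≤ M) (x : RSpace d) : ‖fieldConv G μ x‖ ≤ M := by
  refine (norm_integral_le_of_norm_le_const (C := M) (Eventually.of_forall fun y => hM _)).trans ?_
  simp

theorem lipschitz_fieldConv [FiniteDimensional ℝ F] (hG : LipschitzWith Λ G)
    (hM : ∀ x, ‖G x‖ ≤ M) : LipschitzWith Λ (fieldConv G μ) := by
  refine LipschitzWith.of_dist_le_mul fun x y => ?_
  rw [dist_eq_norm, fieldConv, fieldConv,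
    ← integral_sub (integrable_fieldConv hG hM x) (integrable_fieldConv hG hM y)]
  refine (norm_integral_le_of_norm_le_const (C := Λ * dist x y)
    (Eventually.of_forall fun z => ?_)).trans (by simp)
  have := hG.dist_le_mul (x - z) (y - z)
  rwa [dist_eq_norm, dist_sub_right] at this

theorem norm_fieldConv_sub_le [FiniteDimensional ℝ F] {Λ' : ℝ≥0} {M' η : ℝ}
    (hG : LipschitzWith Λ G) (hM : ∀ x, ‖G x‖ ≤ M) (hG' : LipschitzWith Λ' G')
    (hM' : ∀ x, ‖G' x‖ ≤ M') (h : ∀ x, ‖G x - G' x‖ ≤ η) (x : RSpace d) :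
    ‖fieldConv G μ x - fieldConv G' μ x‖ ≤ η := by
  rw [fieldConv, fieldConv,
    ← integral_sub (integrable_fieldConv hG hM x) (integrable_fieldConv hG' hM' x)]
  exact (norm_integral_le_of_norm_le_const (C := η)
    (Eventually.of_forall fun z => h _)).trans (by simp)

theorem enorm_fieldConv_sub_le_d2 [FiniteDimensional ℝ F] (hG : LipschitzWith Λ G)
    (hM : ∀ x, ‖G x‖ ≤ M) (x : RSpace d) :
    ‖fieldConv G μ x - fieldConv G ν x‖ₑ ≤ Λ * d2 μ ν :=
  enorm_integral_sub_le_d2 (hG.const_sub_left x) (integrable_fieldConv hG hM x)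
    (integrable_fieldConv hG hM x)

/-- Stability of `∫ Θ(x, (G * μ)(x)) dμ(x)` in both the field and the measure. -/
theorem enorm_integral_comp_fieldConv_sub_le [FiniteDimensional ℝ F] {E : Type*}
    [NormedAddCommGroup E] [NormedSpace ℝ E] [FiniteDimensional ℝ E]
    {Θ : RSpace d → F → E} {C : ℝ≥0} {B : ℝ} {η : ℝ≥0}
    (hΘ : ∀ x y a b, ‖a‖ ≤ M → ‖b‖ ≤ M → ‖Θ x a - Θ y b‖ ≤ C * (‖x - y‖ + ‖a - b‖))
    (hB : ∀ x a, ‖a‖ ≤ M → ‖Θ x a‖ ≤ B)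
    (hG : LipschitzWith Λ G) (hM : ∀ x, ‖G x‖ ≤ M) (hG' : LipschitzWith Λ G')
    (hM' : ∀ x, ‖G' x‖ ≤ M) (h : ∀ x, ‖G x - G' x‖ ≤ η) :
    ‖∫ x, Θ x (fieldConv G μ x) ∂μ - ∫ x, Θ x (fieldConv G' ν x) ∂ν‖ₑ ≤
      (C * (1 + 2 * Λ) : ℝ≥0) * d2 μ ν + (C * η : ℝ≥0) := by
  have key : ∀ (H : RSpace d → F), LipschitzWith Λ H → (∀ x, ‖H x‖ ≤ M) →
      ∀ (m : Measure (RSpace d)) [IsProbabilityMeasure m],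
      LipschitzWith (C * (1 + Λ)) (fun x => Θ x (fieldConv H m x)) := by
    intro H hH hHM m _
    refine LipschitzWith.of_dist_le_mul fun x y => ?_
    rw [dist_eq_norm]
    refine (hΘ _ _ _ _ (norm_fieldConv_le hHM x) (norm_fieldConv_le hHM y)).trans ?_
    have := (lipschitz_fieldConv (μ := m) hH hHM).dist_le_mul x y
    rw [dist_eq_norm, dist_eq_norm] at this
    rw [dist_eq_norm, NNReal.coe_mul, mul_assoc]
    refine mul_le_mul_of_nonneg_left ?_ C.2
    push_cast
    linarith
  have kB : ∀ (H : RSpace d → F), (∀ x, ‖H x‖ ≤ M) →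
      ∀ (m : Measure (RSpace d)) [IsProbabilityMeasure m] (x), ‖Θ x (fieldConv H m x)‖ ≤ B :=
    fun H hHM m _ x => hB _ _ (norm_fieldConv_le hHM x)
  -- The outer measure is changed first with the field frozen, at cost `C * (1 + Λ)`. Then `s2`
  -- changes the measure inside the convolution, at cost `C * Λ`, and the kernel, at cost `C * η`.
  have s1 : ‖∫ x, Θ x (fieldConv G μ x) ∂μ - ∫ x, Θ x (fieldConv G μ x) ∂ν‖ₑ ≤
      (C * (1 + Λ) : ℝ≥0) * d2 μ ν :=
    enorm_integral_sub_le_d2 (key G hG hM μ)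
      ((key G hG hM μ).integrable_of_bounded (kB G hM μ))
      ((key G hG hM μ).integrable_of_bounded (kB G hM μ))
  have s2 : ‖∫ x, Θ x (fieldConv G μ x) ∂ν - ∫ x, Θ x (fieldConv G' ν x) ∂ν‖ₑ ≤
      (C * Λ : ℝ≥0) * d2 μ ν + (C * η : ℝ≥0) := by
    rw [← integral_sub ((key G hG hM μ).integrable_of_bounded (kB G hM μ))
      ((key G' hG' hM' ν).integrable_of_bounded (kB G' hM' ν))]
    refine (enorm_integral_le_lintegral_enorm _).trans ?_
    refine (lintegral_mono (g := fun _ => (C * Λ : ℝ≥0) * d2 μ ν + (C * η : ℝ≥0))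
      fun x => ?_).trans (by simp)
    have h1 : ‖Θ x (fieldConv G μ x) - Θ x (fieldConv G' ν x)‖ₑ ≤
        C * ‖fieldConv G μ x - fieldConv G' ν x‖ₑ := by
      have := hΘ x x _ _ (norm_fieldConv_le (μ := μ) hM x) (norm_fieldConv_le (μ := ν) hM' x)
      rw [sub_self, norm_zero, zero_add] at this
      rw [← ofReal_norm, ← ofReal_norm, ← ENNReal.ofReal_coe_nnreal, ← ENNReal.ofReal_mul (NNReal.coe_nonneg C)]
      exact ENNReal.ofReal_le_ofReal this
    refine h1.trans ?_
    have h2 : ‖fieldConv G μ x - fieldConv G' ν x‖ₑ ≤ Λ * d2 μ ν + η := by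
      have : fieldConv G μ x - fieldConv G' ν x =
        (fieldConv G μ x - fieldConv G ν x) + (fieldConv G ν x - fieldConv G' ν x) := by abel
      rw [this]
      refine (enorm_add_le _ _).trans (add_le_add (enorm_fieldConv_sub_le_d2 hG hM x) ?_)
      exact_mod_cast norm_fieldConv_sub_le (μ := ν) hG hM hG' hM' h x
    refine (mul_le_mul_right h2 (C : ℝ≥0∞)).trans_eq ?_
    push_cast
    ring
  have e : ∫ x, Θ x (fieldConv G μ x) ∂μ - ∫ x, Θ x (fieldConv G' ν x) ∂ν =
    (∫ x, Θ x (fieldConv G μ x) ∂μ - ∫ x, Θ x (fieldConv G μ x) ∂ν) +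
    (∫ x, Θ x (fieldConv G μ x) ∂ν - ∫ x, Θ x (fieldConv G' ν x) ∂ν) := by abel
  rw [e]
  refine ((enorm_add_le _ _).trans (add_le_add s1 s2)).trans_eq ?_
  push_cast
  ring

/-- The common source of continuity in time. `Θ` is specialised below to the pairing with `∇ φ`, to
a test function alone, to the squared norm, and to the identity for scalar kernels. -/
theorem IsP2Curve.continuousOn_integral_comp_fieldConv [FiniteDimensional ℝ F] {E : Type*}
    [NormedAddCommGroup E] [NormedSpace ℝ E] [FiniteDimensional ℝ E]
    {Θ : RSpace d → F → E} {C : ℝ≥0} {B : ℝ} {T : ℝ} {μ : ℝ → Measure (RSpace d)}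
    (hμ : IsP2Curve T μ)
    (hΘ : ∀ x y a b, ‖a‖ ≤ M → ‖b‖ ≤ M → ‖Θ x a - Θ y b‖ ≤ C * (‖x - y‖ + ‖a - b‖))
    (hB : ∀ x a, ‖a‖ ≤ M → ‖Θ x a‖ ≤ B)
    (hG : LipschitzWith Λ G) (hM : ∀ x, ‖G x‖ ≤ M) :
    ContinuousOn (fun t => ∫ x, Θ x (fieldConv G (μ t) x) ∂(μ t)) (Icc 0 T) := by
  intro t ht
  rw [ContinuousWithinAt, tendsto_iff_edist_tendsto_0]
  have h0 := (hμ t ht).2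
  have := (hμ t ht).1.1
  have h1 : Tendsto (fun s => ((C * (1 + 2 * Λ) : ℝ≥0) : ℝ≥0∞) * d2 (μ s) (μ t))
      (𝓝[Icc 0 T] t) (𝓝 0) := by
    simpa using ENNReal.Tendsto.const_mul (a := ((C * (1 + 2 * Λ) : ℝ≥0) : ℝ≥0∞)) h0
      (Or.inr ENNReal.coe_ne_top)
  refine tendsto_of_tendsto_of_tendsto_of_le_of_le' tendsto_const_nhds h1
    (Eventually.of_forall fun _ => zero_le) ?_
  filter_upwards [self_mem_nhdsWithin] with s hs
  have := (hμ s hs).1.1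
  rw [edist_eq_enorm_sub]
  simpa using enorm_integral_comp_fieldConv_sub_le (μ := μ s) (ν := μ t) (η := 0) hΘ hB hG hM hG hM
    (by simp)

end fieldConv

/-! ### Lagrangian solutions -/

theorem MemP2.map_of_norm_sub_le {d : ℕ} {Ω : Type*} [MeasurableSpace Ω] {P : Measure Ω}
    [IsProbabilityMeasure P] {X Y : Ω → RSpace d} (hX : Measurable X) (hY : Measurable Y)
    (hP : MemP2 (P.map X)) {c : ℝ} (hc : ∀ w, ‖Y w - X w‖ ≤ c) : MemP2 (P.map Y) := by
  refine ⟨Measure.isProbabilityMeasure_map hY.aemeasurable, ?_⟩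
  have h1 := hP.2
  rw [lintegral_map (measurable_enorm.pow_const 2) hX] at h1
  rw [lintegral_map (measurable_enorm.pow_const 2) hY]
  have : ∀ w, ‖Y w‖ₑ ^ 2 ≤ 2 * (‖X w‖ₑ ^ 2 + ENNReal.ofReal c ^ 2) := fun w => by
    have h2 : ‖Y w‖ₑ ≤ ‖X w‖ₑ + ENNReal.ofReal c := by
      have e : Y w = X w + (Y w - X w) := by abel
      rw [e]
      refine (enorm_add_le _ _).trans (by gcongr; rw [← ofReal_norm]; simpa using ENNReal.ofReal_le_ofReal (hc w))
    refine (pow_le_pow_left' h2 2).trans ?_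
    have := ENNReal.rpow_add_le_mul_rpow_add_rpow ‖X w‖ₑ (ENNReal.ofReal c) (p := 2) (by norm_num)
    norm_num at this
    exact_mod_cast this
  refine (lintegral_mono this).trans_lt ?_
  rw [lintegral_const_mul _ (by fun_prop), lintegral_add_right _ measurable_const]
  simp only [lintegral_const, measure_univ, mul_one]
  exact ENNReal.mul_lt_top (by simp) (ENNReal.add_lt_top.2 ⟨h1, by simp⟩)

theorem isP2Curve_map {d : ℕ} {T M : ℝ} (hT : 0 ≤ T) {Ω : Type*} [MeasurableSpace Ω]
    {P : Measure Ω} [IsProbabilityMeasure P] {X : ℝ → Ω → RSpace d} (hX : ∀ t, Measurable (X t))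
    (h0 : MemP2 (P.map (X 0)))
    (hlip : ∀ s ∈ Icc 0 T, ∀ t ∈ Icc 0 T, ∀ w, ‖X s w - X t w‖ ≤ M * |s - t|) :
    IsP2Curve T (fun t => P.map (X t)) := by
  intro t ht
  refine ⟨MemP2.map_of_norm_sub_le (hX 0) (hX t) h0 (hlip t ht 0 ⟨le_rfl, hT⟩), ?_⟩
  have h1 : Tendsto (fun s => ENNReal.ofReal (M * |s - t|)) (𝓝[Icc 0 T] t) (𝓝 0) := by
    have : Continuous fun s => ENNReal.ofReal (M * |s - t|) :=
      ENNReal.continuous_ofReal.comp (by fun_prop)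
    have h2 := (this.tendsto t).mono_left (nhdsWithin_le_nhds (s := Icc 0 T))
    simpa using h2
  refine tendsto_of_tendsto_of_tendsto_of_le_of_le' tendsto_const_nhds h1
    (Eventually.of_forall fun _ => zero_le) ?_
  filter_upwards [self_mem_nhdsWithin] with s hs
  exact d2_map_le P (hX s) (hX t) (hlip s hs t ht)

theorem norm_sub_le_of_hasDerivWithinAt_Icc {E : Type*} [NormedAddCommGroup E] [NormedSpace ℝ E]
    {T M : ℝ} {f f' : ℝ → E} (hf : ∀ t ∈ Icc 0 T, HasDerivWithinAt f (f' t) (Icc 0 T) t)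
    (hM : ∀ t ∈ Icc 0 T, ‖f' t‖ ≤ M) {s t : ℝ} (hs : s ∈ Icc 0 T) (ht : t ∈ Icc 0 T) :
    ‖f s - f t‖ ≤ M * |s - t| :=
  (convex_Icc 0 T).norm_image_sub_le_of_norm_hasDerivWithin_le hf hM ht hs

theorem fieldConv_map {d : ℕ} {F : Type*} [NormedAddCommGroup F] [NormedSpace ℝ F]
    [FiniteDimensional ℝ F] {G : RSpace d → F} {Λ : ℝ≥0} (hG : LipschitzWith Λ G) {Ω : Type*}
    [MeasurableSpace Ω] {P : Measure Ω} {X : Ω → RSpace d} (hX : Measurable X) (x : RSpace d) :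
    fieldConv G (P.map X) x = ∫ w, G (x - X w) ∂P := by
  have : ProperSpace F := FiniteDimensional.proper_real F
  rw [fieldConv, integral_map hX.aemeasurable]
  exact (hG.const_sub_left x).continuous.aestronglyMeasurable

/-- Existence of the characteristic flow of the aggregation equation, by the Picard–Lindelöf
theorem in the space of bounded continuous displacements. -/
theorem exists_characteristic_flow {d : ℕ} {T : ℝ} (hT : 0 ≤ T) {G : RSpace d → RSpace d}
    {Λ M : ℝ≥0} (hG : LipschitzWith Λ G) (hM : ∀ x, ‖G x‖ ≤ M) (μ₀ : Measure (RSpace d))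
    [IsProbabilityMeasure μ₀] :
    ∃ X : ℝ → RSpace d → RSpace d, X 0 = id ∧ (∀ t, Continuous (X t)) ∧
      ∀ t ∈ Icc 0 T, ∀ x, HasDerivWithinAt (fun s => X s x)
        (-fieldConv G (μ₀.map (X t)) (X t x)) (Icc 0 T) t := by
  -- The unknown is the displacement from the identity, since the flow map itself is unbounded.
  let E := BoundedContinuousFunction (RSpace d) (RSpace d)
  have hΦ : ∀ u : E, Continuous fun x => x + u x := fun u => continuous_id.add u.continuous
  have hP : ∀ u : E, IsProbabilityMeasure (μ₀.map fun x => x + u x) := fun u =>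
    Measure.isProbabilityMeasure_map (hΦ u).measurable.aemeasurable
  let V : E → E := fun u => BoundedContinuousFunction.ofNormedAddCommGroup
    (fun x => -fieldConv G (μ₀.map fun x => x + u x) (x + u x))
    (((lipschitz_fieldConv hG hM).continuous.comp (hΦ u)).neg) M
    (fun x => by rw [norm_neg]; exact norm_fieldConv_le hM _)
  have hVb : ∀ u, ‖V u‖ ≤ M := fun u => BoundedContinuousFunction.norm_ofNormedAddCommGroup_le _
    M.2 _
  -- One `Λ` accounts for the point of evaluation, the other for the measure pushed by the same
  -- displacement.
  have hVl : LipschitzWith (2 * Λ) V := by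
    refine LipschitzWith.of_dist_le_mul fun u v => ?_
    refine (BoundedContinuousFunction.dist_le (by positivity)).2 fun x => ?_
    have hi : ∀ (w : E) (z : RSpace d), Integrable (fun y => G (z - (y + w y))) μ₀ := fun w z =>
      Integrable.of_bound ((hG.continuous.comp (continuous_const.sub (hΦ w))).aestronglyMeasurable)
        M (Eventually.of_forall fun _ => hM _)
    change dist (-fieldConv G (μ₀.map fun x => x + u x) (x + u x))
      (-fieldConv G (μ₀.map fun x => x + v x) (x + v x)) ≤ _
    rw [dist_neg_neg, fieldConv_map hG (hΦ u).measurable, fieldConv_map hG (hΦ v).measurable,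
      dist_eq_norm, ← integral_sub (hi u _) (hi v _)]
    refine (norm_integral_le_of_norm_le_const (C := 2 * Λ * dist u v)
      (Eventually.of_forall fun y => ?_)).trans (by simp)
    have h1 := hG.dist_le_mul (x + u x - (y + u y)) (x + v x - (y + v y))
    rw [dist_eq_norm] at h1
    refine h1.trans ?_
    have h2 : dist (x + u x - (y + u y)) (x + v x - (y + v y)) ≤ dist u v + dist u v := by
      refine (dist_sub_sub_le _ _ _ _).trans (add_le_add ?_ ?_)
      · rw [dist_add_left]; exact BoundedContinuousFunction.dist_coe_le_dist x
      · rw [dist_add_left]; exact BoundedContinuousFunction.dist_coe_le_dist y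
    calc (Λ : ℝ) * dist (x + u x - (y + u y)) (x + v x - (y + v y))
        ≤ Λ * (dist u v + dist u v) := by gcongr
      _ = 2 * Λ * dist u v := by ring
  -- The speed never exceeds `M`, so a solution starting at `0` stays in the ball of radius `M * T`
  -- up to time `T`; existence is thus obtained on the whole interval at once.
  have hPL : IsPicardLindelof (fun _ => V) (⟨0, le_rfl, hT⟩ : Icc (0 : ℝ) T) 0
      (M * ⟨T, hT⟩) 0 M (2 * Λ) :=
    IsPicardLindelof.of_time_independent (fun u _ => hVb u) hVl.lipschitzOnWith (by
      simp only [sub_self, sub_zero, max_eq_left hT, NNReal.coe_zero]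
      rfl)
  obtain ⟨u, hu0, hu⟩ := hPL.exists_eq_forall_mem_Icc_hasDerivWithinAt₀
  refine ⟨fun t x => x + u t x, ?_, fun t => hΦ (u t), fun t ht x => ?_⟩
  · funext x
    have : u 0 = 0 := hu0
    change x + u 0 x = x
    rw [this]
    exact add_zero x
  · have h1 := (BoundedContinuousFunction.evalCLM ℝ x : E →L[ℝ] RSpace d).hasFDerivAt
      (x := u t) |>.comp_hasDerivWithinAt t (hu t ht)
    exact h1.const_add x

/-- The bounds of a test function and its gradient. -/
theorem exists_testFunction_bounds {d : ℕ} {φ : RSpace d → ℝ} (hφ : ContDiff ℝ ∞ φ)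
    (hc : HasCompactSupport φ) :
    ∃ L : ℝ≥0, LipschitzWith L φ ∧ (∀ x, ‖φ x‖ ≤ L) ∧ (∀ x, ‖∇ φ x‖ ≤ L) ∧
      LipschitzWith L (∇ φ) := by
  have hg : ContDiff ℝ ∞ (∇ φ) :=
    (InnerProductSpace.toDual ℝ (RSpace d)).symm.toContinuousLinearEquiv.contDiff.comp
      (hφ.fderiv_right (m := ∞) (by simp))
  have hgc : HasCompactSupport (∇ φ) :=
    (hc.fderiv ℝ).comp_left (g := (InnerProductSpace.toDual ℝ (RSpace d)).symm) (map_zero _)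
  obtain ⟨L1, h1⟩ := hφ.lipschitzWith_of_hasCompactSupport hc (by simp)
  obtain ⟨L2, h2⟩ := hg.lipschitzWith_of_hasCompactSupport hgc (by simp)
  obtain ⟨C1, h3⟩ := hφ.continuous.bounded_above_of_compact_support hc
  obtain ⟨C2, h4⟩ := hg.continuous.bounded_above_of_compact_support hgc
  refine ⟨L1 + L2 + C1.toNNReal + C2.toNNReal, h1.weaken ?_, fun x => (h3 x).trans ?_,
    fun x => (h4 x).trans ?_, h2.weaken ?_⟩
  · rw [add_assoc, add_assoc]; exact le_self_add
  · have := Real.le_coe_toNNReal C1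
    push_cast; linarith [L1.2, L2.2, C2.toNNReal.2, NNReal.coe_nonneg L1, NNReal.coe_nonneg L2, NNReal.coe_nonneg C2.toNNReal]
  · have := Real.le_coe_toNNReal C2
    push_cast; linarith [NNReal.coe_nonneg L1, NNReal.coe_nonneg L2, NNReal.coe_nonneg C1.toNNReal]
  · calc L2 ≤ L1 + L2 := le_add_self
      _ ≤ L1 + L2 + C1.toNNReal + C2.toNNReal := by rw [add_assoc (L1 + L2)]; exact le_self_add

theorem IsP2Curve.continuousOn_integral_inner_gradient {d : ℕ} {T : ℝ}
    {μ : ℝ → Measure (RSpace d)} (hμ : IsP2Curve T μ) {G : RSpace d → RSpace d} {Λ M : ℝ≥0}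
    (hG : LipschitzWith Λ G) (hM : ∀ x, ‖G x‖ ≤ M) {φ : RSpace d → ℝ} (hφ : ContDiff ℝ ∞ φ)
    (hc : HasCompactSupport φ) :
    ContinuousOn (fun t => ∫ x, (inner ℝ (∇ φ x) (fieldConv G (μ t) x) : ℝ) ∂(μ t)) (Icc 0 T) := by
  obtain ⟨L, -, -, h3, h4⟩ := exists_testFunction_bounds hφ hc
  refine hμ.continuousOn_integral_comp_fieldConv (Θ := fun x a => (inner ℝ (∇ φ x) a : ℝ))
    (C := L * (M + 1)) (B := L * M) (fun x y a b ha hb => ?_) (fun x a ha => ?_) hG hM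
  · have e : (inner ℝ (∇ φ x) a - inner ℝ (∇ φ y) b : ℝ) =
        inner ℝ (∇ φ x - ∇ φ y) a + inner ℝ (∇ φ y) (a - b) := by
      rw [inner_sub_left, inner_sub_right]; ring
    rw [e]
    refine (norm_add_le _ _).trans ?_
    have i1 : ‖(inner ℝ (∇ φ x - ∇ φ y) a : ℝ)‖ ≤ L * ‖x - y‖ * M := by
      refine (norm_inner_le_norm _ _).trans ?_
      have := h4.dist_le_mul x y
      rw [dist_eq_norm, dist_eq_norm] at this
      gcongr
    have i2 : ‖(inner ℝ (∇ φ y) (a - b) : ℝ)‖ ≤ L * ‖a - b‖ := by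
      refine (norm_inner_le_norm _ _).trans ?_
      gcongr
      exact h3 y
    push_cast
    nlinarith [mul_nonneg (NNReal.coe_nonneg L) (norm_nonneg (x - y)),
      mul_nonneg (mul_nonneg (NNReal.coe_nonneg L) (NNReal.coe_nonneg M)) (norm_nonneg (a - b))]
  · refine (norm_inner_le_norm _ _).trans ?_
    gcongr
    exact h3 x

theorem IsP2Curve.continuousOn_integral_testFunction {d : ℕ} {T : ℝ}
    {μ : ℝ → Measure (RSpace d)} (hμ : IsP2Curve T μ) {φ : RSpace d → ℝ} (hφ : ContDiff ℝ ∞ φ)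
    (hc : HasCompactSupport φ) :
    ContinuousOn (fun t => ∫ x, φ x ∂(μ t)) (Icc 0 T) := by
  obtain ⟨L, h1, h2, -, -⟩ := exists_testFunction_bounds hφ hc
  -- The kernel is trivial and `Θ` ignores its second argument.
  refine hμ.continuousOn_integral_comp_fieldConv (G := fun _ => (0 : ℝ)) (Λ := 0) (M := 0)
    (Θ := fun x _ => φ x) (C := L) (B := L) (fun x y a b _ _ => ?_) (fun x _ _ => h2 x)
    (LipschitzWith.const _) (by simp)
  have := h1.dist_le_mul x y
  rw [dist_eq_norm, dist_eq_norm] at this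
  refine this.trans (mul_le_mul_of_nonneg_left ?_ L.2)
  linarith [norm_nonneg (a - b)]

/-- The image of the initial measure under the characteristic flow solves the aggregation
equation. -/
theorem isAggregationSolution_of_flow {d : ℕ} {T : ℝ} (hT : 0 ≤ T) {W : RSpace d → ℝ} {Λ M : ℝ≥0}
    (hG : LipschitzWith Λ (∇ W)) (hM : ∀ x, ‖∇ W x‖ ≤ M) {μ₀ : Measure (RSpace d)} (hμ₀ : MemP2 μ₀)
    {X : ℝ → RSpace d → RSpace d} (hX0 : X 0 = id) (hXc : ∀ t, Continuous (X t))
    (hX : ∀ t ∈ Icc 0 T, ∀ x, HasDerivWithinAt (fun s => X s x)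
        (-fieldConv (∇ W) (μ₀.map (X t)) (X t x)) (Icc 0 T) t) :
    IsAggregationSolution T W (fun t => μ₀.map (X t)) := by
  have hp := hμ₀.1
  have hpt : ∀ t, IsProbabilityMeasure (μ₀.map (X t)) := fun t =>
    Measure.isProbabilityMeasure_map (hXc t).measurable.aemeasurable
  have hcurve : IsP2Curve T (fun t => μ₀.map (X t)) := by
    refine isP2Curve_map (M := M) hT (fun t => (hXc t).measurable) (by rw [hX0, Measure.map_id]; exact hμ₀)
      fun s hs t ht x => ?_
    exact norm_sub_le_of_hasDerivWithinAt_Icc (fun t ht => hX t ht x)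
      (fun t ht => by rw [norm_neg]; exact norm_fieldConv_le hM _) hs ht
  refine ⟨hcurve, fun φ hφ hc t ht => ?_⟩
  obtain ⟨L, h1, h2, h3, h4⟩ := exists_testFunction_bounds hφ hc
  have hJ := hcurve.continuousOn_integral_testFunction hφ hc
  have hI := hcurve.continuousOn_integral_inner_gradient hG hM hφ hc
  have hsub : Icc 0 t ⊆ Icc 0 T := Icc_subset_Icc_right ht.2
  -- Along characteristics the weak formulation is the chain rule for `φ (X s x)`; the constant `L *
  -- M` dominates the derivative.
  have hder : ∀ s ∈ Ioo 0 t, HasDerivAt (fun t => ∫ x, φ x ∂(μ₀.map (X t)))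
      (-∫ x, (inner ℝ (∇ φ x) (fieldConv (∇ W) (μ₀.map (X s)) x) : ℝ) ∂(μ₀.map (X s))) s := by
    intro s hs
    have hm : ∀ s, ∫ x, φ x ∂(μ₀.map (X s)) = ∫ x, φ (X s x) ∂μ₀ := fun s =>
      integral_map (hXc s).measurable.aemeasurable hφ.continuous.aestronglyMeasurable
    simp_rw [hm]
    have hcont : ∀ s, Continuous fun x => (inner ℝ (∇ φ x) (fieldConv (∇ W) (μ₀.map (X s)) x) : ℝ) :=
      fun s => h4.continuous.inner (lipschitz_fieldConv hG hM).continuous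
    rw [integral_map (hXc s).measurable.aemeasurable (hcont s).aestronglyMeasurable, ← integral_neg]
    have hnhds : Ioo 0 t ∈ 𝓝 s := Ioo_mem_nhds hs.1 hs.2
    refine (hasDerivAt_integral_of_dominated_loc_of_deriv_le (bound := fun _ => (L : ℝ) * M)
      (F' := fun s x => -(inner ℝ (∇ φ (X s x)) (fieldConv (∇ W) (μ₀.map (X s)) (X s x)) : ℝ)) hnhds
      (Eventually.of_forall fun s => (hφ.continuous.comp (hXc s)).aestronglyMeasurable)
      (Integrable.of_bound (hφ.continuous.comp (hXc s)).aestronglyMeasurable L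
        (Eventually.of_forall fun x => h2 _))
      ((hcont s).comp (hXc s)).neg.aestronglyMeasurable
      (Eventually.of_forall fun x r hr => ?_) (integrable_const _)
      (Eventually.of_forall fun x r hr => ?_)).2
    · rw [norm_neg]
      refine (norm_inner_le_norm _ _).trans ?_
      gcongr
      · exact h3 _
      · exact norm_fieldConv_le hM _
    · have hr' : Icc 0 T ∈ 𝓝 r :=
        mem_of_superset (Ioo_mem_nhds hr.1 hr.2) (Ioo_subset_Icc_self.trans hsub)
      have d1 := (hX r (hsub (Ioo_subset_Icc_self hr)) x).hasDerivAt hr'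
      have d2 := ((hφ.differentiable (by simp) (X r x)).hasFDerivAt).comp_hasDerivAt r d1
      rw [map_neg] at d2
      rw [gradient, InnerProductSpace.toDual_symm_apply]
      exact d2
  have := intervalIntegral.integral_eq_sub_of_hasDerivAt_of_le ht.1 (hJ.mono hsub) hder
    ((hI.neg.mono hsub).intervalIntegrable_of_Icc ht.1)
  rw [intervalIntegral.integral_neg] at this
  exact this.symm

/-! ### Stability of Lagrangian systems -/

/-- A Grönwall estimate for a random curve whose derivative is controlled by the curve and its
mean. -/
theorem norm_le_of_norm_deriv_le_add_integral {Ω : Type*} [MeasurableSpace Ω] {P : Measure Ω}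
    [IsProbabilityMeasure P] {d : ℕ} {T Λ η C : ℝ} (hT : 0 ≤ T) (hΛ : 1 ≤ Λ) (hη : 0 < η)
    {D D' : ℝ → Ω → RSpace d}
    (hD : ∀ t ∈ Icc 0 T, ∀ w, HasDerivWithinAt (fun s => D s w) (D' t w) (Icc 0 T) t)
    (hD' : ∀ t ∈ Icc 0 T, ∀ w, ‖D' t w‖ ≤ Λ * ‖D t w‖ + Λ * ∫ w, ‖D t w‖ ∂P + η)
    (hC : ∀ t ∈ Icc 0 T, ∀ w, ‖D' t w‖ ≤ C) (hm : ∀ t, Measurable (D t))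
    (h0 : Integrable (D 0) P) {t : ℝ} (ht : t ∈ Icc 0 T) (w : Ω) :
    ‖D t w‖ ≤ (‖D 0 w‖ + ∫ w, ‖D 0 w‖ ∂P + 2 * η) * Real.exp (3 * Λ * t) := by
  have h0T : (0 : ℝ) ∈ Icc 0 T := ⟨le_rfl, hT⟩
  have hC0 : 0 ≤ C := (norm_nonneg _).trans (hC 0 h0T w)
  have hDb : ∀ t ∈ Icc 0 T, ∀ w, ‖D t w‖ ≤ ‖D 0 w‖ + C * T := fun t ht w => by
    have h1 := norm_sub_le_of_hasDerivWithinAt_Icc (fun t ht => hD t ht w)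
      (fun t ht => hC t ht w) ht h0T
    have h2 : C * |t - 0| ≤ C * T := by
      rw [sub_zero, abs_of_nonneg ht.1]; exact mul_le_mul_of_nonneg_left ht.2 hC0
    linarith [norm_le_norm_add_norm_sub' (D t w) (D 0 w)]
  have hint : ∀ t ∈ Icc 0 T, Integrable (fun w => ‖D t w‖) P := fun t ht =>
    (h0.norm.add (integrable_const (C * T))).mono' (hm t).norm.aestronglyMeasurable
      (Eventually.of_forall fun w => by rw [norm_norm]; exact hDb t ht w)
  set e : ℝ → ℝ := fun t => ∫ w, ‖D t w‖ ∂P with he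
  have he0 : ∀ t, 0 ≤ e t := fun t => integral_nonneg fun _ => norm_nonneg _
  -- The exponentially weighted supremum of the mean replaces an integral Grönwall inequality, so no
  -- regularity in time of the mean is required.
  set S : Set ℝ := (fun t => e t * Real.exp (-(3 * Λ * t))) '' Icc 0 T with hS
  have hSb : BddAbove S := by
    refine ⟨e 0 + C * T, ?_⟩
    rintro _ ⟨t, ht, rfl⟩
    have h1 : e t ≤ e 0 + C * T := by
      have := integral_mono (hint t ht) ((hint 0 h0T).add (integrable_const (C * T)))
        (fun w => hDb t ht w)
      simp only [Pi.add_apply] at this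
      rwa [integral_add (hint 0 h0T) (integrable_const _), integral_const, probReal_univ,
        one_smul] at this
    have h2 : Real.exp (-(3 * Λ * t)) ≤ 1 := by
      rw [Real.exp_le_one_iff]
      have := ht.1
      have : 0 ≤ 3 * Λ * t := by positivity
      linarith
    exact (mul_le_of_le_one_right (he0 t) h2).trans h1
  set m : ℝ := sSup S with hm'
  have hem : ∀ t ∈ Icc 0 T, e t ≤ m * Real.exp (3 * Λ * t) := fun t ht => by
    have h1 : e t * Real.exp (-(3 * Λ * t)) ≤ m := le_csSup hSb ⟨t, ht, rfl⟩
    have h2 := mul_le_mul_of_nonneg_right h1 (Real.exp_pos (3 * Λ * t)).le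
    rwa [mul_assoc, ← Real.exp_add, neg_add_cancel, Real.exp_zero, mul_one] at h2
  have hm0 : 0 ≤ m := by
    have := hem 0 h0T
    simp only [mul_zero, Real.exp_zero, mul_one] at this
    exact (he0 0).trans this
  -- A barrier for each fixed `w`. Where the norm touches the barrier `b`, its growth is at most `Λ
  -- * b + Λ * e + η`. The remaining `2 * Λ * b` of the barrier's slope `3 * Λ * b` strictly exceeds
  -- `Λ * e + η`, because `b` contains `(m / 2 + η)` times the exponential.
  have key : ∀ t ∈ Icc 0 T, ∀ w, ‖D t w‖ ≤ (‖D 0 w‖ + (m / 2 + η)) * Real.exp (3 * Λ * t) := by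
    intro t ht w
    refine image_norm_le_of_norm_deriv_right_lt_deriv_boundary (f := fun s => D s w)
      (f' := fun s => D' s w) (a := 0) (b := T)
      (B := fun t => (‖D 0 w‖ + (m / 2 + η)) * Real.exp (3 * Λ * t))
      (B' := fun t => (‖D 0 w‖ + (m / 2 + η)) * (Real.exp (3 * Λ * t) * (3 * Λ)))
      (fun s hs => (hD s hs w).continuousWithinAt)
      (fun s hs => (hD s (Ico_subset_Icc_self hs) w).mono_of_mem_nhdsWithin
        (Icc_mem_nhdsGE_of_mem hs)) ?_ (fun s => ?_) (fun s hs heq => ?_) ht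
    · simp only [mul_zero, Real.exp_zero, mul_one]; linarith
    · have h1 : HasDerivAt (fun t : ℝ => 3 * Λ * t) (3 * Λ) s := by
        simpa using (hasDerivAt_id s).const_mul (3 * Λ)
      exact (h1.exp).const_mul _
    · have hs' := Ico_subset_Icc_self hs
      have h1 := hD' s hs' w
      have h2 := hem s hs'
      have h3 : 1 ≤ Real.exp (3 * Λ * s) := by
        apply Real.one_le_exp
        have := hs.1
        positivity
      have h4 : 0 ≤ ‖D 0 w‖ * Real.exp (3 * Λ * s) := by positivity
      rw [heq] at h1
      refine h1.trans_lt ?_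
      have h5 : Λ * e s ≤ Λ * (m * Real.exp (3 * Λ * s)) := by gcongr
      have h6 : η * 1 ≤ η * Real.exp (3 * Λ * s) := by gcongr
      have h7 : η * Real.exp (3 * Λ * s) ≤ Λ * (η * Real.exp (3 * Λ * s)) :=
        le_mul_of_one_le_left (by positivity) hΛ
      have h8 : 0 ≤ Λ * (‖D 0 w‖ * Real.exp (3 * Λ * s)) := by positivity
      change _ + Λ * e s + η < _
      nlinarith
  -- Averaging the barrier bound over `w` returns half of `m`, which is then absorbed.
  have hm1 : m ≤ e 0 + (m / 2 + η) := by
    refine csSup_le (Nonempty.image _ ⟨0, h0T⟩) ?_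
    rintro _ ⟨t, ht, rfl⟩
    have h1 : e t ≤ (e 0 + (m / 2 + η)) * Real.exp (3 * Λ * t) := by
      have := integral_mono (hint t ht)
        (((hint 0 h0T).add (integrable_const (m / 2 + η))).mul_const (Real.exp (3 * Λ * t)))
        (fun w => key t ht w)
      simp only [Pi.add_apply] at this
      rwa [integral_mul_const, integral_add (hint 0 h0T) (integrable_const _), integral_const,
        probReal_univ, one_smul] at this
    have h2 := mul_le_mul_of_nonneg_right h1 (Real.exp_pos (-(3 * Λ * t))).le
    rwa [mul_assoc _ (Real.exp _), ← Real.exp_add, add_neg_cancel, Real.exp_zero, mul_one] at h2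
  refine (key t ht w).trans (mul_le_mul_of_nonneg_right ?_ (Real.exp_pos _).le)
  change _ ≤ _ + e 0 + _
  linarith

/-! ### Particle systems -/

section particles

variable {d N : ℕ}

theorem isProbabilityMeasure_empiricalMeasure (hN : N ≠ 0) (x : Fin N → RSpace d) :
    IsProbabilityMeasure (empiricalMeasure x) := by
  constructor
  simp only [empiricalMeasure, Measure.smul_apply, Measure.finsetSum_apply, measure_univ,
    Finset.sum_const, Finset.card_univ, Fintype.card_fin, smul_eq_mul, nsmul_eq_mul, mul_one]
  exact ENNReal.inv_mul_cancel (by exact_mod_cast hN) (ENNReal.natCast_ne_top N)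

theorem integral_empiricalMeasure {F : Type*} [NormedAddCommGroup F] [NormedSpace ℝ F]
    [FiniteDimensional ℝ F] (x : Fin N → RSpace d) (f : RSpace d → F) :
    ∫ z, f z ∂(empiricalMeasure x) = (1 / N : ℝ) • ∑ j, f (x j) := by
  have : CompleteSpace F := FiniteDimensional.complete ℝ F
  rw [empiricalMeasure, integral_smul_measure, integral_finsetSum_measure]
  · simp [integral_dirac]
  · intro i _
    exact integrable_dirac (by simp)

theorem map_empiricalMeasure (x : Fin N → RSpace d) {Y : RSpace d → RSpace d} (hY : Measurable Y) :
    (empiricalMeasure x).map Y = empiricalMeasure (Y ∘ x) := by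
  rw [empiricalMeasure, empiricalMeasure, Measure.map_smul]
  congr 1
  rw [← Measure.mapₗ_apply_of_measurable hY, map_sum]
  simp [Measure.mapₗ_apply_of_measurable hY, Measure.map_dirac' hY]

theorem memP2_empiricalMeasure (hN : N ≠ 0) (x : Fin N → RSpace d) :
    MemP2 (empiricalMeasure x) := by
  refine ⟨isProbabilityMeasure_empiricalMeasure hN x, ?_⟩
  rw [empiricalMeasure, lintegral_smul_measure, lintegral_finsetSum_measure]
  refine ENNReal.mul_lt_top (by simpa using Nat.pos_of_ne_zero hN) (ENNReal.sum_lt_top.2 fun i _ => ?_)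
  rw [lintegral_dirac' _ (measurable_enorm.pow_const 2)]
  simp

variable {T : ℝ} {W : RSpace d → ℝ} {x : ℝ → Fin N → RSpace d} {Λ M : ℝ≥0}

/-- The term `j = i` is added and subtracted to obtain a full convolution. No symmetry makes `∇ W 0`
vanish, so it stays as an error of order `1/N`. -/
theorem IsParticleSolution.hasDerivWithinAt (hx : IsParticleSolution T W x) {t : ℝ} (ht : t ∈ Icc 0 T) (i : Fin N) :
    HasDerivWithinAt (fun s => x s i)
      ((1 / N : ℝ) • ∇ W 0 - fieldConv (∇ W) (empiricalMeasure (x t)) (x t i)) (Icc 0 T) t := by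
  convert hx t ht i using 1
  rw [fieldConv, integral_empiricalMeasure,
    ← Finset.add_sum_erase _ _ (Finset.mem_univ i), sub_self, smul_add]
  abel

/-- The self-interaction term is the same for all particles, so all of them follow one Lipschitz
field and coincident particles never separate. Hence trajectories are functions of the initial
position, and plans on `RSpace d × RSpace d` can be transported. -/
theorem IsParticleSolution.eq_of_initial_eq (hN : N ≠ 0) (hx : IsParticleSolution T W x)
    (hG : LipschitzWith Λ (∇ W)) (hM : ∀ z, ‖∇ W z‖ ≤ M) {i j : Fin N} (h0 : x 0 i = x 0 j)
    {t : ℝ} (ht : t ∈ Icc 0 T) : x t i = x t j := by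
  rw [← sub_eq_zero]
  have hd : ∀ s ∈ Icc 0 T, HasDerivWithinAt (fun s => x s i - x s j) _ (Icc 0 T) s := fun s hs =>
    (hx.hasDerivWithinAt hs i).sub (hx.hasDerivWithinAt hs j)
  refine eq_zero_of_abs_deriv_le_mul_abs_self_of_eq_zero_right (K := Λ)
    (f := fun s => x s i - x s j) (a := 0) (b := T)
    (fun s hs => (hd s hs).continuousWithinAt)
    (fun s hs => (hd s (Ico_subset_Icc_self hs)).mono_of_mem_nhdsWithin
        (Icc_mem_nhdsGE_of_mem hs)) (by simp [h0]) (fun s hs => ?_) t ht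
  have := isProbabilityMeasure_empiricalMeasure hN (x s)
  have h1 := (lipschitz_fieldConv (μ := empiricalMeasure (x s)) hG hM).dist_le_mul (x s i) (x s j)
  rw [sub_sub_sub_cancel_left, norm_sub_rev]
  rwa [dist_eq_norm, dist_eq_norm] at h1

/-- The particle trajectories as a function of the initial positions. -/
theorem IsParticleSolution.exists_index (hN : N ≠ 0) (hx : IsParticleSolution T W x)
    (hG : LipschitzWith Λ (∇ W)) (hM : ∀ z, ‖∇ W z‖ ≤ M) :
    ∃ ι : RSpace d → Fin N, Measurable ι ∧ ∀ t ∈ Icc 0 T, ∀ j, x t (ι (x 0 j)) = x t j := by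
  classical
  have : NeZero N := ⟨hN⟩
  let ι : RSpace d → Fin N := fun z => if h : ∃ i, x 0 i = z then h.choose else 0
  refine ⟨ι, ?_, fun t ht j => ?_⟩
  -- Off the countable set of initial positions `ι` takes the default index `0`.
  · refine (measurable_const (a := (0 : Fin N))).measurable_of_countable_ne
      ((countable_range (x 0)).mono fun z hz => ?_)
    by_contra hne
    have h1 : ¬ ∃ i, x 0 i = z := hne
    exact hz (by simp [ι, h1])
  · have h : ∃ i, x 0 i = x 0 j := ⟨j, rfl⟩
    have h1 : ι (x 0 j) = h.choose := dif_pos h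
    rw [h1]
    exact hx.eq_of_initial_eq hN hG hM h.choose_spec ht

theorem IsParticleSolution.isP2Curve (hT : 0 ≤ T) (hN : N ≠ 0) (hx : IsParticleSolution T W x)
    (hG : LipschitzWith Λ (∇ W)) (hM : ∀ z, ‖∇ W z‖ ≤ M) :
    IsP2Curve T (fun t => empiricalMeasure (x t)) := by
  obtain ⟨ι, hι, hιx⟩ := hx.exists_index hN hG hM
  have hp := isProbabilityMeasure_empiricalMeasure hN (x 0)
  have hmeas : ∀ t, Measurable fun z => x t (ι z) := fun t => Measurable.of_discrete.comp hι
  have hmap : ∀ t ∈ Icc 0 T, (empiricalMeasure (x 0)).map (fun z => x t (ι z)) =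
      empiricalMeasure (x t) := fun t ht => by
    rw [map_empiricalMeasure _ (hmeas t)]
    congr 1
    exact funext (hιx t ht)
  have h0 : (0 : ℝ) ∈ Icc 0 T := ⟨le_rfl, hT⟩
  have key := isP2Curve_map (T := T) (M := M + M) (P := empiricalMeasure (x 0)) hT hmeas
    (by rw [hmap 0 h0]; exact memP2_empiricalMeasure hN _) (fun s hs t ht z => ?_)
  · intro t ht
    have h1 := key t ht
    simp only [hmap t ht] at h1
    refine ⟨h1.1, h1.2.congr' ?_⟩
    filter_upwards [self_mem_nhdsWithin] with s hs
    rw [hmap s hs]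
  · refine norm_sub_le_of_hasDerivWithinAt_Icc (f := fun t => x t (ι z))
      (fun t ht => hx.hasDerivWithinAt ht _) (fun t ht => ?_) hs ht
    have := isProbabilityMeasure_empiricalMeasure hN (x t)
    refine (norm_sub_le _ _).trans (add_le_add ?_ (norm_fieldConv_le hM _))
    rw [norm_smul]
    refine (mul_le_of_le_one_left (norm_nonneg _) ?_).trans (hM 0)
    have : (1 : ℝ) ≤ N := by exact_mod_cast Nat.one_le_iff_ne_zero.2 hN
    rw [Real.norm_of_nonneg (by positivity), div_le_one (by positivity)]
    exact this

end particles

/-! ### The mean-field limit -/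

/-- The mean displacement is bounded by the root of the cost through Cauchy–Schwarz. Squaring the
three terms gives coefficients `6` and `12`, both rounded up to `16 = 4 ^ 2`. -/
theorem d2_sq_le_of_flow_coupling {d : ℕ} {μ ν : Measure (RSpace d)} [IsProbabilityMeasure μ]
    {γ : Measure (RSpace d × RSpace d)} (hγ : γ ∈ Couplings μ ν) {Y X : RSpace d × RSpace d → RSpace d}
    (hY : Measurable Y) (hX : Measurable X) {E η : ℝ} (hE : 0 ≤ E) (hη : 0 ≤ η)
    (hb : ∀ᵐ p ∂γ, ‖Y p - X p‖ ≤ (‖p.1 - p.2‖ + ∫ p, ‖p.1 - p.2‖ ∂γ + 2 * η) * E) :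
    d2 (γ.map Y) (γ.map X) ^ 2 ≤
      ENNReal.ofReal (4 * E) ^ 2 * (transportCost γ + ENNReal.ofReal η ^ 2) := by
  have hp := Couplings.isProbabilityMeasure hγ
  have hD : Measurable fun p : RSpace d × RSpace d => ‖p.1 - p.2‖ₑ :=
    (measurable_fst.sub measurable_snd).enorm
  set e := ∫ p, ‖p.1 - p.2‖ ∂γ with he
  have he0 : 0 ≤ e := integral_nonneg fun _ => norm_nonneg _
  have hee : ENNReal.ofReal e ≤ ∫⁻ p, ‖p.1 - p.2‖ₑ ∂γ := by
    rw [← Real.enorm_of_nonneg he0, he]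
    refine (enorm_integral_le_lintegral_enorm _).trans_eq ?_
    simp
  have he2 : ENNReal.ofReal e ^ 2 ≤ transportCost γ :=
    (pow_le_pow_left' hee 2).trans (sq_lintegral_enorm_sub_le γ)
  have sq3 : ∀ a b c : ℝ≥0∞, (a + b + c) ^ 2 ≤ 3 * (a ^ 2 + b ^ 2 + c ^ 2) := by
    intro a b c
    induction a with
    | top => simp
    | coe a =>
    induction b with
    | top => simp
    | coe b =>
    induction c with
    | top => simp
    | coe c =>
    have h : (a + b + c) ^ 2 ≤ 3 * (a ^ 2 + b ^ 2 + c ^ 2) := by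
      rw [← NNReal.coe_le_coe]
      push_cast
      nlinarith [sq_nonneg ((a : ℝ) - b), sq_nonneg ((b : ℝ) - c), sq_nonneg ((a : ℝ) - c)]
    exact_mod_cast h
  have hb' : ∀ᵐ p ∂γ, ‖Y p - X p‖ₑ ^ 2 ≤ ENNReal.ofReal E ^ 2 *
      (3 * (‖p.1 - p.2‖ₑ ^ 2 + ENNReal.ofReal e ^ 2 + ENNReal.ofReal (2 * η) ^ 2)) := by
    filter_upwards [hb] with p hp
    have h1 : ‖Y p - X p‖ₑ ≤
        ENNReal.ofReal E * (‖p.1 - p.2‖ₑ + ENNReal.ofReal e + ENNReal.ofReal (2 * η)) := by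
      rw [← ofReal_norm, ← ofReal_norm, ← ENNReal.ofReal_add (norm_nonneg _) he0,
        ← ENNReal.ofReal_add (by positivity) (by positivity), ← ENNReal.ofReal_mul hE]
      exact ENNReal.ofReal_le_ofReal (by linarith)
    refine (pow_le_pow_left' h1 2).trans ?_
    rw [mul_pow]
    gcongr
    exact sq3 _ _ _
  refine (d2_map_sq_le γ hY hX).trans ((lintegral_mono_ae hb').trans ?_)
  have hm2 : Measurable fun p : RSpace d × RSpace d => ‖p.1 - p.2‖ₑ ^ 2 := hD.pow_const 2
  rw [lintegral_const_mul _ (by fun_prop), lintegral_const_mul _ (by fun_prop),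
    lintegral_add_right _ measurable_const, lintegral_add_right _ measurable_const]
  simp only [lintegral_const, measure_univ, mul_one]
  change _ * (3 * (transportCost γ + _ + _)) ≤ _
  calc ENNReal.ofReal E ^ 2 *
        (3 * (transportCost γ + ENNReal.ofReal e ^ 2 + ENNReal.ofReal (2 * η) ^ 2))
      ≤ ENNReal.ofReal E ^ 2 *
        (3 * (transportCost γ + transportCost γ + (2 * ENNReal.ofReal η) ^ 2)) := by
        gcongr
        rw [ENNReal.ofReal_mul (by norm_num)]
        simp
    _ = ENNReal.ofReal E ^ 2 * (6 * transportCost γ + 12 * ENNReal.ofReal η ^ 2) := by ring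
    _ ≤ ENNReal.ofReal E ^ 2 * (16 * transportCost γ + 16 * ENNReal.ofReal η ^ 2) := by
        gcongr <;> norm_num
    _ = _ := by
        rw [ENNReal.ofReal_mul (by norm_num), ENNReal.ofReal_ofNat]; ring

/-- Wasserstein distance between a particle system and a characteristic flow. -/
theorem d2_empiricalMeasure_flow_le {d N : ℕ} (hN : N ≠ 0) {T : ℝ} (hT : 0 ≤ T)
    {V W : RSpace d → ℝ} {Λ M : ℝ≥0} (hΛ : 1 ≤ Λ) (hV : LipschitzWith Λ (∇ V))
    (hVM : ∀ z, ‖∇ V z‖ ≤ M) (hW : LipschitzWith Λ (∇ W)) (hWM : ∀ z, ‖∇ W z‖ ≤ M) {η : ℝ}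
    (hη : 0 < η) (hVW : ∀ z, ‖∇ V z - ∇ W z‖ + (1 / N : ℝ) * M ≤ η)
    {x : ℝ → Fin N → RSpace d} (hx : IsParticleSolution T V x) {μ₀ : Measure (RSpace d)}
    [IsProbabilityMeasure μ₀] {X : ℝ → RSpace d → RSpace d} (hX0 : X 0 = id)
    (hXc : ∀ t, Continuous (X t))
    (hX : ∀ t ∈ Icc 0 T, ∀ x, HasDerivWithinAt (fun s => X s x)
        (-fieldConv (∇ W) (μ₀.map (X t)) (X t x)) (Icc 0 T) t) {t : ℝ} (ht : t ∈ Icc 0 T) :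
    d2 (empiricalMeasure (x t)) (μ₀.map (X t)) ≤
      ENNReal.ofReal (4 * Real.exp (3 * Λ * T)) *
        (d2 (empiricalMeasure (x 0)) μ₀ + ENNReal.ofReal η) := by
  obtain ⟨ι, hι, hιx⟩ := hx.exists_index hN hV hVM
  have hp0 := isProbabilityMeasure_empiricalMeasure hN (x 0)
  have h0T : (0 : ℝ) ∈ Icc 0 T := ⟨le_rfl, hT⟩
  have hmeas : ∀ t, Measurable fun z => x t (ι z) := fun t => Measurable.of_discrete.comp hι
  have hmap : ∀ t ∈ Icc 0 T, (empiricalMeasure (x 0)).map (fun z => x t (ι z)) =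
      empiricalMeasure (x t) := fun t ht => by
    rw [map_empiricalMeasure _ (hmeas t)]
    congr 1
    exact funext (hιx t ht)
  have hN1 : (1 / N : ℝ) * M ≤ M := by
    refine mul_le_of_le_one_left M.2 ?_
    have : (1 : ℝ) ≤ N := by exact_mod_cast Nat.one_le_iff_ne_zero.2 hN
    rw [div_le_one (by positivity)]
    exact this
  set E := Real.exp (3 * Λ * T) with hE
  have hE0 : 0 < E := Real.exp_pos _
  have key : ∀ γ ∈ Couplings (empiricalMeasure (x 0)) μ₀,
      d2 (empiricalMeasure (x t)) (μ₀.map (X t)) ^ 2 ≤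
      ENNReal.ofReal (4 * E) ^ 2 * (transportCost γ + ENNReal.ofReal η ^ 2) := by
    intro γ hγ
    have hp := Couplings.isProbabilityMeasure hγ
    -- A plan of infinite cost gives nothing to prove; finite cost makes the initial displacement
    -- integrable.
    rcases eq_or_ne (transportCost γ) ⊤ with htop | htop
    · rw [htop, top_add, ENNReal.mul_top (by simp; positivity)]
      exact le_top
    let Y : ℝ → RSpace d × RSpace d → RSpace d := fun t p => x t (ι p.1)
    let Z : ℝ → RSpace d × RSpace d → RSpace d := fun t p => X t p.2
    have hYm : ∀ t, Measurable (Y t) := fun t => (hmeas t).comp measurable_fst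
    have hZm : ∀ t, Measurable (Z t) := fun t => (hXc t).measurable.comp measurable_snd
    have hY : ∀ t ∈ Icc 0 T, γ.map (Y t) = empiricalMeasure (x t) := fun t ht => by
      rw [← hmap t ht, ← hγ.1, Measure.map_map (hmeas t) measurable_fst]; rfl
    have hZ : ∀ t, γ.map (Z t) = μ₀.map (X t) := fun t => by
      rw [← hγ.2, Measure.map_map (hXc t).measurable measurable_snd]; rfl
    -- `ι` recovers a position only at the particles, which carry the first marginal; hence the
    -- equality holds almost everywhere.
    have hD0 : ∀ᵐ p ∂γ, Y 0 p - Z 0 p = p.1 - p.2 := by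
      have h1 : ∀ᵐ z ∂(empiricalMeasure (x 0)), x 0 (ι z) = z := by
        rw [ae_iff, ← le_zero_iff]
        have hms : MeasurableSet {z | ¬ x 0 (ι z) = z} :=
          (measurableSet_eq_fun (hmeas 0) measurable_id).compl
        rw [empiricalMeasure, Measure.smul_apply, Measure.finsetSum_apply]
        have : ∀ i ∈ Finset.univ, Measure.dirac (x 0 i) {z | ¬ x 0 (ι z) = z} = 0 := fun i _ => by
          rw [Measure.dirac_apply' _ hms, indicator_of_notMem]
          simpa using hιx 0 h0T i
        rw [Finset.sum_eq_zero this, smul_zero]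
      rw [← hγ.1] at h1
      filter_upwards [ae_of_ae_map measurable_fst.aemeasurable h1] with p hp
      simp only [Y, Z, hX0, hp, id]
    have hi0 : Integrable (fun p : RSpace d × RSpace d => p.1 - p.2) γ := by
      refine ⟨(measurable_fst.sub measurable_snd).aestronglyMeasurable, ?_⟩
      refine lt_top_iff_ne_top.2 fun h => htop ?_
      have := sq_lintegral_enorm_sub_le γ
      change ∫⁻ p, ‖p.1 - p.2‖ₑ ∂γ = ⊤ at h
      rw [h] at this
      exact top_le_iff.1 (by simpa using this)
    have hDi0 : Integrable (Y 0 - Z 0) γ := hi0.congr (hD0.mono fun p hp => hp.symm)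
    have hder : ∀ t ∈ Icc 0 T, ∀ p, HasDerivWithinAt (fun s => (Y s - Z s) p)
        (((1 / N : ℝ) • ∇ V 0 - fieldConv (∇ V) (empiricalMeasure (x t)) (Y t p)) -
          (-fieldConv (∇ W) (μ₀.map (X t)) (Z t p))) (Icc 0 T) t := fun t ht p =>
      (hx.hasDerivWithinAt ht (ι p.1)).sub (hX t ht p.2)
    have hbound : ∀ t ∈ Icc 0 T, ∀ p,
        ‖((1 / N : ℝ) • ∇ V 0 - fieldConv (∇ V) (empiricalMeasure (x t)) (Y t p)) -
          (-fieldConv (∇ W) (μ₀.map (X t)) (Z t p))‖ ≤ 3 * M := fun t ht p => by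
      have := isProbabilityMeasure_empiricalMeasure hN (x t)
      have : IsProbabilityMeasure (μ₀.map (X t)) :=
        Measure.isProbabilityMeasure_map (hXc t).measurable.aemeasurable
      refine (norm_sub_le _ _).trans ?_
      rw [norm_neg]
      have h1 := norm_sub_le ((1 / N : ℝ) • ∇ V 0)
        (fieldConv (∇ V) (empiricalMeasure (x t)) (Y t p))
      have h2 := norm_fieldConv_le (μ := empiricalMeasure (x t)) hVM (Y t p)
      have h3 := norm_fieldConv_le (μ := μ₀.map (X t)) hWM (Z t p)
      have h4 : ‖(1 / N : ℝ) • ∇ V 0‖ ≤ M := by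
        rw [norm_smul, Real.norm_of_nonneg (by positivity)]
        exact (mul_le_mul_of_nonneg_left (hVM 0) (by positivity)).trans hN1
      linarith
    have hDi : ∀ t ∈ Icc 0 T, Integrable (Y t - Z t) γ := fun t ht => by
      refine (hDi0.norm.add (integrable_const (3 * M * |t - 0|))).mono'
        ((hYm t).sub (hZm t)).aestronglyMeasurable (Eventually.of_forall fun p => ?_)
      have h1 := norm_sub_le_of_hasDerivWithinAt_Icc (fun t ht => hder t ht p)
        (fun t ht => hbound t ht p) ht h0T
      have h2 := norm_le_norm_add_norm_sub' ((Y t - Z t) p) ((Y 0 - Z 0) p)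
      simp only [Pi.add_apply]
      linarith
    have hgron : ∀ t ∈ Icc 0 T, ∀ p,
        ‖((1 / N : ℝ) • ∇ V 0 - fieldConv (∇ V) (empiricalMeasure (x t)) (Y t p)) -
          (-fieldConv (∇ W) (μ₀.map (X t)) (Z t p))‖ ≤
        Λ * ‖(Y t - Z t) p‖ + Λ * ∫ q, ‖(Y t - Z t) q‖ ∂γ + η := fun t ht p => by
      have i1 : Integrable (fun q => ∇ V (Y t p - Y t q)) γ :=
        Integrable.of_bound (hV.continuous.measurable.comp
          (measurable_const.sub (hYm t))).aestronglyMeasurable M (Eventually.of_forall fun _ => hVM _)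
      have i2 : Integrable (fun q => ∇ W (Z t p - Z t q)) γ :=
        Integrable.of_bound (hW.continuous.measurable.comp
          (measurable_const.sub (hZm t))).aestronglyMeasurable M (Eventually.of_forall fun _ => hWM _)
      rw [← hY t ht, ← hZ t, fieldConv_map hV (hYm t), fieldConv_map hW (hZm t)]
      have e1 : (1 / N : ℝ) • ∇ V 0 - ∫ q, ∇ V (Y t p - Y t q) ∂γ -
          -∫ q, ∇ W (Z t p - Z t q) ∂γ =
          (1 / N : ℝ) • ∇ V 0 - ∫ q, (∇ V (Y t p - Y t q) - ∇ W (Z t p - Z t q)) ∂γ := by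
        rw [integral_sub i1 i2]; abel
      rw [e1]
      refine (norm_sub_le _ _).trans ?_
      have h4 : ‖(1 / N : ℝ) • ∇ V 0‖ ≤ (1 / N : ℝ) * M := by
        rw [norm_smul, Real.norm_of_nonneg (by positivity)]
        exact mul_le_mul_of_nonneg_left (hVM 0) (by positivity)
      -- The hypothesis on `η` already includes `M / N`; that part is set aside for the
      -- self-interaction, and the rest bounds the distance of the forces.
      have ib : Integrable (fun q => Λ * ‖(Y t - Z t) p‖ + (η - (1 / N : ℝ) * M) +
          Λ * ‖(Y t - Z t) q‖) γ := (integrable_const _).add ((hDi t ht).norm.const_mul _)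
      have h5 := norm_integral_le_of_norm_le ib
        (f := fun q => ∇ V (Y t p - Y t q) - ∇ W (Z t p - Z t q))
        (Eventually.of_forall fun q => ?_)
      · rw [integral_add (integrable_const _) ((hDi t ht).norm.const_mul _), integral_const,
          probReal_univ, one_smul, integral_const_mul] at h5
        linarith
      · have h6 := hVW (Z t p - Z t q)
        have h7 := hV.dist_le_mul (Y t p - Y t q) (Z t p - Z t q)
        have h8 := dist_sub_sub_le (Y t p) (Y t q) (Z t p) (Z t q)
        rw [dist_eq_norm] at h7
        rw [dist_eq_norm, dist_eq_norm] at h8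
        have h9 : ‖∇ V (Y t p - Y t q) - ∇ W (Z t p - Z t q)‖ ≤
            ‖∇ V (Y t p - Y t q) - ∇ V (Z t p - Z t q)‖ +
            ‖∇ V (Z t p - Z t q) - ∇ W (Z t p - Z t q)‖ := norm_sub_le_norm_sub_add_norm_sub _ _ _
        have h10 := mul_le_mul_of_nonneg_left h8 (NNReal.coe_nonneg Λ)
        simp only [Pi.sub_apply]
        rw [dist_eq_norm] at *
        linarith
    have main := fun p => norm_le_of_norm_deriv_le_add_integral (P := γ) hT
      (by exact_mod_cast hΛ) hη hder hgron hbound (fun t => (hYm t).sub (hZm t)) hDi0 ht p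
    have hint0 : ∫ p, ‖(Y 0 - Z 0) p‖ ∂γ = ∫ p, ‖p.1 - p.2‖ ∂γ :=
      integral_congr_ae (hD0.mono fun p hp => by simp only [Pi.sub_apply, hp])
    rw [← hY t ht, ← hZ t]
    refine d2_sq_le_of_flow_coupling hγ (hYm t) (hZm t) hE0.le hη.le ?_
    filter_upwards [hD0] with p hp
    have h1 := main p
    rw [hint0] at h1
    simp only [Pi.sub_apply] at h1
    rw [hp] at h1
    refine h1.trans (mul_le_mul_of_nonneg_left ?_ (by positivity))
    rw [hE]
    gcongr
    exact ht.2
  rw [← ENNReal.pow_le_pow_left_iff two_ne_zero]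
  have hA : ENNReal.ofReal (4 * E) ^ 2 ≠ 0 := by simp; positivity
  have hA' : ENNReal.ofReal (4 * E) ^ 2 ≠ ⊤ := ENNReal.pow_ne_top ENNReal.ofReal_ne_top
  -- Isolating the cost of `γ` turns `key` into a lower bound valid for every plan, so that the
  -- infimum can be taken.
  have h1 : d2 (empiricalMeasure (x t)) (μ₀.map (X t)) ^ 2 / ENNReal.ofReal (4 * E) ^ 2 -
      ENNReal.ofReal η ^ 2 ≤ d2 (empiricalMeasure (x 0)) μ₀ ^ 2 := by
    rw [d2_sq (μ := empiricalMeasure (x 0))]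
    refine le_iInf₂ fun γ hγ => ?_
    rw [tsub_le_iff_right]
    exact ENNReal.div_le_of_le_mul' (key γ hγ)
  rw [tsub_le_iff_right, ENNReal.div_le_iff hA hA'] at h1
  refine h1.trans ?_
  rw [mul_pow, mul_comm]
  gcongr
  rw [add_sq]
  calc _ ≤ d2 (empiricalMeasure (x 0)) μ₀ ^ 2 + ENNReal.ofReal η ^ 2 +
        2 * d2 (empiricalMeasure (x 0)) μ₀ * ENNReal.ofReal η := le_self_add
    _ = _ := by ring

theorem tendsto_iSup_d2_flow {d : ℕ} {T : ℝ} (hT : 0 ≤ T) {M : ℝ≥0} {K : Set (RSpace d)}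
    {V : ℕ → RSpace d → ℝ} {W : RSpace d → ℝ} (hV : ∀ N, V N ∈ XClass M K) (hW : W ∈ XClass M K)
    (hVW : TendstoUniformly (fun N => ∇ (V N)) (∇ W) atTop)
    {x : (N : ℕ) → ℝ → Fin N → RSpace d} (hx : ∀ N, IsParticleSolution T (V N) (x N))
    {μ₀ : Measure (RSpace d)} [IsProbabilityMeasure μ₀]
    (h0 : Tendsto (fun N => d2 (empiricalMeasure (x N 0)) μ₀) atTop (𝓝 0))
    {X : ℝ → RSpace d → RSpace d} (hX0 : X 0 = id) (hXc : ∀ t, Continuous (X t))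
    (hX : ∀ t ∈ Icc 0 T, ∀ x, HasDerivWithinAt (fun s => X s x)
        (-fieldConv (∇ W) (μ₀.map (X t)) (X t x)) (Icc 0 T) t) :
    Tendsto (fun N => ⨆ t ∈ Icc 0 T, d2 (empiricalMeasure (x N t)) (μ₀.map (X t)))
      atTop (𝓝 0) := by
  set Λ : ℝ≥0 := max 1 (gradLip d M) with hΛ
  set A : ℝ≥0∞ := ENNReal.ofReal (4 * Real.exp (3 * Λ * T)) with hA
  have hAt : A ≠ ⊤ := ENNReal.ofReal_ne_top
  have key : ∀ η : ℝ, 0 < η → ∀ᶠ N in atTop,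
      ⨆ t ∈ Icc 0 T, d2 (empiricalMeasure (x N t)) (μ₀.map (X t)) ≤
        A * (d2 (empiricalMeasure (x N 0)) μ₀ + ENNReal.ofReal η) := by
    intro η hη
    have h1 : Tendsto (fun N : ℕ => (1 / N : ℝ) * M) atTop (𝓝 0) := by
      simpa using (tendsto_one_div_atTop_nhds_zero_nat (𝕜 := ℝ)).mul_const (M : ℝ)
    filter_upwards [Metric.tendstoUniformly_iff.1 hVW (η / 2) (half_pos hη),
      h1.eventually (gt_mem_nhds (half_pos hη)), eventually_ne_atTop 0] with N hN1 hN2 hN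
    refine iSup₂_le fun t ht => ?_
    refine d2_empiricalMeasure_flow_le hN hT (le_max_left _ _)
      ((XClass.lipschitz_gradient (hV N)).weaken (le_max_right _ _))
      (XClass.norm_gradient_le (hV N)) ((XClass.lipschitz_gradient hW).weaken (le_max_right _ _))
      (XClass.norm_gradient_le hW) hη (fun z => ?_) (hx N) hX0 hXc hX ht
    have := hN1 z
    rw [dist_comm, dist_eq_norm] at this
    linarith
  rw [ENNReal.tendsto_nhds_zero]
  intro ε hε
  have h2 : ∀ η : ℝ, Tendsto (fun N => A * (d2 (empiricalMeasure (x N 0)) μ₀ + ENNReal.ofReal η))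
      atTop (𝓝 (A * (0 + ENNReal.ofReal η))) := fun η =>
    ENNReal.Tendsto.const_mul (h0.add_const _) (Or.inr hAt)
  have h3 : Tendsto (fun η => A * (0 + ENNReal.ofReal η)) (𝓝[>] 0) (𝓝 0) := by
    have : Tendsto (fun η => ENNReal.ofReal η) (𝓝[>] 0) (𝓝 0) := by
      simpa using (ENNReal.continuous_ofReal.tendsto 0).mono_left nhdsWithin_le_nhds
    simpa using ENNReal.Tendsto.const_mul this (Or.inr hAt)
  obtain ⟨η, hη1, hη2⟩ := ((h3.eventually (gt_mem_nhds hε)).and self_mem_nhdsWithin).exists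
  filter_upwards [key η hη2, (h2 η).eventually (gt_mem_nhds hη1)] with N hN1 hN2
  exact hN1.trans hN2.le

/-! ### Uniqueness of weak solutions -/

/-- Two finite measures agreeing on test functions are equal. -/
theorem Measure.ext_of_integral_testFunction {d : ℕ} {μ ν : Measure (RSpace d)}
    [IsProbabilityMeasure μ] [IsProbabilityMeasure ν]
    (h : ∀ φ : RSpace d → ℝ, ContDiff ℝ ∞ φ → HasCompactSupport φ → ∫ x, φ x ∂μ = ∫ x, φ x ∂ν) :
    μ = ν := by
  refine Measure.ext_of_integral_eq_on_compactlySupported fun f => ?_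
  refine eq_of_forall_dist_le fun ε hε => ?_
  obtain ⟨g, hg, hgf, hgs⟩ := f.continuous.exists_contDiff_approx ⊤
    (continuous_const (y := ε / 2)) (fun _ => half_pos hε)
  have hgc : HasCompactSupport g := f.hasCompactSupport.mono hgs
  have key : ∀ (m : Measure (RSpace d)) [IsProbabilityMeasure m],
      dist (∫ x, f x ∂m) (∫ x, g x ∂m) ≤ ε / 2 := fun m _ => by
    have hf : Integrable (fun x => f x) m :=
      f.continuous.integrable_of_hasCompactSupport f.hasCompactSupport
    rw [dist_eq_norm, ← integral_sub hf
      (hg.continuous.integrable_of_hasCompactSupport hgc)]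
    refine (norm_integral_le_of_norm_le_const (C := ε / 2)
      (Eventually.of_forall fun x => ?_)).trans (by simp)
    rw [← dist_eq_norm, dist_comm]
    exact (hgf x).le
  have h1 := key μ
  have h2 := key ν
  rw [← h g hg hgc, dist_comm] at h2
  linarith [dist_triangle (∫ x, f x ∂μ) (∫ x, g x ∂μ) (∫ x, f x ∂ν)]

/-- Test functions with bounds on the first two derivatives. -/
structure IsTestFunction {d : ℕ} (ψ : RSpace d → ℝ) (L B : ℝ) : Prop where
  contDiff : ContDiff ℝ ∞ ψ
  hasCompactSupport : HasCompactSupport ψ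
  norm_fderiv_le : ∀ x, ‖fderiv ℝ ψ x‖ ≤ L
  norm_fderiv_sub_le : ∀ x y, ‖fderiv ℝ ψ x - fderiv ℝ ψ y‖ ≤ B * ‖x - y‖

/-- Smooth velocity fields with bounds on the first two derivatives. -/
structure IsSmoothField {d : ℕ} (a : RSpace d → RSpace d) (M Λ Λ₂ : ℝ) : Prop where
  contDiff : ContDiff ℝ ∞ a
  norm_le : ∀ x, ‖a x‖ ≤ M
  norm_fderiv_le : ∀ x, ‖fderiv ℝ a x‖ ≤ Λ
  norm_fderiv_sub_le : ∀ x y, ‖fderiv ℝ a x - fderiv ℝ a y‖ ≤ Λ₂ * ‖x - y‖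

/-! ### Test functions and weak solutions along one Euler step -/

section uniqueness

variable {d : ℕ}

theorem norm_sub_le_of_norm_fderiv_le {F : Type*} [NormedAddCommGroup F] [NormedSpace ℝ F]
    {f : RSpace d → F} (hf : ContDiff ℝ ∞ f) {C : ℝ} (hC : ∀ x, ‖fderiv ℝ f x‖ ≤ C)
    (x y : RSpace d) : ‖f x - f y‖ ≤ C * ‖x - y‖ :=
  convex_univ.norm_image_sub_le_of_norm_fderiv_le (𝕜 := ℝ)
    (fun z _ => hf.differentiable (by simp) z) (fun z _ => hC z) (mem_univ y) (mem_univ x)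

theorem norm_gradient_eq {φ : RSpace d → ℝ} (x : RSpace d) : ‖∇ φ x‖ = ‖fderiv ℝ φ x‖ := by
  rw [gradient, LinearIsometryEquiv.norm_map]

theorem inner_gradient_eq {φ : RSpace d → ℝ} (x v : RSpace d) :
    (inner ℝ (∇ φ x) v : ℝ) = fderiv ℝ φ x v := by
  rw [gradient, InnerProductSpace.toDual_symm_apply]

/-- The pullbacks of a test function must keep controlled first and second order bounds over many
steps, so the growth has to be of the form `1 + O(δ)`. Boundedness of `a` keeps the support compact.
-/
theorem IsTestFunction.comp_euler {ψ : RSpace d → ℝ} {L B : ℝ} (hψ : IsTestFunction ψ L B)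
    {a : RSpace d → RSpace d} {M Λ Λ₂ : ℝ} (ha : IsSmoothField a M Λ Λ₂) {δ : ℝ} (hδ : 0 ≤ δ)
    (hΛ : 0 ≤ Λ) :
    IsTestFunction (fun x => ψ (x + δ • a x)) ((1 + δ * Λ) * L)
      ((1 + δ * Λ) ^ 2 * B + δ * Λ₂ * L) := by
  have hL : 0 ≤ L := (norm_nonneg _).trans (hψ.norm_fderiv_le 0)
  have hΦ : ContDiff ℝ ∞ fun x => x + δ • a x := contDiff_id.add (ha.contDiff.const_smul δ)
  let A : RSpace d → RSpace d →L[ℝ] RSpace d := fun x =>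
    ContinuousLinearMap.id ℝ (RSpace d) + δ • fderiv ℝ a x
  have hΦd : ∀ x, HasFDerivAt (fun x => x + δ • a x) (A x) x := fun x =>
    (hasFDerivAt_id x).add ((ha.contDiff.differentiable (by simp) x).hasFDerivAt.const_smul δ)
  have hA : ∀ x, ‖A x‖ ≤ 1 + δ * Λ := fun x => by
    refine (norm_add_le _ _).trans (add_le_add ContinuousLinearMap.norm_id_le ?_)
    rw [norm_smul, Real.norm_of_nonneg hδ]
    exact mul_le_mul_of_nonneg_left (ha.norm_fderiv_le x) hδ
  have hd : ∀ x, fderiv ℝ (fun x => ψ (x + δ • a x)) x =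
      (fderiv ℝ ψ (x + δ • a x)).comp (A x) := fun x =>
    ((hψ.contDiff.differentiable (by simp) _).hasFDerivAt.comp x (hΦd x)).fderiv
  have hΦl : ∀ x y, ‖(x + δ • a x) - (y + δ • a y)‖ ≤ (1 + δ * Λ) * ‖x - y‖ :=
    norm_sub_le_of_norm_fderiv_le hΦ (fun x => by rw [(hΦd x).fderiv]; exact hA x)
  refine ⟨hψ.contDiff.comp hΦ, ?_, fun x => ?_, fun x y => ?_⟩
  · obtain ⟨R, hR⟩ := hψ.hasCompactSupport.isCompact.isBounded.subset_closedBall (0 : RSpace d)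
    refine HasCompactSupport.intro (isCompact_closedBall (0 : RSpace d) (R + δ * M)) fun x hx => ?_
    refine image_eq_zero_of_notMem_tsupport fun h => hx ?_
    have h1 := hR h
    rw [mem_closedBall_zero_iff] at h1 ⊢
    have h2 : ‖δ • a x‖ ≤ δ * M := by
      rw [norm_smul, Real.norm_of_nonneg hδ]
      exact mul_le_mul_of_nonneg_left (ha.norm_le x) hδ
    have h3 := norm_sub_le (x + δ • a x) (δ • a x)
    rw [add_sub_cancel_right] at h3
    linarith
  · rw [hd]
    refine (ContinuousLinearMap.opNorm_comp_le _ _).trans ?_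
    rw [mul_comm]
    exact mul_le_mul (hA x) (hψ.norm_fderiv_le _) (norm_nonneg _) (by positivity)
  · rw [hd, hd]
    have e : (fderiv ℝ ψ (x + δ • a x)).comp (A x) - (fderiv ℝ ψ (y + δ • a y)).comp (A y) =
        (fderiv ℝ ψ (x + δ • a x) - fderiv ℝ ψ (y + δ • a y)).comp (A x) +
        (fderiv ℝ ψ (y + δ • a y)).comp (A x - A y) := by
      ext v; simp
    rw [e]
    refine (norm_add_le _ _).trans ?_
    have hB : ‖fderiv ℝ ψ (x + δ • a x) - fderiv ℝ ψ (y + δ • a y)‖ ≤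
        B * ((1 + δ * Λ) * ‖x - y‖) := by
      -- The sign of `B` is not assumed; two distinct points force it to be nonnegative.
      rcases eq_or_ne x y with rfl | hxy
      · simp
      have hB0 : 0 ≤ B := by
        have := (norm_nonneg _).trans (hψ.norm_fderiv_sub_le x y)
        exact nonneg_of_mul_nonneg_left this (norm_pos_iff.2 (sub_ne_zero.2 hxy))
      exact (hψ.norm_fderiv_sub_le _ _).trans (mul_le_mul_of_nonneg_left (hΦl x y) hB0)
    have hAs : ‖A x - A y‖ ≤ δ * (Λ₂ * ‖x - y‖) := by
      have : A x - A y = δ • (fderiv ℝ a x - fderiv ℝ a y) := by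
        simp only [A, smul_sub]; abel
      rw [this, norm_smul, Real.norm_of_nonneg hδ]
      exact mul_le_mul_of_nonneg_left (ha.norm_fderiv_sub_le x y) hδ
    have h1 := (ContinuousLinearMap.opNorm_comp_le
      (fderiv ℝ ψ (x + δ • a x) - fderiv ℝ ψ (y + δ • a y)) (A x)).trans
      (mul_le_mul hB (hA x) (norm_nonneg _) ((norm_nonneg _).trans hB))
    have h2 := (ContinuousLinearMap.opNorm_comp_le (fderiv ℝ ψ (y + δ • a y)) (A x - A y)).trans
      (mul_le_mul (hψ.norm_fderiv_le _) hAs (norm_nonneg _) hL)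
    refine (add_le_add h1 h2).trans_eq ?_
    ring

variable {T : ℝ} {W : RSpace d → ℝ} {Λ M : ℝ≥0} {μ : ℝ → Measure (RSpace d)}

theorem IsAggregationSolution.integral_sub_eq (hμ : IsAggregationSolution T W μ)
    (hG : LipschitzWith Λ (∇ W)) (hM : ∀ z, ‖∇ W z‖ ≤ M) {φ : RSpace d → ℝ}
    (hφ : ContDiff ℝ ∞ φ) (hc : HasCompactSupport φ) {s t : ℝ} (hs : s ∈ Icc 0 T)
    (ht : t ∈ Icc 0 T) :
    ∫ x, φ x ∂(μ t) - ∫ x, φ x ∂(μ s) =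
      -∫ r in s..t, ∫ x, (fderiv ℝ φ x (fieldConv (∇ W) (μ r) x) : ℝ) ∂(μ r) := by
  have h1 := hμ.2 φ hφ hc t ht
  have h2 := hμ.2 φ hφ hc s hs
  have hcont := hμ.1.continuousOn_integral_inner_gradient hG hM hφ hc
  have hi : ∀ r ∈ Icc 0 T, IntervalIntegrable (fun t =>
      ∫ x, (inner ℝ (∇ φ x) (fieldConv (∇ W) (μ t) x) : ℝ) ∂(μ t)) volume 0 r := fun r hr =>
    (hcont.mono (Icc_subset_Icc_right hr.2)).intervalIntegrable_of_Icc hr.1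
  have h3 := intervalIntegral.integral_interval_sub_left (hi t ht) (hi s hs)
  simp_rw [← inner_gradient_eq]
  rw [← h3]
  change _ = - ∫ s in (0 : ℝ)..t, ∫ x, inner ℝ (∇ φ x) (fieldConv (∇ W) (μ s) x) ∂(μ s) at h1
  change _ = - ∫ s in (0 : ℝ)..s, ∫ x, inner ℝ (∇ φ x) (fieldConv (∇ W) (μ s) x) ∂(μ s) at h2
  linarith

/-- The velocity is bounded by `M`, so a weak solution is Lipschitz in time when tested against
Lipschitz functions. -/
theorem IsAggregationSolution.abs_integral_sub_le (hμ : IsAggregationSolution T W μ)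
    (hG : LipschitzWith Λ (∇ W)) (hM : ∀ z, ‖∇ W z‖ ≤ M) {φ : RSpace d → ℝ}
    (hφ : ContDiff ℝ ∞ φ) (hc : HasCompactSupport φ) {L : ℝ} (hL : ∀ x, ‖fderiv ℝ φ x‖ ≤ L)
    {s t : ℝ} (hs : s ∈ Icc 0 T) (ht : t ∈ Icc 0 T) (hst : s ≤ t) :
    |∫ x, φ x ∂(μ t) - ∫ x, φ x ∂(μ s)| ≤ L * M * (t - s) := by
  have hL0 : 0 ≤ L := (norm_nonneg _).trans (hL 0)
  rw [hμ.integral_sub_eq hG hM hφ hc hs ht, abs_neg, ← Real.norm_eq_abs]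
  refine (intervalIntegral.norm_integral_le_of_norm_le_const (C := L * M) fun r hr => ?_).trans_eq
    (by rw [abs_of_nonneg (sub_nonneg.2 hst)])
  rw [uIoc_of_le hst] at hr
  have := (hμ.1 r ⟨hs.1.trans hr.1.le, hr.2.trans ht.2⟩).1.1
  refine (norm_integral_le_of_norm_le_const (C := L * M) (Eventually.of_forall fun x => ?_)).trans
    (by simp)
  exact (ContinuousLinearMap.le_opNorm _ _).trans
    (mul_le_mul (hL x) (norm_fieldConv_le hM x) (norm_nonneg _) hL0)

/-- One explicit Euler step for a weak solution, tested against a smooth function. -/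
theorem IsAggregationSolution.abs_integral_sub_euler_le (hμ : IsAggregationSolution T W μ)
    (hG : LipschitzWith Λ (∇ W)) {M₁ : ℝ≥0} (hM : ∀ z, ‖∇ W z‖ ≤ M₁) {ψ : RSpace d → ℝ} {L B : ℝ}
    (hψ : IsTestFunction ψ L B) (hB : 0 ≤ B) {a : RSpace d → RSpace d} {Λ₁ Λ₂ : ℝ}
    (ha : IsSmoothField a M₁ Λ₁ Λ₂) {s t : ℝ} (hs : s ∈ Icc 0 T) (ht : t ∈ Icc 0 T)
    (hst : s ≤ t) {κ : ℝ → ℝ} (hκ : Continuous κ)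
    (hκa : ∀ r ∈ Icc s t, ∀ x, ‖-fieldConv (∇ W) (μ r) x - a x‖ ≤ κ r) :
    |∫ x, ψ x ∂(μ t) - ∫ x, ψ (x + (t - s) • a x) ∂(μ s)| ≤
      L * (∫ r in s..t, κ r) + (2 * B * M₁ + L * Λ₁) * M₁ * (t - s) ^ 2 := by
  have hL0 : 0 ≤ L := (norm_nonneg _).trans (hψ.norm_fderiv_le 0)
  set δ := t - s with hδ
  have hδ0 : 0 ≤ δ := sub_nonneg.2 hst
  have hps := (hμ.1 s hs).1.1
  -- The derivative of `ψ` along the frozen velocity. Both `∫ ψ ∂(μ t)` and the Euler integral agree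
  -- with `∫ ψ ∂(μ s) + δ * ∫ J ∂(μ s)` up to the stated errors.
  let J : RSpace d → ℝ := fun x => fderiv ℝ ψ x (a x)
  have hJ : ContDiff ℝ ∞ J :=
    (hψ.contDiff.fderiv_right (m := ∞) (by simp)).clm_apply ha.contDiff
  have hJc : HasCompactSupport J := by
    refine (hψ.hasCompactSupport.fderiv ℝ).mono fun x hx => ?_
    simp only [Function.mem_support, J] at hx ⊢
    intro h; exact hx (by simp [h])
  have hJl : ∀ x, ‖fderiv ℝ J x‖ ≤ B * M₁ + L * Λ₁ := by
    have hl : ∀ x y, ‖J x - J y‖ ≤ (B * M₁ + L * Λ₁) * ‖x - y‖ := fun x y => by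
      have e : J x - J y = (fderiv ℝ ψ x - fderiv ℝ ψ y) (a x) + fderiv ℝ ψ y (a x - a y) := by
        simp [J]
      rw [e]
      refine (norm_add_le _ _).trans ?_
      have h1 := ((fderiv ℝ ψ x - fderiv ℝ ψ y).le_opNorm (a x)).trans
        (mul_le_mul (hψ.norm_fderiv_sub_le x y) (ha.norm_le x) (norm_nonneg _) (by positivity))
      have h2 := ((fderiv ℝ ψ y).le_opNorm (a x - a y)).trans
        (mul_le_mul (hψ.norm_fderiv_le y)
          (norm_sub_le_of_norm_fderiv_le ha.contDiff ha.norm_fderiv_le x y) (norm_nonneg _) hL0)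
      refine (add_le_add h1 h2).trans_eq ?_
      ring
    have hΛ1 : 0 ≤ Λ₁ := (norm_nonneg _).trans (ha.norm_fderiv_le 0)
    have hC : 0 ≤ B * M₁ + L * Λ₁ := by positivity
    intro x
    exact norm_fderiv_le_of_lipschitz ℝ (C := ⟨_, hC⟩) (LipschitzWith.of_dist_le_mul fun x y => by
      rw [dist_eq_norm, dist_eq_norm]; exact hl x y)
  have iJ : ∀ (m : Measure (RSpace d)) [IsProbabilityMeasure m], Integrable J m := fun m _ =>
    hJ.continuous.integrable_of_hasCompactSupport hJc
  -- the Taylor remainder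
  have hψ' := hψ.contDiff.continuous
  have iψ : Integrable ψ (μ s) := hψ'.integrable_of_hasCompactSupport hψ.hasCompactSupport
  have iψΦ : Integrable (fun x => ψ (x + δ • a x)) (μ s) := by
    obtain ⟨C, hC⟩ := hψ'.bounded_above_of_compact_support hψ.hasCompactSupport
    exact Integrable.of_bound (hψ'.comp (continuous_id.add
      (ha.contDiff.continuous.const_smul δ))).aestronglyMeasurable C (Eventually.of_forall fun _ => hC _)
  have hR : |∫ x, ψ (x + δ • a x) ∂(μ s) - ∫ x, ψ x ∂(μ s) - δ * ∫ x, J x ∂(μ s)| ≤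
      B * M₁ * M₁ * δ ^ 2 := by
    have i3 : Integrable (fun x => ψ (x + δ • a x) - ψ x) (μ s) := iψΦ.sub iψ
    rw [← integral_const_mul, ← integral_sub iψΦ iψ, ← integral_sub i3 ((iJ _).const_mul δ),
      ← Real.norm_eq_abs]
    refine (norm_integral_le_of_norm_le_const (C := B * M₁ * M₁ * δ ^ 2)
      (Eventually.of_forall fun x => ?_)).trans (by simp)
    have hv : ‖δ • a x‖ ≤ δ * M₁ := by
      rw [norm_smul, Real.norm_of_nonneg hδ0]
      exact mul_le_mul_of_nonneg_left (ha.norm_le x) hδ0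
    have h1 : ‖ψ (x + δ • a x) - ψ x - fderiv ℝ ψ x (x + δ • a x - x)‖ ≤
        B * (δ * M₁) * ‖x + δ • a x - x‖ := by
      refine Convex.norm_image_sub_le_of_norm_fderiv_le' (𝕜 := ℝ)
        (s := Metric.closedBall x (δ * M₁)) (fun z _ => hψ.contDiff.differentiable (by simp) z)
        (fun z hz => ?_) (convex_closedBall x _) (Metric.mem_closedBall_self (by positivity))
        (by simpa using hv)
      refine (hψ.norm_fderiv_sub_le z x).trans (mul_le_mul_of_nonneg_left ?_ hB)
      simpa [dist_eq_norm] using hz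
    rw [add_sub_cancel_left, map_smul, smul_eq_mul] at h1
    refine h1.trans ((mul_le_mul_of_nonneg_left hv (by positivity)).trans_eq ?_)
    ring
  -- the weak formulation
  have hE : |∫ x, ψ x ∂(μ t) - ∫ x, ψ x ∂(μ s) - δ * ∫ x, J x ∂(μ s)| ≤
      L * (∫ r in s..t, κ r) + (B * M₁ + L * Λ₁) * M₁ * δ ^ 2 := by
    have hsub : uIcc s t ⊆ Icc 0 T := by
      rw [uIcc_of_le hst]; exact Icc_subset_Icc hs.1 ht.2
    have hi : IntervalIntegrable (fun r =>
        ∫ x, (fderiv ℝ ψ x (fieldConv (∇ W) (μ r) x) : ℝ) ∂(μ r)) volume s t := by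
      have := (hμ.1.continuousOn_integral_inner_gradient hG hM hψ.contDiff
        hψ.hasCompactSupport).mono hsub
      simp_rw [inner_gradient_eq] at this
      exact this.intervalIntegrable
    rw [hμ.integral_sub_eq hG hM hψ.contDiff hψ.hasCompactSupport hs ht]
    have e : -(∫ r in s..t, ∫ x, (fderiv ℝ ψ x (fieldConv (∇ W) (μ r) x) : ℝ) ∂(μ r)) -
        δ * ∫ x, J x ∂(μ s) =
        -∫ r in s..t, ((∫ x, (fderiv ℝ ψ x (fieldConv (∇ W) (μ r) x) : ℝ) ∂(μ r)) +
          ∫ x, J x ∂(μ s)) := by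
      rw [intervalIntegral.integral_add hi intervalIntegrable_const,
        intervalIntegral.integral_const, smul_eq_mul]
      ring
    have e2 : L * (∫ r in s..t, κ r) + (B * M₁ + L * Λ₁) * M₁ * δ ^ 2 =
        ∫ r in s..t, (L * κ r + (B * M₁ + L * Λ₁) * M₁ * δ) := by
      rw [intervalIntegral.integral_add ((hκ.const_mul L).intervalIntegrable _ _)
        intervalIntegrable_const, intervalIntegral.integral_const,
        intervalIntegral.integral_const_mul, smul_eq_mul]
      ring
    rw [e, abs_neg, e2, ← Real.norm_eq_abs]
    refine intervalIntegral.norm_integral_le_of_norm_le hst (Eventually.of_forall fun r hr => ?_)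
      (((hκ.const_mul L).add continuous_const).intervalIntegrable _ _)
    have hrT : r ∈ Icc 0 T := ⟨hs.1.trans hr.1.le, hr.2.trans ht.2⟩
    have hpr := (hμ.1 r hrT).1.1
    -- Replacing `μ r` by `μ s` costs the Lipschitz constant of `J` times `M₁ * (r - s)`. Added to
    -- the Taylor remainder `B * M₁ * M₁ * δ ^ 2`, this gives the coefficient `2 * B * M₁ + L * Λ₁`.
    have h1 := hμ.abs_integral_sub_le hG hM hJ hJc hJl hs hrT hr.1.le
    have hcF : Continuous fun x => (fderiv ℝ ψ x (fieldConv (∇ W) (μ r) x) : ℝ) :=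
      (hψ.contDiff.continuous_fderiv (by simp)).clm_apply (lipschitz_fieldConv hG hM).continuous
    have iF : Integrable (fun x => (fderiv ℝ ψ x (fieldConv (∇ W) (μ r) x) : ℝ)) (μ r) := by
      refine Integrable.of_bound hcF.aestronglyMeasurable (L * M₁) (Eventually.of_forall fun x => ?_)
      exact (ContinuousLinearMap.le_opNorm _ _).trans
        (mul_le_mul (hψ.norm_fderiv_le x) (norm_fieldConv_le hM x) (norm_nonneg _) hL0)
    have h2 : |(∫ x, (fderiv ℝ ψ x (fieldConv (∇ W) (μ r) x) : ℝ) ∂(μ r)) + ∫ x, J x ∂(μ r)| ≤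
        L * κ r := by
      rw [← integral_add iF (iJ _), ← Real.norm_eq_abs]
      refine (norm_integral_le_of_norm_le_const (C := L * κ r)
        (Eventually.of_forall fun x => ?_)).trans (by simp)
      have h3 : (fderiv ℝ ψ x (fieldConv (∇ W) (μ r) x) : ℝ) + J x =
          -fderiv ℝ ψ x (-fieldConv (∇ W) (μ r) x - a x) := by
        simp [J]; ring
      rw [h3, norm_neg]
      exact (ContinuousLinearMap.le_opNorm _ _).trans
        (mul_le_mul (hψ.norm_fderiv_le x) (hκa r ⟨hr.1.le, hr.2⟩ x) (norm_nonneg _) hL0)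
    have h4 : r - s ≤ δ := by rw [hδ]; linarith [hr.2]
    have h5 : (B * M₁ + L * Λ₁) * M₁ * (r - s) ≤ (B * M₁ + L * Λ₁) * M₁ * δ := by
      refine mul_le_mul_of_nonneg_left h4 (mul_nonneg ?_ M₁.2)
      exact (norm_nonneg _).trans (hJl 0)
    rw [Real.norm_eq_abs]
    rw [abs_le] at *
    constructor <;> linarith [h1.1, h1.2, h2.1, h2.2]
  rw [abs_le] at *
  constructor <;> nlinarith [hR.1, hR.2, hE.1, hE.2]

end uniqueness

/-! ### Smooth velocity fields obtained by convolution -/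

section fieldConv_smooth

variable {d : ℕ} {g : RSpace d → RSpace d}

/-- The convolution of a smooth compactly supported field with a probability measure is a smooth
field, with bounds independent of the measure. -/
theorem exists_isSmoothField_fieldConv (hg : ContDiff ℝ ∞ g) (hc : HasCompactSupport g) {Λ : ℝ≥0}
    (hl : LipschitzWith Λ g) {M : ℝ} (hM : ∀ x, ‖g x‖ ≤ M) :
    ∃ Λ₂ : ℝ, 0 ≤ Λ₂ ∧ ∀ (μ : Measure (RSpace d)) [IsProbabilityMeasure μ],
      IsSmoothField (fun x => -fieldConv g μ x) M Λ Λ₂ := by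
  have hg' : ContDiff ℝ ∞ (fderiv ℝ g) := hg.fderiv_right (m := ∞) (by simp)
  obtain ⟨Λ₂, h2⟩ := hg'.lipschitzWith_of_hasCompactSupport (hc.fderiv ℝ) (by simp)
  have hb : ∀ x, ‖fderiv ℝ g x‖ ≤ Λ := fun x => norm_fderiv_le_of_lipschitz ℝ hl
  refine ⟨Λ₂, Λ₂.2, fun μ _ => ?_⟩
  have e : fieldConv g μ = MeasureTheory.convolution (fun _ => (1 : ℝ)) g
      (ContinuousLinearMap.lsmul ℝ ℝ) μ := by
    funext x
    simp [fieldConv, MeasureTheory.convolution]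
  have hli : LocallyIntegrable (fun _ : RSpace d => (1 : ℝ)) μ := (integrable_const _).locallyIntegrable
  -- Derivatives fall on `g`, so all bounds are those of `g` and do not depend on the measure.
  have hd : ∀ x, HasFDerivAt (fieldConv g μ) (fieldConv (fderiv ℝ g) μ x) x := fun x => by
    have hcont : Continuous (fderiv ℝ g) := hg'.continuous
    refine hasFDerivAt_integral_of_dominated_of_fderiv_le (F := fun x y => g (x - y))
      (F' := fun x y => fderiv ℝ g (x - y)) (bound := fun _ => (Λ : ℝ)) univ_mem
      (Eventually.of_forall fun z => ?_) (integrable_fieldConv hl hM x) ?_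
      (Eventually.of_forall fun y z _ => hb _) (integrable_const _)
      (Eventually.of_forall fun y z _ => ?_)
    · exact (hl.const_sub_left z).continuous.aestronglyMeasurable
    · exact (hcont.comp (continuous_const.sub continuous_id)).aestronglyMeasurable
    · exact ((hg.differentiable (by simp) (z - y)).hasFDerivAt).comp z
        ((hasFDerivAt_id z).sub_const y)
  have hcd : ContDiff ℝ ∞ (fieldConv g μ) := by
    rw [e]
    exact hc.contDiff_convolution_right _ hli hg
  have hdn : ∀ x, fderiv ℝ (fun x => -fieldConv g μ x) x = -fieldConv (fderiv ℝ g) μ x := fun x =>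
    (hd x).neg.fderiv
  refine ⟨hcd.neg, fun x => ?_, fun x => ?_, fun x y => ?_⟩
  · rw [norm_neg]; exact norm_fieldConv_le hM x
  · rw [hdn, norm_neg]; exact norm_fieldConv_le hb x
  · rw [hdn, hdn, neg_sub_neg, norm_sub_rev]
    have := (lipschitz_fieldConv (μ := μ) h2 hb).dist_le_mul x y
    rwa [dist_eq_norm, dist_eq_norm] at this

/-- Smooth fields convolved with two measures are close when the measures are close in duality
with Lipschitz test functions. -/
theorem norm_fieldConv_sub_le_of_duality (hg : ContDiff ℝ ∞ g) (hc : HasCompactSupport g) {Λ : ℝ≥0}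
    (hl : LipschitzWith Λ g) {μ ν : Measure (RSpace d)} [IsProbabilityMeasure μ]
    [IsProbabilityMeasure ν] {q : ℝ}
    (hq : ∀ φ : RSpace d → ℝ, ∀ L : ℝ, ContDiff ℝ ∞ φ → HasCompactSupport φ →
      (∀ x, ‖fderiv ℝ φ x‖ ≤ L) → |∫ x, φ x ∂μ - ∫ x, φ x ∂ν| ≤ L * q) (x : RSpace d) :
    ‖fieldConv g μ x - fieldConv g ν x‖ ≤ Λ * q := by
  set e := fieldConv g μ x - fieldConv g ν x with he
  have hgx : ContDiff ℝ ∞ fun y => g (x - y) := hg.comp (contDiff_const.sub contDiff_id)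
  have hcx : HasCompactSupport fun y => g (x - y) := hc.comp_homeomorph (Homeomorph.subLeft x)
  have hi : ∀ (m : Measure (RSpace d)) [IsProbabilityMeasure m], Integrable (fun y => g (x - y)) m :=
    fun m _ => hgx.continuous.integrable_of_hasCompactSupport hcx
  -- Testing in the direction of the difference `e` itself yields `‖e‖ ^ 2 ≤ ‖e‖ * Λ * q`.
  let φ : RSpace d → ℝ := fun y => innerSL ℝ e (g (x - y))
  have hφ : ContDiff ℝ ∞ φ := (innerSL ℝ e).contDiff.comp hgx
  have hφc : HasCompactSupport φ := hcx.comp_left (g := innerSL ℝ e) (map_zero _)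
  have hφl : LipschitzWith (‖e‖₊ * Λ) φ := by
    refine LipschitzWith.of_dist_le_mul fun y z => ?_
    have h1 := (hl.const_sub_left x).dist_le_mul y z
    rw [dist_eq_norm] at h1 ⊢
    have h2 : φ y - φ z = inner ℝ e (g (x - y) - g (x - z)) := by
      simp [φ, inner_sub_right]
    rw [h2]
    refine (norm_inner_le_norm _ _).trans ?_
    rw [NNReal.coe_mul, mul_assoc, coe_nnnorm]
    gcongr
  have h1 := hq φ (‖e‖ * Λ) hφ hφc (fun y => norm_fderiv_le_of_lipschitz ℝ hφl)
  have h2 : ∀ (m : Measure (RSpace d)) [IsProbabilityMeasure m],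
      ∫ y, φ y ∂m = inner ℝ e (fieldConv g m x) := fun m _ => by
    simp only [φ]
    rw [ContinuousLinearMap.integral_comp_comm _ (hi m)]
    rfl
  rw [h2 μ, h2 ν, ← inner_sub_right, ← he, real_inner_self_eq_norm_sq, abs_of_nonneg (sq_nonneg _)]
    at h1
  rcases eq_or_lt_of_le (norm_nonneg e) with h0 | h0
  · rw [← h0]
    -- When `e = 0` only `0 ≤ q` is needed; the zero test function with constant `1` gives it.
    have := hq (fun _ => 0) 1 contDiff_const (HasCompactSupport.zero) (by simp)
    simp only [integral_zero, sub_self, abs_zero, one_mul] at this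
    positivity
  · nlinarith

end fieldConv_smooth

/-! ### The duality argument for two weak solutions -/

section uniqueness

variable {d : ℕ} {T : ℝ} {W : RSpace d → ℝ} {Λ M : ℝ≥0} {μ ν : ℝ → Measure (RSpace d)}

/-- One step of the duality argument, for two weak solutions and a common Euler map. -/
theorem abs_integral_sub_le_of_euler_step
    (hμ : IsAggregationSolution T W μ) (hν : IsAggregationSolution T W ν)
    (hG : LipschitzWith Λ (∇ W)) (hM : ∀ z, ‖∇ W z‖ ≤ M)
    {g : RSpace d → RSpace d} (hg : ContDiff ℝ ∞ g) (hgc : HasCompactSupport g)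
    (hgl : LipschitzWith Λ g) {ε : ℝ} (hgW : ∀ z, ‖g z - ∇ W z‖ ≤ ε) (hgM : ∀ z, ‖g z‖ ≤ M)
    {Λ₂ : ℝ} (hΛ₂ : ∀ (m : Measure (RSpace d)) [IsProbabilityMeasure m],
      IsSmoothField (fun x => -fieldConv g m x) M Λ Λ₂) {q : ℝ → ℝ} (hqc : Continuous q)
    (hq : ∀ r ∈ Icc 0 T, ∀ φ : RSpace d → ℝ, ∀ L : ℝ, ContDiff ℝ ∞ φ → HasCompactSupport φ →
      (∀ x, ‖fderiv ℝ φ x‖ ≤ L) → |∫ x, φ x ∂(μ r) - ∫ x, φ x ∂(ν r)| ≤ L * q r)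
    {ψ : RSpace d → ℝ} {L B : ℝ} (hψ : IsTestFunction ψ L B) (hB : 0 ≤ B)
    {s t : ℝ} (hs : s ∈ Icc 0 T) (ht : t ∈ Icc 0 T) (hst : s ≤ t) {R : ℝ}
    (hR : |∫ x, ψ (x + (t - s) • -fieldConv g (μ s) x) ∂(μ s) -
      ∫ x, ψ (x + (t - s) • -fieldConv g (μ s) x) ∂(ν s)| ≤ R) :
    |∫ x, ψ x ∂(μ t) - ∫ x, ψ x ∂(ν t)| ≤ R + L * Λ * (∫ r in s..t, q r) +
      2 * L * ε * (t - s) + 4 * (B * M + L * Λ) * M * (t - s) ^ 2 := by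
  have hps := (hμ.1 s hs).1.1
  have hL0 : 0 ≤ L := (norm_nonneg _).trans (hψ.norm_fderiv_le 0)
  have hfield : ∀ r ∈ Icc s t, ∀ x,
      ‖fieldConv g (μ r) x - fieldConv g (μ s) x‖ ≤ Λ * (M * (t - s)) := fun r hr x => by
    have hrT : r ∈ Icc 0 T := ⟨hs.1.trans hr.1, hr.2.trans ht.2⟩
    have hpr := (hμ.1 r hrT).1.1
    refine norm_fieldConv_sub_le_of_duality hg hgc hgl (fun φ L hφ hφc hφL => ?_) x
    have hL0 : 0 ≤ L := (norm_nonneg _).trans (hφL 0)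
    refine (hμ.abs_integral_sub_le hG hM hφ hφc hφL hs hrT hr.1).trans ?_
    rw [mul_assoc]
    gcongr
    exact hr.2
  have hgW' : ∀ z, ‖∇ W z - g z‖ ≤ ε := fun z => by rw [norm_sub_rev]; exact hgW z
  have s1 := hμ.abs_integral_sub_euler_le hG hM hψ hB (hΛ₂ (μ s)) hs ht hst
    (κ := fun _ => ε + Λ * (M * (t - s))) continuous_const (fun r hr x => by
      have hpr := (hμ.1 r ⟨hs.1.trans hr.1, hr.2.trans ht.2⟩).1.1
      have h1 := norm_fieldConv_sub_le (μ := μ r) hG hM hgl hgM hgW' x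
      have h2 := hfield r hr x
      have e : -fieldConv (∇ W) (μ r) x - -fieldConv g (μ s) x =
        -((fieldConv (∇ W) (μ r) x - fieldConv g (μ r) x) +
          (fieldConv g (μ r) x - fieldConv g (μ s) x)) := by abel
      rw [e, norm_neg]
      exact (norm_add_le _ _).trans (add_le_add h1 h2))
  -- `ν` is advanced with the Euler map built from `μ`, so the same pulled-back function tests both
  -- solutions; the mismatch of the velocities adds `Λ * q r`.
  have s2 := hν.abs_integral_sub_euler_le hG hM hψ hB (hΛ₂ (μ s)) hs ht hst
    (κ := fun r => ε + Λ * (M * (t - s)) + Λ * q r) (by fun_prop) (fun r hr x => by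
      have hrT : r ∈ Icc 0 T := ⟨hs.1.trans hr.1, hr.2.trans ht.2⟩
      have hpr := (hν.1 r hrT).1.1
      have hpr' := (hμ.1 r hrT).1.1
      have h1 := norm_fieldConv_sub_le (μ := ν r) hG hM hgl hgM hgW' x
      have h2 := hfield r hr x
      have h3 := norm_fieldConv_sub_le_of_duality hg hgc hgl (hq r hrT) x
      have e : -fieldConv (∇ W) (ν r) x - -fieldConv g (μ s) x =
        (fieldConv g (μ r) x - fieldConv g (ν r) x) -
        ((fieldConv (∇ W) (ν r) x - fieldConv g (ν r) x) +
          (fieldConv g (μ r) x - fieldConv g (μ s) x)) := by abel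
      rw [e]
      have h4 := norm_sub_le (fieldConv g (μ r) x - fieldConv g (ν r) x)
        ((fieldConv (∇ W) (ν r) x - fieldConv g (ν r) x) +
          (fieldConv g (μ r) x - fieldConv g (μ s) x))
      have h5 := norm_add_le (fieldConv (∇ W) (ν r) x - fieldConv g (ν r) x)
          (fieldConv g (μ r) x - fieldConv g (μ s) x)
      linarith)
  rw [intervalIntegral.integral_const, smul_eq_mul] at s1
  rw [intervalIntegral.integral_add intervalIntegrable_const
    ((hqc.const_mul (Λ : ℝ)).intervalIntegrable _ _), intervalIntegral.integral_const,
    intervalIntegral.integral_const_mul, smul_eq_mul] at s2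
  -- The two Euler remainders contribute `2 * (2 * B * M + L * Λ) * M` and the two freezing errors
  -- `2 * L * Λ * M`, in total `4 * (B * M + L * Λ) * M`.
  rw [abs_le] at *
  constructor <;> nlinarith [s1.1, s1.2, s2.1, s2.2, hR.1, hR.2]

end uniqueness

section uniqueness

variable {d : ℕ} {T : ℝ} {W : RSpace d → ℝ} {Λ M : ℝ≥0} {μ ν : ℝ → Measure (RSpace d)}

theorem IsTestFunction.mono {ψ : RSpace d → ℝ} {L B L' B' : ℝ} (h : IsTestFunction ψ L B)
    (hL : L ≤ L') (hB : B ≤ B') : IsTestFunction ψ L' B' :=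
  ⟨h.contDiff, h.hasCompactSupport, fun x => (h.norm_fderiv_le x).trans hL,
    fun x y => (h.norm_fderiv_sub_le x y).trans
      (mul_le_mul_of_nonneg_right hB (norm_nonneg _))⟩

/-- The duality argument along `n` Euler steps. -/
theorem abs_integral_sub_le_of_euler_iterate
    (hμ : IsAggregationSolution T W μ) (hν : IsAggregationSolution T W ν) (h0 : μ 0 = ν 0)
    (hG : LipschitzWith Λ (∇ W)) (hM : ∀ z, ‖∇ W z‖ ≤ M)
    {g : RSpace d → RSpace d} (hg : ContDiff ℝ ∞ g) (hgc : HasCompactSupport g)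
    (hgl : LipschitzWith Λ g) {ε : ℝ} (hε : 0 ≤ ε) (hgW : ∀ z, ‖g z - ∇ W z‖ ≤ ε)
    (hgM : ∀ z, ‖g z‖ ≤ M) {Λ₂ : ℝ} (hΛ₂0 : 0 ≤ Λ₂)
    (hΛ₂ : ∀ (m : Measure (RSpace d)) [IsProbabilityMeasure m],
      IsSmoothField (fun x => -fieldConv g m x) M Λ Λ₂) {q : ℝ → ℝ} (hqc : Continuous q)
    (hq0 : ∀ r, 0 ≤ q r)
    (hq : ∀ r ∈ Icc 0 T, ∀ φ : RSpace d → ℝ, ∀ L : ℝ, ContDiff ℝ ∞ φ → HasCompactSupport φ →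
      (∀ x, ‖fderiv ℝ φ x‖ ≤ L) → |∫ x, φ x ∂(μ r) - ∫ x, φ x ∂(ν r)| ≤ L * q r)
    {L B : ℝ} (hL : 0 ≤ L) (hB : 0 ≤ B) {t : ℝ} (ht : t ∈ Icc 0 T) {n : ℕ} (hn : n ≠ 0)
    {L₁ B₁ C : ℝ} (hL₁ : L₁ = L * Real.exp (Λ * T))
    (hB₁ : B₁ = Real.exp (2 * Λ * T) * (B + T * Λ₂ * L)) (hC : C = 4 * (B₁ * M + L₁ * Λ) * M)
    (k : ℕ) (hk : k ≤ n) (ψ : RSpace d → ℝ)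
    (hψ : IsTestFunction ψ (L * Real.exp (Λ * (t - k * (t / n))))
      (Real.exp (2 * Λ * (t - k * (t / n))) * (B + (t - k * (t / n)) * Λ₂ * L))) :
    |∫ x, ψ x ∂(μ (k * (t / n))) - ∫ x, ψ x ∂(ν (k * (t / n)))| ≤
      L₁ * Λ * (∫ r in (0 : ℝ)..(k * (t / n)), q r) +
        (2 * L₁ * ε + C * (t / n)) * (k * (t / n)) := by
  have hn0 : (0 : ℝ) < n := by exact_mod_cast Nat.pos_of_ne_zero hn
  set δ := t / n with hδ
  have hδ0 : 0 ≤ δ := div_nonneg ht.1 hn0.le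
  have hst : ∀ j : ℕ, j ≤ n → j * δ ≤ t := fun j hj => by
    have : (j : ℝ) ≤ n := by exact_mod_cast hj
    calc j * δ ≤ n * δ := by gcongr
      _ = t := by rw [hδ]; field_simp
  have hs0 : ∀ j : ℕ, 0 ≤ j * δ := fun j => by positivity
  have hsT : ∀ j : ℕ, j ≤ n → j * δ ∈ Icc 0 T := fun j hj => ⟨hs0 j, (hst j hj).trans ht.2⟩
  -- Each step replaces `ψ` by its pullback through an Euler map. The bounds allowed for `ψ` grow
  -- backwards from time `t`, so the pullback is admissible at the earlier time.
  induction k generalizing ψ with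
  | zero => simp [h0]
  | succ k ih =>
    have hk' : k ≤ n := Nat.le_of_succ_le hk
    have hstep : ((k + 1 : ℕ) : ℝ) * δ = k * δ + δ := by push_cast; ring
    set s := (k : ℝ) * δ with hs
    set s' := ((k + 1 : ℕ) : ℝ) * δ with hs'
    have hss' : s' - s = δ := by rw [hstep]; ring
    have hle : s ≤ s' := by linarith
    have hs't : s' ≤ t := hst _ hk
    have hTs' : t - s' ≤ T := by linarith [ht.2, hs0 (k + 1)]
    set ℓ := L * Real.exp (Λ * (t - s')) with hℓ
    set β := Real.exp (2 * Λ * (t - s')) * (B + (t - s') * Λ₂ * L) with hβ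
    have hu : 0 ≤ t - s' := sub_nonneg.2 hs't
    have hβ0 : 0 ≤ β := by positivity
    have hℓ0 : 0 ≤ ℓ := by positivity
    have hℓ₁ : ℓ ≤ L₁ := by rw [hℓ, hL₁]; gcongr
    have hβ₁ : β ≤ B₁ := by rw [hβ, hB₁]; gcongr
    have hps := (hμ.1 s (hsT k hk')).1.1
    have hexp : 1 + δ * Λ ≤ Real.exp (Λ * δ) := by
      have := Real.add_one_le_exp (Λ * δ : ℝ)
      linarith
    have hts : t - s = (t - s') + δ := by linarith
    have htest := (hψ.comp_euler (hΛ₂ (μ s)) hδ0 Λ.2).mono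
      (L' := L * Real.exp (Λ * (t - s)))
      (B' := Real.exp (2 * Λ * (t - s)) * (B + (t - s) * Λ₂ * L))
      (by
        have e : Real.exp (Λ * (t - s)) = Real.exp (Λ * δ) * Real.exp (Λ * (t - s')) := by
          rw [← Real.exp_add]; congr 1; rw [hts]; ring
        rw [e]
        calc (1 + δ * Λ) * ℓ ≤ Real.exp (Λ * δ) * ℓ := by gcongr
          _ = _ := by rw [hℓ]; ring)
      (by
        have e : Real.exp (2 * Λ * (t - s)) =
            Real.exp (Λ * δ) ^ 2 * Real.exp (2 * Λ * (t - s')) := by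
          rw [← Real.exp_nat_mul, ← Real.exp_add]; congr 1; rw [hts]; push_cast; ring
        have h1 : (1 + δ * Λ) ^ 2 * β ≤ Real.exp (Λ * δ) ^ 2 * β := by
          have : 0 ≤ 1 + δ * Λ := by positivity
          gcongr
        -- The cruder exponent `2 * Λ` lets the new second order term join the factor common to the
        -- bound on `B`.
        have h2 : ℓ ≤ L * Real.exp (2 * Λ * (t - s)) := by
          rw [hℓ]
          have h3 : (Λ : ℝ) * (t - s') ≤ 2 * Λ * (t - s) := by
            rw [hts]
            nlinarith [mul_nonneg (NNReal.coe_nonneg Λ) hu, mul_nonneg (NNReal.coe_nonneg Λ) hδ0]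
          gcongr
        have h4 : δ * Λ₂ * ℓ ≤ δ * Λ₂ * (L * Real.exp (2 * Λ * (t - s))) := by gcongr
        calc (1 + δ * Λ) ^ 2 * β + δ * Λ₂ * ℓ
            ≤ Real.exp (Λ * δ) ^ 2 * β + δ * Λ₂ * (L * Real.exp (2 * Λ * (t - s))) :=
              add_le_add h1 h4
          _ = Real.exp (Λ * δ) ^ 2 * Real.exp (2 * Λ * (t - s')) * (B + (t - s') * Λ₂ * L) +
              δ * Λ₂ * (L * Real.exp (2 * Λ * (t - s))) := by rw [hβ]; ring
          _ = _ := by rw [← e, hts]; ring)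
    have hR := ih hk' _ htest
    have main := abs_integral_sub_le_of_euler_step hμ hν hG hM hg hgc hgl hgW hgM hΛ₂ hqc hq hψ hβ0
      (s := s) (t := s')
      (R := L₁ * Λ * (∫ r in (0 : ℝ)..s, q r) + (2 * L₁ * ε + C * δ) * s)
      (hsT k hk') (hsT _ hk) hle (by rw [hss']; exact hR)
    refine main.trans ?_
    rw [hss']
    have hI : (∫ r in (0 : ℝ)..s', q r) = (∫ r in (0 : ℝ)..s, q r) + ∫ r in s..s', q r :=
      (intervalIntegral.integral_add_adjacent_intervals (hqc.intervalIntegrable _ _)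
        (hqc.intervalIntegrable _ _)).symm
    have hI0 : 0 ≤ ∫ r in s..s', q r := intervalIntegral.integral_nonneg hle fun r _ => hq0 r
    have m1 : ℓ * Λ * (∫ r in s..s', q r) ≤ L₁ * Λ * ∫ r in s..s', q r := by gcongr
    have m2 : 2 * ℓ * ε * δ ≤ 2 * L₁ * ε * δ := by gcongr
    have m3 : 4 * (β * M + ℓ * Λ) * M * δ ^ 2 ≤ C * δ ^ 2 := by rw [hC]; gcongr
    have e3 : (2 * L₁ * ε + C * δ) * s' =
        (2 * L₁ * ε + C * δ) * s + (2 * L₁ * ε + C * δ) * δ := by rw [hstep]; ring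
    rw [hI, e3]
    linarith

/-- Improvement of a bound for the distance between two weak solutions. -/
theorem abs_integral_sub_le_half
    (hμ : IsAggregationSolution T W μ) (hν : IsAggregationSolution T W ν) (h0 : μ 0 = ν 0)
    (hΛ : 1 ≤ Λ) (hG : LipschitzWith Λ (∇ W)) (hGc : HasCompactSupport (∇ W))
    (hM : ∀ z, ‖∇ W z‖ ≤ M) {m α : ℝ} (hm : 0 ≤ m) (hα : α = 2 * (Λ * Real.exp (Λ * T)))
    (hq : ∀ r ∈ Icc 0 T, ∀ φ : RSpace d → ℝ, ∀ L : ℝ, ContDiff ℝ ∞ φ → HasCompactSupport φ →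
      (∀ x, ‖fderiv ℝ φ x‖ ≤ L) →
        |∫ x, φ x ∂(μ r) - ∫ x, φ x ∂(ν r)| ≤ L * (m * Real.exp (α * r))) :
    ∀ r ∈ Icc 0 T, ∀ φ : RSpace d → ℝ, ∀ L : ℝ, ContDiff ℝ ∞ φ → HasCompactSupport φ →
      (∀ x, ‖fderiv ℝ φ x‖ ≤ L) →
        |∫ x, φ x ∂(μ r) - ∫ x, φ x ∂(ν r)| ≤ L * (m / 2 * Real.exp (α * r)) := by
  intro t ht φ L hφ hφc hφL
  have hL0 : 0 ≤ L := (norm_nonneg _).trans (hφL 0)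
  have hΛ0 : (0 : ℝ) < Λ := by
    have : (1 : ℝ) ≤ Λ := by exact_mod_cast hΛ
    linarith
  have hα0 : 0 < α := by rw [hα]; positivity
  have hqc : Continuous fun r => m * Real.exp (α * r) := by fun_prop
  obtain ⟨B, hB⟩ := (hφ.fderiv_right (m := ∞) (by simp)).lipschitzWith_of_hasCompactSupport
    (hφc.fderiv ℝ) (by simp)
  have hφt : IsTestFunction φ L B := ⟨hφ, hφc, hφL, fun x y => by
    have := hB.dist_le_mul x y
    rwa [dist_eq_norm, dist_eq_norm] at this⟩
  set L₁ := L * Real.exp (Λ * T) with hL₁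
  -- The order of limits matters: `Λ₂`, hence `C`, depends on the mollified field `g`. The number of
  -- steps tends to infinity for fixed `ε`, and only afterwards does `ε` tend to `0`.
  have key : ∀ ε ∈ Ioc (0 : ℝ) 1, |∫ x, φ x ∂(μ t) - ∫ x, φ x ∂(ν t)| ≤
      L₁ * Λ * (∫ r in (0 : ℝ)..t, m * Real.exp (α * r)) + 2 * L₁ * ε * t := by
    intro ε hε
    obtain ⟨g, hg, hgc, hgl, hgW⟩ := hG.exists_contDiff_approx hGc hε.1
    have hgM : ∀ z, ‖g z‖ ≤ ((M + 1 : ℝ≥0) : ℝ) := fun z => by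
      have h1 := norm_le_norm_add_norm_sub' (g z) (∇ W z)
      have h2 := hgW z
      have h3 := hM z
      push_cast
      linarith [hε.2]
    have hM1 : ∀ z, ‖∇ W z‖ ≤ ((M + 1 : ℝ≥0) : ℝ) := fun z => by
      push_cast; linarith [hM z]
    obtain ⟨Λ₂, hΛ₂0, hΛ₂⟩ := exists_isSmoothField_fieldConv hg hgc hgl hgM
    set C := 4 * (Real.exp (2 * Λ * T) * (B + T * Λ₂ * L) * (M + 1 : ℝ≥0) + L₁ * Λ) * (M + 1 : ℝ≥0)
      with hC
    have hn : ∀ n : ℕ, n ≠ 0 → |∫ x, φ x ∂(μ t) - ∫ x, φ x ∂(ν t)| ≤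
        L₁ * Λ * (∫ r in (0 : ℝ)..t, m * Real.exp (α * r)) + (2 * L₁ * ε + C * (t / n)) * t := by
      intro n hn
      have hnt : (n : ℝ) * (t / n) = t := by
        have : (n : ℝ) ≠ 0 := by exact_mod_cast hn
        field_simp
      have := abs_integral_sub_le_of_euler_iterate hμ hν h0 hG hM1 hg hgc hgl hε.1.le hgW hgM hΛ₂0
        hΛ₂ hqc (fun r => by positivity) hq hL0 B.2 ht hn hL₁ rfl hC n le_rfl φ (by
          rw [hnt]; simpa using hφt)
      rwa [hnt] at this
    have hlim : Tendsto (fun n : ℕ => L₁ * Λ * (∫ r in (0 : ℝ)..t, m * Real.exp (α * r)) +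
        (2 * L₁ * ε + C * (t / n)) * t) atTop
        (𝓝 (L₁ * Λ * (∫ r in (0 : ℝ)..t, m * Real.exp (α * r)) + (2 * L₁ * ε + C * 0) * t)) :=
      (((tendsto_const_div_atTop_nhds_zero_nat t).const_mul C).const_add _ |>.mul_const t).const_add _
    have := ge_of_tendsto hlim ((eventually_ne_atTop 0).mono fun n h => hn n h)
    simpa using this
  have hlim : Tendsto (fun ε : ℝ => L₁ * Λ * (∫ r in (0 : ℝ)..t, m * Real.exp (α * r)) +
      2 * L₁ * ε * t) (𝓝[>] 0)
      (𝓝 (L₁ * Λ * (∫ r in (0 : ℝ)..t, m * Real.exp (α * r)) + 2 * L₁ * 0 * t)) := by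
    have : Continuous fun ε : ℝ => L₁ * Λ * (∫ r in (0 : ℝ)..t, m * Real.exp (α * r)) +
      2 * L₁ * ε * t := by fun_prop
    exact (this.tendsto 0).mono_left nhdsWithin_le_nhds
  have h1 := ge_of_tendsto hlim (by
    filter_upwards [Ioc_mem_nhdsGT (zero_lt_one' ℝ)] with ε hε using key ε hε)
  have h2 : (∫ r in (0 : ℝ)..t, m * Real.exp (α * r)) = m / α * (Real.exp (α * t) - 1) := by
    rw [intervalIntegral.integral_const_mul, intervalIntegral.integral_comp_mul_left _ hα0.ne',
      integral_exp]
    simp only [mul_zero, Real.exp_zero, smul_eq_mul]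
    ring
  rw [h2] at h1
  refine h1.trans ?_
  -- The rate `α` is chosen so that `L₁ * Λ / α = L / 2`.
  have h3 : L₁ * Λ * (m / α * (Real.exp (α * t) - 1)) = L * (m / 2 * (Real.exp (α * t) - 1)) := by
    rw [hL₁, hα]; field_simp
  rw [h3]
  have : 0 ≤ L * (m / 2) := by positivity
  nlinarith

/-- Uniqueness of weak solutions of the aggregation equation. -/
theorem IsAggregationSolution.unique (hT : 0 ≤ T)
    (hμ : IsAggregationSolution T W μ) (hν : IsAggregationSolution T W ν) (h0 : μ 0 = ν 0)
    (hG : LipschitzWith Λ (∇ W)) (hGc : HasCompactSupport (∇ W)) (hM : ∀ z, ‖∇ W z‖ ≤ M)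
    {t : ℝ} (ht : t ∈ Icc 0 T) : μ t = ν t := by
  have h0T : (0 : ℝ) ∈ Icc 0 T := ⟨le_rfl, hT⟩
  set Λ' : ℝ≥0 := max 1 Λ
  have hG' : LipschitzWith Λ' (∇ W) := hG.weaken (le_max_right _ _)
  set α : ℝ := 2 * (Λ' * Real.exp (Λ' * T)) with hα
  have hα0 : 0 ≤ α := by positivity
  -- The starting bound `2 * M * T` holds because each solution moves at speed at most `M` from the
  -- same datum; every round of `abs_integral_sub_le_half` then halves it.
  have key : ∀ n : ℕ, ∀ r ∈ Icc 0 T, ∀ φ : RSpace d → ℝ, ∀ L : ℝ, ContDiff ℝ ∞ φ →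
      HasCompactSupport φ → (∀ x, ‖fderiv ℝ φ x‖ ≤ L) →
        |∫ x, φ x ∂(μ r) - ∫ x, φ x ∂(ν r)| ≤ L * (2 * M * T * (1 / 2) ^ n * Real.exp (α * r)) := by
    intro n
    induction n with
    | zero =>
      intro r hr φ L hφ hφc hL
      have hL0 : 0 ≤ L := (norm_nonneg _).trans (hL 0)
      have h1 := hμ.abs_integral_sub_le hG hM hφ hφc hL h0T hr hr.1
      have h2 := hν.abs_integral_sub_le hG hM hφ hφc hL h0T hr hr.1
      rw [h0] at h1
      have h3 : 1 ≤ Real.exp (α * r) := Real.one_le_exp (mul_nonneg hα0 hr.1)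
      have h4 : L * M * (r - 0) ≤ L * M * T := by
        rw [sub_zero]; gcongr; exact hr.2
      have h5 : |∫ x, φ x ∂(μ r) - ∫ x, φ x ∂(ν r)| ≤ 2 * (L * M * T) := by
        rw [abs_le] at *
        constructor <;> linarith [h1.1, h1.2, h2.1, h2.2]
      refine h5.trans ?_
      have h6 : 0 ≤ L * M * T := by positivity
      rw [pow_zero, mul_one]
      nlinarith
    | succ n ih =>
      have := abs_integral_sub_le_half hμ hν h0 (le_max_left _ _) hG' hGc hM (by positivity) hα ih
      intro r hr φ L hφ hφc hL
      refine (this r hr φ L hφ hφc hL).trans_eq ?_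
      rw [pow_succ]; ring
  have hp1 := (hμ.1 t ht).1.1
  have hp2 := (hν.1 t ht).1.1
  refine Measure.ext_of_integral_testFunction fun φ hφ hφc => ?_
  obtain ⟨L, -, -, hL, -⟩ := exists_testFunction_bounds hφ hφc
  have hlim : Tendsto (fun n : ℕ => (L : ℝ) * (2 * M * T * (1 / 2) ^ n * Real.exp (α * t))) atTop
      (𝓝 (L * (2 * M * T * 0 * Real.exp (α * t)))) :=
    (((tendsto_pow_atTop_nhds_zero_of_lt_one (by norm_num) (by norm_num)).const_mul _).mul_const
      _).const_mul _
  have h1 := ge_of_tendsto' hlim fun n => key n t ht φ L hφ hφc fun x => by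
    rw [← norm_gradient_eq]; exact hL x
  simp only [mul_zero, zero_mul] at h1
  exact sub_eq_zero.1 (abs_nonpos_iff.1 h1)

end uniqueness

/-! ### Identification of the potential -/

section identification

variable {d : ℕ} {T : ℝ} {M : ℝ≥0} {K : Set (RSpace d)} {W Ψ : RSpace d → ℝ}

/-- The squared `L²(μ)` norm of `H * μ`. -/
noncomputable def convEnergy (H : RSpace d → RSpace d) (μ : Measure (RSpace d)) : ℝ :=
  ∫ x, ‖fieldConv H μ x‖ ^ 2 ∂μ

theorem abs_sq_norm_sub_sq_norm_le {E : Type*} [NormedAddCommGroup E] {C : ℝ} {a b : E}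
    (ha : ‖a‖ ≤ C) (hb : ‖b‖ ≤ C) : |‖a‖ ^ 2 - ‖b‖ ^ 2| ≤ 2 * C * ‖a - b‖ := by
  rw [sq_sub_sq, abs_mul, abs_of_nonneg (by positivity)]
  exact mul_le_mul (by linarith) (abs_norm_sub_norm_le a b) (abs_nonneg _)
    (by linarith [norm_nonneg a])

theorem XClass.lipschitz_gradient_sub (hΨ : Ψ ∈ XClass M K) (hW : W ∈ XClass M K) :
    LipschitzWith (gradLip d M + gradLip d M) (fun z => ∇ Ψ z - ∇ W z) :=
  (XClass.lipschitz_gradient hΨ).sub (XClass.lipschitz_gradient hW)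

theorem XClass.norm_gradient_sub_le (hΨ : Ψ ∈ XClass M K) (hW : W ∈ XClass M K) (z : RSpace d) :
    ‖∇ Ψ z - ∇ W z‖ ≤ ((M + M : ℝ≥0) : ℝ) := by
  push_cast
  exact (norm_sub_le _ _).trans
    (add_le_add (XClass.norm_gradient_le hΨ z) (XClass.norm_gradient_le hW z))

theorem XClass.gradConv_sub (hΨ : Ψ ∈ XClass M K) (hW : W ∈ XClass M K) (μ : Measure (RSpace d))
    [IsProbabilityMeasure μ] (x : RSpace d) :
    gradConv Ψ μ x - gradConv W μ x = fieldConv (fun z => ∇ Ψ z - ∇ W z) μ x :=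
  (integral_sub
    (integrable_fieldConv (XClass.lipschitz_gradient hΨ) (XClass.norm_gradient_le hΨ) x)
    (integrable_fieldConv (XClass.lipschitz_gradient hW) (XClass.norm_gradient_le hW) x)).symm

theorem XClass.errorFunctional_eq (hT : 0 ≤ T) (hΨ : Ψ ∈ XClass M K) (hW : W ∈ XClass M K)
    {μ : ℝ → Measure (RSpace d)} (hμ : IsP2Curve T μ) :
    errorFunctional T W μ Ψ =
      (1 / T) * ∫ t in (0 : ℝ)..T, convEnergy (fun z => ∇ Ψ z - ∇ W z) (μ t) := by
  rw [errorFunctional]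
  congr 1
  refine intervalIntegral.integral_congr fun t ht => ?_
  rw [uIcc_of_le hT] at ht
  have := (hμ t ht).1.1
  simp only [convEnergy]
  simp_rw [XClass.gradConv_sub hΨ hW (μ t)]

theorem enorm_convEnergy_sub_le {H H' : RSpace d → RSpace d} {Λ C η : ℝ≥0}
    (hH : LipschitzWith Λ H) (hC : ∀ z, ‖H z‖ ≤ C) (hH' : LipschitzWith Λ H')
    (hC' : ∀ z, ‖H' z‖ ≤ C) (h : ∀ z, ‖H z - H' z‖ ≤ η) (μ ν : Measure (RSpace d))
    [IsProbabilityMeasure μ] [IsProbabilityMeasure ν] :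
    ‖convEnergy H μ - convEnergy H' ν‖ₑ ≤
      (2 * C * (1 + 2 * Λ) : ℝ≥0) * d2 μ ν + (2 * C * η : ℝ≥0) :=
  enorm_integral_comp_fieldConv_sub_le (Θ := fun _ a => ‖a‖ ^ 2) (C := 2 * C) (B := (C : ℝ) ^ 2)
    (fun x y a b ha hb => (abs_sq_norm_sub_sq_norm_le ha hb).trans (by
      push_cast
      gcongr
      linarith [norm_nonneg (x - y)]))
    (fun x a ha => by
      rw [norm_pow, norm_norm]
      gcongr)
    hH hC hH' hC' h

theorem IsP2Curve.continuousOn_convEnergy {μ : ℝ → Measure (RSpace d)} (hμ : IsP2Curve T μ)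
    {H : RSpace d → RSpace d} {Λ C : ℝ≥0} (hH : LipschitzWith Λ H) (hC : ∀ z, ‖H z‖ ≤ C) :
    ContinuousOn (fun t => convEnergy H (μ t)) (Icc 0 T) :=
  hμ.continuousOn_integral_comp_fieldConv (Θ := fun _ a => ‖a‖ ^ 2) (C := 2 * C)
    (B := (C : ℝ) ^ 2)
    (fun x y a b ha hb => (abs_sq_norm_sub_sq_norm_le ha hb).trans (by
      push_cast
      gcongr
      linarith [norm_nonneg (x - y)]))
    (fun x a ha => by
      rw [norm_pow, norm_norm]
      gcongr)
    hH hC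

theorem convEnergy_nonneg (H : RSpace d → RSpace d) (μ : Measure (RSpace d)) :
    0 ≤ convEnergy H μ := integral_nonneg fun _ => by positivity

/-- Continuity in time turns a vanishing time average into a statement at every time, not just
almost every one. -/
theorem eq_zero_of_intervalIntegral_le_zero {g : ℝ → ℝ} (hT : 0 < T)
    (hg : ContinuousOn g (Icc 0 T)) (h0 : ∀ t, 0 ≤ g t) (hi : ∫ t in (0 : ℝ)..T, g t ≤ 0) {t : ℝ}
    (ht : t ∈ Icc 0 T) : g t = 0 := by
  by_contra hne
  have := intervalIntegral.integral_pos hT hg (fun t _ => h0 t)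
    ⟨t, ht, lt_of_le_of_ne (h0 t) (Ne.symm hne)⟩
  linarith

theorem XClass.ae_eq_of_convEnergy_eq_zero (hΨ : Ψ ∈ XClass M K) (hW : W ∈ XClass M K)
    {μ : Measure (RSpace d)} [IsProbabilityMeasure μ]
    (h : convEnergy (fun z => ∇ Ψ z - ∇ W z) μ = 0) : gradConv Ψ μ =ᵐ[μ] gradConv W μ := by
  have hl := lipschitz_fieldConv (μ := μ) (XClass.lipschitz_gradient_sub hΨ hW)
    (XClass.norm_gradient_sub_le hΨ hW)
  have hi : Integrable (fun x => ‖fieldConv (fun z => ∇ Ψ z - ∇ W z) μ x‖ ^ 2) μ := by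
    refine Integrable.of_bound (hl.continuous.norm.pow 2).aestronglyMeasurable
      (((M + M : ℝ≥0) : ℝ) ^ 2) (Eventually.of_forall fun x => ?_)
    rw [norm_pow, norm_norm]
    gcongr
    exact norm_fieldConv_le (XClass.norm_gradient_sub_le hΨ hW) x
  filter_upwards [(integral_eq_zero_iff_of_nonneg (fun x => by positivity) hi).1 h] with x hx
  rw [← sub_eq_zero, XClass.gradConv_sub hΨ hW]
  simpa using hx

/-- The weak formulation sees the potential only through its convolved gradient, almost everywhere
for `μ t`. Potentials indistinguishable along a curve can thus be exchanged before invoking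
uniqueness. -/
theorem IsAggregationSolution.congr_potential {μ : ℝ → Measure (RSpace d)}
    (hμ : IsAggregationSolution T W μ)
    (h : ∀ t ∈ Icc 0 T, gradConv Ψ (μ t) =ᵐ[μ t] gradConv W (μ t)) :
    IsAggregationSolution T Ψ μ := by
  refine ⟨hμ.1, fun φ hφ hc t ht => (hμ.2 φ hφ hc t ht).trans ?_⟩
  congr 1
  refine intervalIntegral.integral_congr fun s hs => ?_
  rw [uIcc_of_le ht.1] at hs
  refine integral_congr_ae ?_
  filter_upwards [h s ⟨hs.1, hs.2.trans ht.2⟩] with x hx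
  rw [hx]

/-- The minimizers of the particle error functionals identify the field on the limit measure. -/
theorem convEnergy_eq_zero_of_isMinOn (hT : 0 < T) (hW : W ∈ XClass M K)
    {A : ℕ → Set (RSpace d → ℝ)} (hAX : ∀ N, A N ⊆ XClass M K)
    (hA : UniformlyApproximating K (XClass M K) A) {What : ℕ → RSpace d → ℝ}
    (hWhat : ∀ N, What N ∈ A N) {Wbar : RSpace d → ℝ} (hWbar : Wbar ∈ XClass M K)
    (hlim : TendstoUniformlyOn What Wbar atTop K) {U : ℕ → RSpace d → ℝ}
    (hU : ∀ N, U N ∈ XClass M K) {y : (N : ℕ) → ℝ → Fin N → RSpace d}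
    (hy : ∀ N, IsParticleSolution T (U N) (y N))
    (hmin : ∀ N, IsMinOn (errorFunctional T W (fun t => empiricalMeasure (y N t)))
      (A N) (What N))
    {μ : ℝ → Measure (RSpace d)} (hμ : IsP2Curve T μ)
    (hd : Tendsto (fun N => ⨆ t ∈ Icc 0 T, d2 (empiricalMeasure (y N t)) (μ t)) atTop (𝓝 0))
    {t : ℝ} (ht : t ∈ Icc 0 T) : convEnergy (fun z => ∇ Wbar z - ∇ W z) (μ t) = 0 := by
  -- Competitors approximating the true potential; their particle errors tend to zero.
  obtain ⟨β, hβA, hβ⟩ := hA W hW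
  have hWX : ∀ N, What N ∈ XClass M K := fun N => hAX N (hWhat N)
  have hβX : ∀ N, β N ∈ XClass M K := fun N => hAX N (hβA N)
  have hg1 := XClass.tendstoUniformly_gradient hWX hWbar hlim
  have hg2 := XClass.tendstoUniformly_gradient hβX hW hβ
  have hcont := hμ.continuousOn_convEnergy (XClass.lipschitz_gradient_sub hWbar hW)
    (XClass.norm_gradient_sub_le hWbar hW)
  refine eq_zero_of_intervalIntegral_le_zero hT hcont (fun t => convEnergy_nonneg _ _) ?_ ht
  set C : ℝ≥0 := M + M with hC
  set Λ : ℝ≥0 := gradLip d M + gradLip d M with hΛ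
  -- The first term is the cost of passing from the limit curve and `Wbar` to the particles and
  -- `What N`; the second bounds the error of the competitor `β N`. Minimality links the two.
  have key : ∀ ε : ℝ≥0, 0 < ε → ∫ t in (0 : ℝ)..T, convEnergy (fun z => ∇ Wbar z - ∇ W z) (μ t) ≤
      (ε + 2 * C * ε) * T + ε ^ 2 * T := by
    intro ε hε
    have hd' : Tendsto (fun N => ((2 * C * (1 + 2 * Λ) : ℝ≥0) : ℝ≥0∞) *
        ⨆ t ∈ Icc 0 T, d2 (empiricalMeasure (y N t)) (μ t)) atTop (𝓝 0) := by
      simpa using ENNReal.Tendsto.const_mul (a := ((2 * C * (1 + 2 * Λ) : ℝ≥0) : ℝ≥0∞)) hd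
        (Or.inr ENNReal.coe_ne_top)
    obtain ⟨N, h1, h2, h3, hN⟩ := ((Metric.tendstoUniformly_iff.1 hg1 ε hε).and
      ((Metric.tendstoUniformly_iff.1 hg2 ε hε).and
      ((hd'.eventually (gt_mem_nhds (ENNReal.coe_pos.2 hε))).and
      (eventually_ne_atTop 0)))).exists
    have hyc := (hy N).isP2Curve hT.le hN (XClass.lipschitz_gradient (hU N))
      (XClass.norm_gradient_le (hU N))
    have hcontN := hyc.continuousOn_convEnergy (XClass.lipschitz_gradient_sub (hWX N) hW)
      (XClass.norm_gradient_sub_le (hWX N) hW)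
    have hle : ∀ t ∈ Icc 0 T, convEnergy (fun z => ∇ Wbar z - ∇ W z) (μ t) ≤
        convEnergy (fun z => ∇ (What N) z - ∇ W z) (empiricalMeasure (y N t)) +
          (ε + 2 * C * ε) := by
      intro t ht
      have hp1 := (hyc t ht).1.1
      have hp2 := (hμ t ht).1.1
      have h4 := enorm_convEnergy_sub_le (η := ε) (XClass.lipschitz_gradient_sub (hWX N) hW)
        (XClass.norm_gradient_sub_le (hWX N) hW) (XClass.lipschitz_gradient_sub hWbar hW)
        (XClass.norm_gradient_sub_le hWbar hW) (fun z => by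
          rw [sub_sub_sub_cancel_right, ← dist_eq_norm, dist_comm]
          exact (h1 z).le) (empiricalMeasure (y N t)) (μ t)
      have h5 : d2 (empiricalMeasure (y N t)) (μ t) ≤
          ⨆ t ∈ Icc 0 T, d2 (empiricalMeasure (y N t)) (μ t) :=
        le_iSup₂ (f := fun t _ => d2 (empiricalMeasure (y N t)) (μ t)) t ht
      have h6 := h4.trans (add_le_add_left ((mul_le_mul_right h5 _).trans h3.le) _)
      rw [← ENNReal.coe_add, enorm_le_coe] at h6
      have h7 : |convEnergy (fun z => ∇ (What N) z - ∇ W z) (empiricalMeasure (y N t)) -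
        convEnergy (fun z => ∇ Wbar z - ∇ W z) (μ t)| ≤ ε + 2 * C * ε := by
        rw [← Real.norm_eq_abs]; exact_mod_cast h6
      linarith [(abs_le.1 h7).1]
    have hi1 := hcont.intervalIntegrable_of_Icc (μ := volume) hT.le
    have hi2 := hcontN.intervalIntegrable_of_Icc (μ := volume) hT.le
    have h8 := intervalIntegral.integral_mono_on hT.le hi1
      (hi2.add (intervalIntegrable_const (c := (ε + 2 * C * ε : ℝ)))) hle
    rw [intervalIntegral.integral_add hi2 intervalIntegrable_const,
      intervalIntegral.integral_const, sub_zero, smul_eq_mul] at h8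
    have h9 := (hmin N) (hβA N)
    simp only [mem_ofPred_eq] at h9
    rw [XClass.errorFunctional_eq hT.le (hWX N) hW hyc,
      XClass.errorFunctional_eq hT.le (hβX N) hW hyc] at h9
    have h10 := le_of_mul_le_mul_left h9 (by positivity)
    have h11 : ∫ t in (0 : ℝ)..T, convEnergy (fun z => ∇ (β N) z - ∇ W z)
        (empiricalMeasure (y N t)) ≤ ε ^ 2 * T := by
      refine (le_abs_self _).trans ?_
      rw [← Real.norm_eq_abs]
      refine (intervalIntegral.norm_integral_le_of_norm_le_const (C := (ε : ℝ) ^ 2)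
        fun t ht => ?_).trans_eq (by rw [sub_zero, abs_of_pos hT])
      rw [uIoc_of_le hT.le] at ht
      have hp1 := (hyc t (Ioc_subset_Icc_self ht)).1.1
      refine (norm_integral_le_of_norm_le_const (C := (ε : ℝ) ^ 2)
        (Eventually.of_forall fun x => ?_)).trans (by simp)
      rw [norm_pow, norm_norm]
      gcongr
      refine norm_fieldConv_le (fun z => ?_) x
      rw [← dist_eq_norm, dist_comm]
      exact (h2 z).le
    linarith
  have hlim0 : Tendsto (fun ε : ℝ => (ε + 2 * C * ε) * T + ε ^ 2 * T) (𝓝[>] 0)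
      (𝓝 ((0 + 2 * C * 0) * T + 0 ^ 2 * T)) := by
    have : Continuous fun ε : ℝ => (ε + 2 * C * ε) * T + ε ^ 2 * T := by fun_prop
    exact (this.tendsto 0).mono_left nhdsWithin_le_nhds
  have := ge_of_tendsto hlim0 (by
    filter_upwards [self_mem_nhdsWithin] with ε hε using key ⟨ε, le_of_lt hε⟩ hε)
  simpa using this

/-- Zero error forces the time integral of the kernel discrepancy to vanish. This discrepancy is
`fieldConv` of a scalar Lipschitz kernel integrated against `μ t`, hence continuous in time, and
Fubini concludes. -/
theorem XClass.ae_prod_eq_of_kernelCoercive (hT : 0 < T) (hΨ : Ψ ∈ XClass M K)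
    (hW : W ∈ XClass M K) {μ : ℝ → Measure (RSpace d)} (hμ : IsP2Curve T μ)
    (h0 : ∀ t ∈ Icc 0 T, convEnergy (fun z => ∇ Ψ z - ∇ W z) (μ t) = 0)
    (hk : KernelCoercive T W μ Ψ) {t : ℝ} (ht : t ∈ Icc 0 T) :
    ∀ᵐ p ∂((μ t).prod (μ t)), ∇ Ψ (p.1 - p.2) = ∇ W (p.1 - p.2) := by
  obtain ⟨c, hc, hck⟩ := hk
  rw [XClass.errorFunctional_eq hT.le hΨ hW hμ] at hck
  have hzero : ∫ t in (0 : ℝ)..T, convEnergy (fun z => ∇ Ψ z - ∇ W z) (μ t) = 0 := by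
    rw [intervalIntegral.integral_congr (g := fun _ => (0 : ℝ)) fun t ht => ?_]
    · simp
    · rw [uIcc_of_le hT.le] at ht
      exact h0 t ht
  rw [hzero, mul_zero] at hck
  set H : RSpace d → ℝ := fun z => ‖∇ Ψ z - ∇ W z‖ ^ 2 with hH
  set C : ℝ≥0 := M + M
  set Λ : ℝ≥0 := gradLip d M + gradLip d M
  have hHl : LipschitzWith (2 * C * Λ) H := by
    refine LipschitzWith.of_dist_le_mul fun x y => ?_
    rw [Real.dist_eq]
    refine (abs_sq_norm_sub_sq_norm_le (XClass.norm_gradient_sub_le hΨ hW x)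
      (XClass.norm_gradient_sub_le hΨ hW y)).trans ?_
    have := (XClass.lipschitz_gradient_sub hΨ hW).dist_le_mul x y
    rw [dist_eq_norm] at this
    rw [NNReal.coe_mul, mul_assoc ((2 * C : ℝ≥0) : ℝ)]
    exact mul_le_mul_of_nonneg_left this (by positivity)
  have hHb : ∀ z, ‖H z‖ ≤ (C : ℝ) ^ 2 := fun z => by
    rw [hH, norm_pow, norm_norm]
    gcongr
    exact XClass.norm_gradient_sub_le hΨ hW z
  have hcont : ContinuousOn (fun t => ∫ x, fieldConv H (μ t) x ∂(μ t)) (Icc 0 T) :=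
    hμ.continuousOn_integral_comp_fieldConv (Θ := fun _ a => a) (C := 1) (B := (C : ℝ) ^ 2)
      (fun x y a b _ _ => by
        rw [NNReal.coe_one, one_mul]
        linarith [norm_nonneg (x - y)]) (fun _ _ ha => ha) hHl hHb
  have hnn : ∀ t, 0 ≤ ∫ x, fieldConv H (μ t) x ∂(μ t) := fun t =>
    integral_nonneg fun x => integral_nonneg fun y => by positivity
  have hint : ∫ t in (0 : ℝ)..T, ∫ x, fieldConv H (μ t) x ∂(μ t) ≤ 0 := by
    have h1 : c * (1 / T) * ∫ t in (0 : ℝ)..T, ∫ x, fieldConv H (μ t) x ∂(μ t) ≤ 0 := by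
      rw [mul_assoc]; exact hck
    exact nonpos_of_mul_nonpos_right h1 (by positivity)
  have hkt := eq_zero_of_intervalIntegral_le_zero hT hcont hnn hint ht
  have hp := (hμ t ht).1.1
  have hHc : Continuous fun p : RSpace d × RSpace d => H (p.1 - p.2) :=
    hHl.continuous.comp (continuous_fst.sub continuous_snd)
  have hi : Integrable (fun p : RSpace d × RSpace d => H (p.1 - p.2)) ((μ t).prod (μ t)) :=
    Integrable.of_bound hHc.aestronglyMeasurable ((C : ℝ) ^ 2) (Eventually.of_forall fun _ => hHb _)
  have h2 : ∫ p, H (p.1 - p.2) ∂((μ t).prod (μ t)) = 0 := by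
    rw [integral_prod _ hi]; exact hkt
  filter_upwards [(integral_eq_zero_iff_of_nonneg (fun p => by positivity) hi).1 h2] with p hp
  rw [← sub_eq_zero]
  simpa [hH] using hp

end identification

/-! ### Mean-field limit and identification combined -/

theorem mainTheorem2 {d : ℕ} (T : ℝ) (hT : 0 < T) (M : ℝ≥0)
    (K : Set (RSpace d)) (hK : IsCompact K)
    -- the true potential, and the sets of candidates
    (W : RSpace d → ℝ) (hW : W ∈ XClass M K)
    (A : ℕ → Set (RSpace d → ℝ)) (hAX : ∀ N, A N ⊆ XClass M K)
    (hA : UniformlyApproximating K (XClass M K) A)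
    -- the estimated potentials and their limit
    (What : ℕ → RSpace d → ℝ) (hWhat : ∀ N, What N ∈ A N)
    (Wbar : RSpace d → ℝ) (hWbar : Wbar ∈ XClass M K)
    (hlim : TendstoUniformlyOn What Wbar atTop K)
    -- the observed particles, driven by the true or by the estimated potential
    (U : ℕ → RSpace d → ℝ) (hU : (∀ N, U N = W) ∨ (∀ N, U N = What N))
    (y : (N : ℕ) → ℝ → Fin N → RSpace d) (hy : ∀ N, IsParticleSolution T (U N) (y N))
    (hmin : ∀ N, IsMinOn (errorFunctional T W (fun t => empiricalMeasure (y N t)))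
      (A N) (What N))
    -- the particle system driven by the estimated potentials, and its initial data
    (μhat₀ : Measure (RSpace d)) (hμhat₀ : MemP2 μhat₀)
    (hsupp : ∃ C : Set (RSpace d), IsCompact C ∧ μhat₀ Cᶜ = 0)
    (x₀ : (N : ℕ) → Fin N → RSpace d)
    (hx₀ : Tendsto (fun N => d2 (empiricalMeasure (x₀ N)) μhat₀) atTop (𝓝 0))
    (x : (N : ℕ) → ℝ → Fin N → RSpace d) (hx : ∀ N, IsParticleSolution T (What N) (x N))
    (hx_init : ∀ N, x N 0 = x₀ N) :
    ∃ μhat : ℝ → Measure (RSpace d),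
      -- the mean-field limit is the aggregation equation driven by the limit potential
      IsAggregationSolution T Wbar μhat ∧ μhat 0 = μhat₀ ∧
      (∀ ν : ℝ → Measure (RSpace d), IsAggregationSolution T Wbar ν → ν 0 = μhat₀ →
        ∀ t ∈ Icc 0 T, ν t = μhat t) ∧
      Tendsto (fun N => ⨆ t ∈ Icc 0 T, d2 (empiricalMeasure (x N t)) (μhat t)) atTop (𝓝 0) ∧
      -- identification of the potential for matching initial data
      ∀ μ : ℝ → Measure (RSpace d), IsAggregationSolution T W μ → μ 0 = μhat₀ →
        Tendsto (fun N => d2 (empiricalMeasure (y N 0)) (μ 0)) atTop (𝓝 0) →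
        (Coercive T W μ Wbar →
          (∀ t ∈ Icc 0 T, gradConv Wbar (μ t) =ᵐ[μ t] gradConv W (μ t)) ∧
          (∀ t ∈ Icc 0 T, μhat t = μ t)) ∧
        (KernelCoercive T W μ Wbar → ∀ t ∈ Icc 0 T,
          ∀ᵐ p ∂((μ t).prod (μ t)), ∇ Wbar (p.1 - p.2) = ∇ W (p.1 - p.2)) := by

  have hWX : ∀ N, What N ∈ XClass M K := fun N => hAX N (hWhat N)
  have hp := hμhat₀.1
  have flow : ∀ V ∈ XClass M K, ∃ X : ℝ → RSpace d → RSpace d, X 0 = id ∧ (∀ t, Continuous (X t)) ∧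
      ∀ t ∈ Icc 0 T, ∀ x, HasDerivWithinAt (fun s => X s x)
        (-fieldConv (∇ V) (μhat₀.map (X t)) (X t x)) (Icc 0 T) t := fun V hV =>
    exists_characteristic_flow hT.le (XClass.lipschitz_gradient hV) (XClass.norm_gradient_le hV) μhat₀
  have sol : ∀ V ∈ XClass M K, ∀ X : ℝ → RSpace d → RSpace d, X 0 = id → (∀ t, Continuous (X t)) →
      (∀ t ∈ Icc 0 T, ∀ x, HasDerivWithinAt (fun s => X s x)
        (-fieldConv (∇ V) (μhat₀.map (X t)) (X t x)) (Icc 0 T) t) →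
      IsAggregationSolution T V (fun t => μhat₀.map (X t)) := fun V hV X h0 hc hX =>
    isAggregationSolution_of_flow hT.le (XClass.lipschitz_gradient hV) (XClass.norm_gradient_le hV)
      hμhat₀ h0 hc hX
  have uniq : ∀ V ∈ XClass M K, ∀ μ ν : ℝ → Measure (RSpace d), IsAggregationSolution T V μ →
      IsAggregationSolution T V ν → μ 0 = ν 0 → ∀ t ∈ Icc 0 T, μ t = ν t :=
    fun V hV μ ν hμ hν h0 t ht => hμ.unique hT.le hν h0 (XClass.lipschitz_gradient hV)
      (XClass.hasCompactSupport_gradient hK hV) (XClass.norm_gradient_le hV) ht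
  have hgrad := XClass.tendstoUniformly_gradient hWX hWbar hlim
  obtain ⟨X, hX0, hXc, hX⟩ := flow Wbar hWbar
  have hsol := sol Wbar hWbar X hX0 hXc hX
  have hinit : μhat₀.map (X 0) = μhat₀ := by rw [hX0, Measure.map_id]
  refine ⟨fun t => μhat₀.map (X t), hsol, hinit, fun ν hν hν0 => ?_, ?_, fun μ hμ hμ0 hyd => ?_⟩
  · exact uniq Wbar hWbar ν _ hν hsol (hν0.trans hinit.symm)
  · exact tendsto_iSup_d2_flow hT.le hWX hWbar hgrad hx (by simpa only [hx_init] using hx₀)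
      hX0 hXc hX
  rw [hμ0] at hyd
  have hzero : ∀ t ∈ Icc 0 T, convEnergy (fun z => ∇ Wbar z - ∇ W z) (μ t) = 0 := by
    -- When the observed particles follow `W`, their limit is the flow solution driven by `W`, which
    -- is `μ` by uniqueness.
    rcases hU with hU | hU
    · obtain ⟨Y, hY0, hYc, hY⟩ := flow W hW
      have hsolY := sol W hW Y hY0 hYc hY
      have hinitY : μhat₀.map (Y 0) = μhat₀ := by rw [hY0, Measure.map_id]
      have hUX : ∀ N, U N ∈ XClass M K := fun N => by rw [hU N]; exact hW
      have hUg : TendstoUniformly (fun N => ∇ (U N)) (∇ W) atTop := by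
        simp only [hU]
        exact Metric.tendstoUniformly_iff.2 fun ε hε => Eventually.of_forall fun N z => by simpa
      have hd := tendsto_iSup_d2_flow hT.le hUX hW hUg hy hyd hY0 hYc hY
      intro t ht
      rw [uniq W hW μ _ hμ hsolY (hμ0.trans hinitY.symm) t ht]
      exact convEnergy_eq_zero_of_isMinOn hT hW hAX hA hWhat hWbar hlim hUX hy hmin hsolY.1 hd ht
    · have hUX : ∀ N, U N ∈ XClass M K := fun N => by rw [hU N]; exact hWX N
      have hUg : TendstoUniformly (fun N => ∇ (U N)) (∇ Wbar) atTop := by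
        simpa only [hU] using hgrad
      have hd := tendsto_iSup_d2_flow hT.le hUX hWbar hUg hy hyd hX0 hXc hX
      have hz : ∀ t ∈ Icc 0 T, convEnergy (fun z => ∇ Wbar z - ∇ W z) (μhat₀.map (X t)) = 0 :=
        fun t ht => convEnergy_eq_zero_of_isMinOn hT hW hAX hA hWhat hWbar hlim hUX hy hmin hsol.1
          hd ht
      -- Here the observed particles converge to the solution driven by `Wbar`, not yet known to be
      -- `μ`. Zero error on that curve allows the exchange of potentials, after which uniqueness for
      -- `W` applies.
      have hsolW : IsAggregationSolution T W (fun t => μhat₀.map (X t)) :=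
        hsol.congr_potential fun t ht => by
          have := (hsol.1 t ht).1.1
          exact (XClass.ae_eq_of_convEnergy_eq_zero hWbar hW (hz t ht)).symm
      intro t ht
      rw [uniq W hW μ _ hμ hsolW (hμ0.trans hinit.symm) t ht]
      exact hz t ht
  have hae : ∀ t ∈ Icc 0 T, gradConv Wbar (μ t) =ᵐ[μ t] gradConv W (μ t) := fun t ht => by
    have := (hμ.1 t ht).1.1
    exact XClass.ae_eq_of_convEnergy_eq_zero hWbar hW (hzero t ht)
  refine ⟨fun _ => ⟨hae, fun t ht => ?_⟩, fun hk t ht =>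
    XClass.ae_prod_eq_of_kernelCoercive hT hWbar hW hμ.1 hzero hk ht⟩
  exact uniq Wbar hWbar _ μ hsol (hμ.congr_potential hae) (hinit.trans hμ0.symm) t ht
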